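/- **Corollary (Regularised $\mathrm{IDS}_\eta$).** *Model.* Let $H,d,T\ge 1$, let $\mathcal S,\mathcal A$ be measurable spaces, $P$ a known transition kernel, $\rho$ the law of the first state, and $\phi:\mathcal S\times\mathcal A\to\mathbb R^d$ a known measurable feature map with $\|\phi\|_2\le 1$. The unknown parameter is $w=(w_1,\dots,w_H)$ with independent $w_h\sim\mathcal N(0,\lambda^{-1}I)$, $\lambda\ge1$. In each episode the state-action pairs are generated by $\rho$, $P$ and the policy, and at stage $h$ one observes $y_h=\phi(s_h,a_h)^\top w_h+\epsilon_h$ with independent $\epsilon_h\sim\mathcal N(0,1)$. The mean reward at stage $h$ is $g(\phi(s_h,a_h)^\top w_h)$ for a fixed $1$-Lipschitz $g:\mathbb R\to\mathbb R$ (for instance $g=\mathrm{id}$, the linear reward, or the clipping onto $[0,1]$), and $V_1^\pi(s;w)$ is the expected total reward of the Markov policy $\pi$ from $s_1=s$. Let $(\pi^*_w)_w$ be a measurable family of policies such that, for every $w$, $\pi^*_w$ maximises $V_1^\pi(s;w)$ over $\pi$ for every $s$. The candidate class $\mathcal C$ is a set of Markov policies that contains all $\pi^*_w$; $\Pi$ is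 its randomised closure, consisting of the policies that draw a member of $\mathcal C$ at random at the start of an episode. *Data.* The offline dataset $\mathcal D_N$ consists of $n_h\ge1$ state-action pairs with observations at each stage $h$, $N=\sum_h n_h$, and $\Lambda_{h,N}=\lambda I+\sum_{(s,a)\in\mathcal D_{N,h}}\phi(s,a)\phi(s,a)^\top$. Fix $\mathcal D_N$ and write $\mathbb E^{\mathrm{off}}$ for expectation given $\mathcal D_N$. Let $\mathcal H_t$ be generated by $\mathcal D_N$ and the first $t-1$ online episodes, let $\beta_t$ be the conditional law of $w$ given $\mathcal H_t$, and for a randomised policy $\pi$ let $$\Delta_t(\pi)=\mathbb E_{t,\pi}\bigl[V_1^{\pi^*_w}(s_{t,1};w)-V_1^\pi(s_{t,1};w)\bigr],\qquad I_t^w(\pi)=I(w;\tau_t\mid\mathcal H_t,\pi_t=\pi),$$ where $\tau_t$ is the observed $t$-th online episode. For $\eta>0$, $\mathrm{IDS}_\eta$ plays in episode $t$ (almost surely, for $t\le T$) an $\mathcal H_t$-measurable minimiser $\pi_t$ of $\Delta_t(\pi)^2/(I_t^w(\pi)+\eta)$ over $\pi\in\Pi$. Put $\mathrm{BayesRegret}^{\mathrm{off}}_T=\mathbb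 E^{\mathrm{off}}\bigl[\sum_{t=1}^T\Delta_t(\pi_t)\bigr]$, $$L_N(T)=\frac1H\sum_{h=1}^H\log\Bigl(1+\frac{T}{d\,\lambda_{\min}(\Lambda_{h,N})}\Bigr),\qquad C^\dagger_{\beta,\mathrm{IDS}_\eta}(N,T)=\frac NH\sum_{h=1}^H\frac{1}{n_h}\,\lambda_{\max}\bigl((\Lambda_{h,N}/n_h)^{-1/2}\,\overline\Sigma_h\,(\Lambda_{h,N}/n_h)^{-1/2}\bigr),$$ where $\overline\Sigma_h=\frac1T\sum_{t=1}^T\mathbb E^{\mathrm{off}}[\phi_{t,h}\phi_{t,h}^\top]$, $\phi_{t,h}=\phi(s_{t,h},a_{t,h})$, is the visitation covariance under $\mathrm{IDS}_\eta$ itself. *Claim.* For every $\eta>0$, $\sum_{t\le T}\Delta_t(\pi_t)$ is integrable given $\mathcal D_N$ and $$\mathrm{BayesRegret}_T^{\mathrm{off}}(\pi^{\mathrm{IDS}_\eta,w})\le \sqrt{\tfrac{2}{\log 2}}\;Hd\,\min\Bigl\{\sqrt{T\,L_N(T)},\;T\sqrt{C^\dagger_{\beta,\mathrm{IDS}_\eta}(N,T)/N}\Bigr\}+T\sqrt{C_w\,\eta},\qquad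 C_w=\frac{4Hd}{\log 2}.$$ In particular the first term is $\widetilde O\bigl(Hd\min\{\sqrt{T L_N(T)},\,T\sqrt{C^\dagger_{\beta,\mathrm{IDS}_\eta}(N,T)/N}\}\bigr)$, with an absolute constant and no logarithmic factor. -/

import Mathlib

open MeasureTheory ProbabilityTheory
open scoped ENNReal NNReal

namespace OffToOn

/-- Parameters `w = (w_1, …, w_H)` with `w_h ∈ ℝ^d`. -/
abbrev Param (H d : ℕ) : Type := Fin H → EuclideanSpace ℝ (Fin d)

/-- The state-action sequence `(s_1, a_1), …, (s_H, a_H)` of one episode. -/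
abbrev StateActions (S A : Type*) (H : ℕ) := Fin H → S × A

/-- An observed episode: its state-action sequence and the observations `y_1, …, y_H`. -/
abbrev Episode (S A : Type*) (H : ℕ) := StateActions S A H × (Fin H → ℝ)

/-- A Bayesian linear-reward model with known dynamics. The mean reward at stage `h` is
`link ⟨φ(s,a), w_h⟩`: with `link = id` the mean reward is exactly linear in `w_h`, and with `link`
the clipping onto `[0,1]` it is bounded in `[0,1]`. -/
structure BayesMDP (S A : Type*) [MeasurableSpace S] [MeasurableSpace A] (H d : ℕ) where
  /-- Law of the first state of an episode. -/
  init : Measure S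
  init_prob : IsProbabilityMeasure init
  /-- The known transition kernel. -/
  trans : Kernel (S × A) S
  trans_markov : IsMarkovKernel trans
  /-- The known feature map. -/
  φ : S × A → EuclideanSpace ℝ (Fin d)
  φ_measurable : Measurable φ
  φ_norm_le : ∀ x, ‖φ x‖ ≤ 1
  /-- The map from the linear predictor to the mean reward. -/
  link : ℝ → ℝ
  link_lipschitz : LipschitzWith 1 link
  /-- The prior precision `λ`. -/
  prec : ℝ
  one_le_prec : 1 ≤ prec

/-- The offline dataset: `n h ≥ 1` samples at stage `h`, each one a state-action pair with its
observation. -/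
structure OfflineData (S A : Type*) (H : ℕ) where
  n : Fin H → ℕ
  one_le_n : ∀ h, 1 ≤ n h
  pt : (h : Fin H) → Fin (n h) → S × A
  obs : (h : Fin H) → Fin (n h) → ℝ

/-- A measurable family of Markov policies `π = (π_1, …, π_H)`, `π_h : S → Δ(A)`, indexed by `X`. -/
structure PolicyFamily (S A : Type*) [MeasurableSpace S] [MeasurableSpace A] (H : ℕ)
    (X : Type*) [MeasurableSpace X] where
  act : Fin H → Kernel (X × S) A
  act_markov : ∀ h, IsMarkovKernel (act h)

/-- A single Markov policy. -/
abbrev Policy (S A : Type*) [MeasurableSpace S] [MeasurableSpace A] (H : ℕ) :=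
  PolicyFamily S A H Unit

/-- A measurable family, indexed by `X`, of randomised policies: at the start of the episode a seed
is drawn from `law x`, and then the Markov policy with that seed is played for the whole episode. -/
structure MixedFamily (S A : Type*) [MeasurableSpace S] [MeasurableSpace A] (H : ℕ)
    (X : Type*) [MeasurableSpace X] where
  Seed : Type
  seedSpace : MeasurableSpace Seed
  law : Kernel X Seed
  law_markov : IsMarkovKernel law
  fam : PolicyFamily S A H (X × Seed)

/-- A single randomised policy. -/
abbrev MixedPolicy (S A : Type*) [MeasurableSpace S] [MeasurableSpace A] (H : ℕ) :=
  MixedFamily S A H Unit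

/-- An online algorithm: for each number `t` of completed online episodes, a randomised policy
that depends measurably on these episodes. -/
abbrev Algorithm (S A : Type*) [MeasurableSpace S] [MeasurableSpace A] (H : ℕ) :=
  (t : ℕ) → MixedFamily S A H (Fin t → Episode S A H)

attribute [instance] BayesMDP.init_prob BayesMDP.trans_markov PolicyFamily.act_markov
  MixedFamily.seedSpace MixedFamily.law_markov

noncomputable section

/-- The mutual information `I(U; Y)` where `U ∼ μ` and `Y` has conditional law `κ u` given
`U = u`. -/
def mutualInfo {U Y : Type*} [MeasurableSpace U] [MeasurableSpace Y]
    (μ : Measure U) (κ : Kernel U Y) : ℝ≥0∞ :=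
  InformationTheory.klDiv (μ ⊗ₘ κ) (μ.prod (μ.bind κ))

/-- The smallest eigenvalue of a symmetric matrix. -/
def lambdaMin {d : ℕ} (B : Matrix (Fin d) (Fin d) ℝ) : ℝ := sInf (spectrum ℝ B)

/-- The largest eigenvalue of a symmetric matrix. -/
def lambdaMax {d : ℕ} (B : Matrix (Fin d) (Fin d) ℝ) : ℝ := sSup (spectrum ℝ B)

/-- `B^{-1/2}` for a symmetric positive definite matrix `B`. -/
def invSqrt {d : ℕ} (B : Matrix (Fin d) (Fin d) ℝ) : Matrix (Fin d) (Fin d) ℝ :=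
  cfc (fun x : ℝ => (√x)⁻¹) B

variable {S A : Type*} [MeasurableSpace S] [MeasurableSpace A] {H d : ℕ}

/-- The member of the family with index `x`. -/
def PolicyFamily.at {X : Type*} [MeasurableSpace X] (p : PolicyFamily S A H X) (x : X) :
    Policy S A H where
  act h := (p.act h).comap (fun z => (x, z.2)) (by fun_prop)
  act_markov _ := inferInstance

/-- The member of the family with index `x`. -/
def MixedFamily.at {X : Type*} [MeasurableSpace X] (p : MixedFamily S A H X) (x : X) :
    MixedPolicy S A H where
  Seed := p.Seed
  seedSpace := p.seedSpace
  law := Kernel.const Unit (p.law x)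
  law_markov := inferInstance
  fam :=
    { act := fun h => (p.fam.act h).comap (fun z => ((x, z.1.2), z.2)) (by fun_prop)
      act_markov := fun _ => inferInstance }

/-- The randomised policy belongs to the randomised closure of the class `C` of Markov policies. -/
def MixedFamily.InClosure (q : MixedPolicy S A H) (C : Set (Policy S A H)) : Prop :=
  ∀ᵐ u ∂(q.law ()), q.fam.at ((), u) ∈ C

namespace BayesMDP

variable (M : BayesMDP S A H d) {X : Type*} [MeasurableSpace X]

/-! ### Episodes -/

/-- Law of the state `s_{k+1}`, given the first state `s_1` (second component of `c.1`) and the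
first `k` state-action pairs `c.2`. -/
def nextState (X : Type*) [MeasurableSpace X] : (k : ℕ) → Kernel ((X × S) × (Fin k → S × A)) S
  | 0 => Kernel.deterministic (fun c => c.1.2) (by fun_prop)
  | k + 1 => M.trans.comap (fun c => c.2 (Fin.last k)) (by fun_prop)

/-- Law of the first `k` state-action pairs when the first state is `s` and the policy with index
`x` is played. -/
def prefixLaw (p : PolicyFamily S A H X) :
    (k : ℕ) → k ≤ H → Kernel (X × S) (Fin k → S × A)
  | 0, _ => Kernel.const _ (Measure.dirac Fin.elim0)
  | k + 1, hk =>
    ((prefixLaw p k (Nat.le_of_succ_le hk)) ⊗ₖ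
      ((M.nextState X k) ⊗ₖ
        ((p.act ⟨k, hk⟩).comap (fun c => (c.1.1.1, c.2)) (by fun_prop)))).map
      (fun z => Fin.snoc (α := fun _ => S × A) z.1 z.2)

/-- Law of the state-action sequence of an episode, given the first state and the policy. -/
def stateActionLaw (p : PolicyFamily S A H X) : Kernel (X × S) (StateActions S A H) :=
  M.prefixLaw p H le_rfl

/-- `V_1^π(s; w)`: the expected total reward under the parameter `w` of the policy with index `x`
when the first state is `s`. -/
def value (p : PolicyFamily S A H X) (x : X) (s : S) (w : Param H d) : ℝ :=
  ∫ z, ∑ h, M.link (inner ℝ (M.φ (z h)) (w h)) ∂(M.stateActionLaw p (x, s))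

/-- For every parameter `w`, the policy with index `w` maximises `V_1^π(s; w)` over all policies,
for every first state. -/
def IsOptimal (piStar : PolicyFamily S A H (Param H d)) : Prop :=
  ∀ (w : Param H d) (s : S) (π : Policy S A H), M.value π () s w ≤ M.value piStar w s w

/-- Law of the state-action sequence of an episode under a randomised policy. -/
def mixedStateActionLaw (p : MixedFamily S A H X) : Kernel X (StateActions S A H) :=
  (M.stateActionLaw p.fam) ∘ₖ ((Kernel.id ×ₖ p.law) ×ₖ Kernel.const X M.init)

/-- Law of an observed episode when the randomised policy with index `x` is played in the model
with parameter `w`: `y_h = ⟨φ(s_h, a_h), w_h⟩ + ε_h` with independent standard Gaussian noise. -/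
def episodeLaw (p : MixedFamily S A H X) : Kernel (X × Param H d) (Episode S A H) :=
  (Kernel.id ×ₖ
    (((M.mixedStateActionLaw p).comap Prod.fst measurable_fst) ×ₖ
      Kernel.const _ (Measure.pi fun _ : Fin H => gaussianReal 0 1))).map
    (fun z => (z.2.1, fun h => inner ℝ (M.φ (z.2.1 h)) (z.1.2 h) + z.2.2 h))

/-! ### Prior, offline data, online interaction -/

/-- The prior: independent `w_h ∼ N(0, λ⁻¹ I)`. -/
def prior : Measure (Param H d) :=
  Measure.pi fun _ => multivariateGaussian 0 (M.prec⁻¹ • (1 : Matrix (Fin d) (Fin d) ℝ))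

/-- The law of `w` given the offline data, by Bayes' rule for the Gaussian likelihood. -/
def offlinePosterior (D : OfflineData S A H) : Measure (Param H d) :=
  M.prior.tilted fun w =>
    -(∑ h, ∑ i : Fin (D.n h), (D.obs h i - inner ℝ (M.φ (D.pt h i)) (w h)) ^ 2 / 2)

/-- The joint law, conditional on the offline data, of the parameter `w` and of the first `t`
online episodes under the algorithm. -/
def jointLaw (D : OfflineData S A H) (alg : Algorithm S A H) :
    (t : ℕ) → Measure (Param H d × (Fin t → Episode S A H))
  | 0 => (M.offlinePosterior D).prod (Measure.dirac Fin.elim0)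
  | t + 1 =>
    ((jointLaw D alg t) ⊗ₘ ((M.episodeLaw (alg t)).comap Prod.swap measurable_swap)).map
      (fun z => (z.1.1, Fin.snoc (α := fun _ => Episode S A H) z.1.2 z.2))

lemma measurable_snoc {Z : Type*} [MeasurableSpace Z] (k : ℕ) :
    Measurable (fun z : (Fin k → Z) × Z => Fin.snoc (α := fun _ => Z) z.1 z.2) := by
  refine measurable_pi_lambda _ fun i => ?_
  refine Fin.lastCases ?_ (fun j => ?_) i
  · simpa using measurable_snd
  · simpa [Function.comp_def] using (measurable_pi_apply j).comp measurable_fst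

instance (k : ℕ) : IsMarkovKernel (M.nextState X k) := by
  cases k <;> (unfold nextState; infer_instance)

instance (p : PolicyFamily S A H X) (k : ℕ) (hk : k ≤ H) :
    IsMarkovKernel (M.prefixLaw p k hk) := by
  induction k with
  | zero => unfold prefixLaw; infer_instance
  | succ k ih =>
    have := ih (Nat.le_of_succ_le hk)
    unfold prefixLaw
    exact Kernel.IsMarkovKernel.map _ (measurable_snoc k)

instance (p : PolicyFamily S A H X) : IsMarkovKernel (M.stateActionLaw p) := by
  unfold stateActionLaw; infer_instance

instance (p : MixedFamily S A H X) : IsMarkovKernel (M.mixedStateActionLaw p) := by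
  unfold mixedStateActionLaw; infer_instance

instance (p : MixedFamily S A H X) : IsMarkovKernel (M.episodeLaw p) := by
  unfold episodeLaw
  refine Kernel.IsMarkovKernel.map _ ?_
  have := M.φ_measurable
  fun_prop

instance : IsProbabilityMeasure M.prior := by
  unfold prior; infer_instance

instance (D : OfflineData S A H) : IsProbabilityMeasure (M.offlinePosterior D) := by
  unfold offlinePosterior
  refine isProbabilityMeasure_tilted (Integrable.of_bound (C := 1) ?_ (ae_of_all _ fun w => ?_))
  · exact Measurable.aestronglyMeasurable (by fun_prop)
  · rw [Real.norm_eq_abs, Real.abs_exp, Real.exp_le_one_iff, neg_nonpos]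
    positivity

instance (D : OfflineData S A H) (alg : Algorithm S A H) (t : ℕ) :
    IsProbabilityMeasure (M.jointLaw D alg t) := by
  induction t with
  | zero => unfold jointLaw; infer_instance
  | succ t ih =>
    unfold jointLaw
    refine Measure.isProbabilityMeasure_map (Measurable.aemeasurable ?_)
    exact (measurable_fst.comp measurable_fst).prodMk ((measurable_snoc t).comp
      ((measurable_snd.comp measurable_fst).prodMk measurable_snd))

/-- The posterior: the conditional distribution of `w` given the offline data and the first `t`
online episodes. -/
def posterior (D : OfflineData S A H) (alg : Algorithm S A H) (t : ℕ) :
    Kernel (Fin t → Episode S A H) (Param H d) :=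
  condDistrib Prod.fst Prod.snd (M.jointLaw D alg t)

/-! ### Regret, information gain, information-directed sampling -/

/-- The expected regret of one episode played with the randomised policy `q`, for
`w ∼ β` and the first state drawn independently from its law. -/
def regret (piStar : PolicyFamily S A H (Param H d)) (β : Measure (Param H d))
    (q : MixedPolicy S A H) : ℝ :=
  ∫ w, ∫ s, (M.value piStar w s w - ∫ u, M.value q.fam ((), u) s w ∂(q.law ())) ∂M.init ∂β

/-- The mutual information between `w ∼ β` and an episode played with the randomised
policy `q`. -/
def infoGain (β : Measure (Param H d)) (q : MixedPolicy S A H) : ℝ≥0∞ :=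
  mutualInfo β ((M.episodeLaw q).comap (fun w => ((), w)) (by fun_prop))

/-- The regularised information ratio `Ψ^η = Δ² / (I + η)`; here `0 / 0 = 0` and `c / 0 = ∞` for
`c > 0`. -/
def score (piStar : PolicyFamily S A H (Param H d)) (η : ℝ) (β : Measure (Param H d))
    (q : MixedPolicy S A H) : ℝ≥0∞ :=
  ENNReal.ofReal (M.regret piStar β q ^ 2) / (M.infoGain β q + ENNReal.ofReal η)

/-- During the first `T` online episodes the algorithm is regularised information-directed sampling
with target `w`: after almost every history it plays a minimiser of the score over the
randomised closure of the candidate class `C`. -/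
def IsIDS (D : OfflineData S A H) (piStar : PolicyFamily S A H (Param H d))
    (C : Set (Policy S A H)) (η : ℝ) (T : ℕ) (alg : Algorithm S A H) : Prop :=
  ∀ t < T, ∀ᵐ ω ∂((M.jointLaw D alg t).map Prod.snd),
    ((alg t).at ω).InClosure C ∧
      ∀ q : MixedPolicy S A H, q.InClosure C →
        M.score piStar η (M.posterior D alg t ω) ((alg t).at ω) ≤
          M.score piStar η (M.posterior D alg t ω) q

/-- `∑_{t ≤ T} Δ_t(π_t)` as a function of the `T` online episodes. -/
def cumRegret (D : OfflineData S A H) (piStar : PolicyFamily S A H (Param H d))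
    (alg : Algorithm S A H) (T : ℕ) (ω : Fin T → Episode S A H) : ℝ :=
  ∑ t : Fin T, M.regret piStar (M.posterior D alg t (Fin.take t t.2.le ω))
    ((alg t).at (Fin.take t t.2.le ω))

/-- The Bayesian regret over `T` online episodes conditional on the offline data. -/
def bayesRegret (D : OfflineData S A H) (piStar : PolicyFamily S A H (Param H d))
    (alg : Algorithm S A H) (T : ℕ) : ℝ :=
  ∫ z, M.cumRegret D piStar alg T z.2 ∂(M.jointLaw D alg T)

/-! ### Gram matrices and coverage -/

/-- `N = ∑_h n_h`. -/
def _root_.OffToOn.OfflineData.total (D : OfflineData S A H) : ℕ := ∑ h, D.n h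

/-- The offline Gram matrix `Λ_{h,N} = λ I + ∑ φ φᵀ` at stage `h`. -/
def gram (D : OfflineData S A H) (h : Fin H) : Matrix (Fin d) (Fin d) ℝ :=
  M.prec • (1 : Matrix (Fin d) (Fin d) ℝ) +
    ∑ i : Fin (D.n h), Matrix.vecMulVec (M.φ (D.pt h i)) (M.φ (D.pt h i))

/-- The time-averaged online visitation covariance at stage `h` under the algorithm. -/
def visitation (D : OfflineData S A H) (alg : Algorithm S A H) (T : ℕ) (h : Fin H) :
    Matrix (Fin d) (Fin d) ℝ :=
  Matrix.of fun i j => (1 / (T : ℝ)) * ∑ t : Fin T,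
    ∫ z, M.φ ((z.2 t).1 h) i * M.φ ((z.2 t).1 h) j ∂(M.jointLaw D alg T)

/-- The stage-`h` coverage coefficient `C_{β,h}(N,T)` of the algorithm. -/
def stageCoverage (D : OfflineData S A H) (alg : Algorithm S A H) (T : ℕ) (h : Fin H) : ℝ :=
  lambdaMax (invSqrt ((D.n h : ℝ)⁻¹ • M.gram D h) * M.visitation D alg T h *
    invSqrt ((D.n h : ℝ)⁻¹ • M.gram D h))

/-- The coverage coefficient `C†_β(N,T)` of the algorithm. -/
def coverage (D : OfflineData S A H) (alg : Algorithm S A H) (T : ℕ) : ℝ :=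
  (D.total : ℝ) / H * ∑ h, M.stageCoverage D alg T h / D.n h

/-- `L_N(T) = (1/H) ∑_h log(1 + T / (d λ_min(Λ_{h,N})))`. -/
def logTerm (D : OfflineData S A H) (T : ℕ) : ℝ :=
  (1 / (H : ℝ)) * ∑ h, Real.log (1 + T / (d * lambdaMin (M.gram D h)))

end BayesMDP

end

end OffToOn

/-! Conjugacy makes everything explicit. Given the history, the parameters are independent
Gaussians, the precision at stage `h` being the offline Gram matrix plus the online rank-one terms
`φ φᵀ` (`posterior_ae_eq`). An episode then carries the information `½ ∑_h log (1 + φᵀ Λ_h⁻¹ φ)`,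
averaged over its state-action sequence (`infoGain_gaussPi`), and since the prior precision is at
least one, each predictive variance `φᵀ Λ_h⁻¹ φ` is at most one.

Information ratio. Thompson sampling lies in the randomised closure, so a minimiser of the
regularised ratio does at least as well as it does. Under Thompson sampling the sampled parameter
`u` and the true `w` are independent copies, so the regret is the mean difference of the values of
one policy, that of `u`, under `u` and under `w` (`regret_thompson`). A weighted Young inequality
splits this difference into the predictive variance along the episode and the squared distance of
`u` and `w` in the precision norm; the latter has mean `2d` per stage. Optimising the weight gives
`Δ² ≤ 2dH · E[total variance]`, and `log 2 · x ≤ log (1 + x)` on `[0, 1]` turns variance into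
information: `Δ² ≤ (4Hd / log 2) · I` (`regret_thompson_sq_le_info`). Hence the played policy
satisfies `Δ_t² ≤ C_w (I_t + η)` (`regret_sq_le_of_score_le`).

Summation. The `η` part costs at most `√(C_w η)` per episode. The rest is controlled by the total
expected information, which telescopes to the expected growth of `½ ∑_h log det` of the posterior
precision (`sum_integral_stepInfo`). One tangent-line inequality for the logarithm, with a free
parameter `c`, bounds this growth (`log_det_sub_le`): a `c` adapted to `T / (d λ_min)` gives the
logarithmic term, and `c = 1` gives a trace, hence the coverage coefficient. Each bound yields one
member of the minimum (`bayesRegret_le_of_info_le`). -/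

namespace OffToOn

open Matrix

/-! ### Determinants, traces and extreme eigenvalues of positive definite matrices. -/

section LinearAlgebra

variable {d : ℕ} {A B : Matrix (Fin d) (Fin d) ℝ}

/-- The rank-one determinant formula is what makes information telescope: observing a feature `v`
raises the log-determinant of the precision by exactly `log (1 + vᵀ A⁻¹ v)`. -/
lemma det_add_vecMulVec_self (hA : A.PosDef) (v : Fin d → ℝ) :
    (A + vecMulVec v v).det = A.det * (1 + v ⬝ᵥ A⁻¹ *ᵥ v) := by
  have h := Matrix.det_add_replicateCol_mul_replicateRow (ι := Unit)
    ((isUnit_iff_isUnit_det A).1 hA.isUnit) v v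
  rw [← vecMulVec_eq] at h
  rw [h]
  congr 2
  simp [Matrix.mul_apply, replicateRow, replicateCol, dotProduct, mulVec, Finset.mul_sum,
    Finset.sum_mul]
  rw [Finset.sum_comm]
  simp [mul_assoc]

/-- With `v = A⁻¹ x`, expand `‖c v - x‖² ≥ 0` and use `c ‖v‖² ≤ v ⬝ᵥ x`; no diagonalisation is
needed. -/
lemma dotProduct_inv_mulVec_le (hA : A.PosDef) {c : ℝ} (hc : 0 < c)
    (h : ∀ v : Fin d → ℝ, c * (v ⬝ᵥ v) ≤ v ⬝ᵥ A *ᵥ v) (x : Fin d → ℝ) :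
    x ⬝ᵥ A⁻¹ *ᵥ x ≤ (x ⬝ᵥ x) / c := by
  set v := A⁻¹ *ᵥ x with hv
  have hAv : A *ᵥ v = x := by
    rw [hv, mulVec_mulVec, mul_nonsing_inv _ ((isUnit_iff_isUnit_det A).1 hA.isUnit), one_mulVec]
  have h1 := h v
  rw [hAv, dotProduct_comm v x] at h1
  have h2 : 0 ≤ (c • v - x) ⬝ᵥ (c • v - x) := by
    simpa using dotProduct_self_star_nonneg (c • v - x)
  simp only [sub_dotProduct, dotProduct_sub, smul_dotProduct, dotProduct_smul, smul_eq_mul,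
    dotProduct_comm v x] at h2
  rw [le_div_iff₀ hc]
  nlinarith

lemma dotProduct_inv_mulVec_nonneg (hA : A.PosDef) (x : Fin d → ℝ) :
    0 ≤ x ⬝ᵥ A⁻¹ *ᵥ x := by
  simpa using hA.inv.posSemidef.dotProduct_mulVec_nonneg x

lemma isHermitian_invSqrt (A : Matrix (Fin d) (Fin d) ℝ) : (invSqrt A).IsHermitian :=
  cfc_predicate _ _

/-- By functional calculus this reduces to `(√x)⁻¹ (√x)⁻¹ x = 1` on the positive spectrum;
continuity there is automatic because the spectrum is finite. -/
lemma invSqrt_mul_self (hA : A.PosDef) : invSqrt A * invSqrt A = A⁻¹ := by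
  have hsa : IsSelfAdjoint A := hA.isHermitian
  have hpos : ∀ x ∈ spectrum ℝ A, 0 < x := by
    intro x hx
    rw [hA.isHermitian.spectrum_real_eq_range_eigenvalues] at hx
    obtain ⟨i, rfl⟩ := hx
    exact hA.eigenvalues_pos i
  have hcont : ∀ f : ℝ → ℝ, ContinuousOn f (spectrum ℝ A) := fun f =>
    (Matrix.finite_real_spectrum (A := A)).continuousOn f
  have h : (invSqrt A * invSqrt A) * A = 1 := by
    nth_rw 3 [← cfc_id' ℝ A]
    unfold invSqrt
    rw [← cfc_mul _ _ _ (hcont _) (hcont _), ← cfc_mul _ _ _ (hcont _) (hcont _),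
      ← cfc_one ℝ A]
    refine cfc_congr fun x hx => ?_
    have := hpos x hx
    have h2 : √x * √x = x := Real.mul_self_sqrt this.le
    have h3 : √x ≠ 0 := (Real.sqrt_pos.2 this).ne'
    simp only [Pi.one_apply]
    nth_rw 3 [← h2]
    field_simp
  exact (Matrix.inv_eq_left_inv h).symm

/-- The left side is the sum of `log μ` over the eigenvalues `μ` of `A^{-1/2} B A^{-1/2}`, and
concavity gives `log μ ≤ μ / c - 1 + log c`, the tangent at `c`. Keeping `c` free lets one
inequality serve both regret bounds. -/
lemma log_det_sub_le (hA : A.PosDef) (hB : B.PosDef) {c : ℝ} (hc : 0 < c) :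
    Real.log B.det - Real.log A.det ≤ (A⁻¹ * B).trace / c - d + d * Real.log c := by
  set R := invSqrt A
  have hRR : R * R = A⁻¹ := invSqrt_mul_self hA
  have hRH : Rᴴ = R := isHermitian_invSqrt A
  have hdetR : R.det * R.det = A.det⁻¹ := by
    rw [← det_mul, hRR, det_nonsing_inv, Ring.inverse_eq_inv']
  have hRdet : R.det ≠ 0 := by
    intro h
    rw [h] at hdetR
    have := hA.det_pos
    simp at hdetR
    linarith
  have hRu : IsUnit R := (isUnit_iff_isUnit_det R).2 hRdet.isUnit
  have hC : (R * B * R).PosDef := by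
    have := (IsUnit.posDef_star_left_conjugate_iff (x := B) hRu).2 hB
    rwa [star_eq_conjTranspose, hRH] at this
  have hdet : (R * B * R).det = B.det / A.det := by
    rw [det_mul, det_mul, mul_right_comm, hdetR]; ring
  have htr : (R * B * R).trace = (A⁻¹ * B).trace := by
    rw [trace_mul_comm, ← mul_assoc, hRR]
  rw [← Real.log_div hB.det_pos.ne' hA.det_pos.ne', ← hdet, ← htr,
    hC.isHermitian.det_eq_prod_eigenvalues, hC.isHermitian.trace_eq_sum_eigenvalues]
  simp only [RCLike.ofReal_real_eq_id, id_eq]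
  rw [Real.log_prod (fun i _ => (hC.eigenvalues_pos i).ne'), Finset.sum_div]
  have : ∀ i, Real.log (hC.isHermitian.eigenvalues i) ≤
      hC.isHermitian.eigenvalues i / c - 1 + Real.log c := by
    intro i
    have h1 := hC.eigenvalues_pos i
    have h2 := Real.log_le_sub_one_of_pos (div_pos h1 hc)
    rw [Real.log_div h1.ne' hc.ne'] at h2
    linarith
  refine (Finset.sum_le_sum fun i _ => this i).trans (le_of_eq ?_)
  simp [Finset.sum_add_distrib, Finset.sum_sub_distrib]

lemma spectrum_nonempty_of_isHermitian (hd : 0 < d) (hA : A.IsHermitian) :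
    (spectrum ℝ A).Nonempty := by
  rw [hA.spectrum_real_eq_range_eigenvalues]
  exact ⟨_, ⟨⟨0, hd⟩, rfl⟩⟩

lemma lambdaMin_pos (hd : 0 < d) (hA : A.PosDef) : 0 < lambdaMin A := by
  have h := (spectrum_nonempty_of_isHermitian hd hA.isHermitian).csInf_mem
    Matrix.finite_real_spectrum
  rw [hA.isHermitian.spectrum_real_eq_range_eigenvalues] at h
  obtain ⟨i, hi⟩ := h
  rw [lambdaMin, hA.isHermitian.spectrum_real_eq_range_eigenvalues, ← hi]
  exact hA.eigenvalues_pos i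

open scoped MatrixOrder in
lemma lambdaMin_mul_le (hA : A.IsHermitian) (v : Fin d → ℝ) :
    lambdaMin A * (v ⬝ᵥ v) ≤ v ⬝ᵥ A *ᵥ v := by
  have h : algebraMap ℝ _ (lambdaMin A) ≤ A :=
    (algebraMap_le_iff_le_spectrum (ha := hA)).2 fun x hx =>
      csInf_le (Matrix.finite_real_spectrum (A := A)).bddBelow hx
  have h2 := (Matrix.le_iff.1 h).dotProduct_mulVec_nonneg v
  simp only [star_trivial, sub_mulVec, dotProduct_sub, Algebra.algebraMap_eq_smul_one,
    smul_mulVec, one_mulVec, dotProduct_smul, smul_eq_mul] at h2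
  linarith

lemma trace_le_lambdaMax (hA : A.IsHermitian) : A.trace ≤ d * lambdaMax A := by
  rw [hA.trace_eq_sum_eigenvalues]
  have : ∀ i, hA.eigenvalues i ≤ lambdaMax A := fun i =>
    le_csSup (Matrix.finite_real_spectrum (A := A)).bddAbove
      (by rw [hA.spectrum_real_eq_range_eigenvalues]; exact ⟨i, rfl⟩)
  simpa using Finset.sum_le_sum (s := Finset.univ) fun i _ => this i

/-- Cyclicity of the trace produces the symmetric conjugate appearing in the coverage coefficient;
replacing each of its `d` eigenvalues by the largest costs the factor `d`. -/
lemma trace_inv_mul_le (hA : A.PosDef) (hB : B.IsHermitian) :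
    (A⁻¹ * B).trace ≤ d * lambdaMax (invSqrt A * B * invSqrt A) := by
  rw [← invSqrt_mul_self hA, mul_assoc, trace_mul_comm]
  refine trace_le_lambdaMax ?_
  have h := isHermitian_mul_mul_conjTranspose (invSqrt A) hB
  rwa [(isHermitian_invSqrt A).eq] at h

lemma trace_inv_mul_vecMulVec (A : Matrix (Fin d) (Fin d) ℝ) (v : Fin d → ℝ) :
    (A⁻¹ * vecMulVec v v).trace = v ⬝ᵥ A⁻¹ *ᵥ v := by
  rw [mul_vecMulVec, trace_vecMulVec, dotProduct_comm]

end LinearAlgebra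

open scoped MatrixOrder

/-! ### Gaussian measures as exponential tiltings of Lebesgue measure. -/

section Gaussian

/-- Both sides have characteristic function `exp (-‖t‖² / 2)`. The tilted form is the one suited to
Bayes' rule, since successive tiltings add their exponents. -/
lemma stdGaussian_eq_tilted (E : Type*) [NormedAddCommGroup E] [InnerProductSpace ℝ E]
    [FiniteDimensional ℝ E] [MeasurableSpace E] [BorelSpace E] :
    stdGaussian E = (volume : Measure E).tilted (fun x => -‖x‖ ^ 2 / 2) := by
  have hint : Integrable (fun x : E => Real.exp (-‖x‖ ^ 2 / 2)) := by
    have h := (GaussianFourier.integrable_cexp_neg_mul_sq_norm_add (V := E) (b := 1 / 2)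
      (by norm_num) 0 0).norm
    refine h.congr (ae_of_all _ fun x => ?_)
    simp only [zero_mul, add_zero, Complex.norm_exp]
    congr 1
    have : (-(1 / 2 : ℂ) * (‖x‖ : ℂ) ^ 2) = ((-‖x‖ ^ 2 / 2 : ℝ) : ℂ) := by push_cast; ring
    rw [this, Complex.ofReal_re]
  have : IsProbabilityMeasure ((volume : Measure E).tilted (fun x => -‖x‖ ^ 2 / 2)) :=
    isProbabilityMeasure_tilted hint
  refine Measure.ext_of_charFun (E := E) (funext fun t => ?_)
  rw [charFun_stdGaussian, charFun_apply, integral_tilted]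
  have h1 := GaussianFourier.integral_cexp_neg_mul_sq_norm_add (V := E) (b := 1 / 2)
    (by norm_num) Complex.I t
  have h0 := GaussianFourier.integral_rexp_neg_mul_sq_norm (V := E) (b := 1 / 2) (by norm_num)
  have e0 : ∀ x : E, Real.exp (-‖x‖ ^ 2 / 2) = Real.exp (-(1 / 2) * ‖x‖ ^ 2) := fun x => by
    congr 1; ring
  simp_rw [e0, h0]
  have e1 : ∀ x : E, ((Real.exp (-(1 / 2) * ‖x‖ ^ 2) /
      (Real.pi / (1 / 2)) ^ ((Module.finrank ℝ E : ℝ) / 2)) •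
        Complex.exp (((inner ℝ x t : ℝ) : ℂ) * Complex.I) : ℂ) =
      (((Real.pi / (1 / 2)) ^ ((Module.finrank ℝ E : ℝ) / 2) : ℝ) : ℂ)⁻¹ *
        Complex.exp (-(1 / 2) * (‖x‖ : ℂ) ^ 2 + Complex.I * ((inner ℝ t x : ℝ) : ℂ)) := fun x => by
    rw [Complex.exp_add, real_inner_comm, Complex.real_smul]
    push_cast
    rw [mul_comm Complex.I]
    ring
  simp_rw [e1]
  rw [integral_const_mul, h1, ← mul_assoc]
  have hpos : (0 : ℝ) < (Real.pi / (1 / 2)) ^ ((Module.finrank ℝ E : ℝ) / 2) := by positivity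
  have e2 : (((Real.pi / (1 / 2)) ^ ((Module.finrank ℝ E : ℝ) / 2) : ℝ) : ℂ) =
      ((Real.pi : ℂ) / (1 / 2)) ^ ((Module.finrank ℝ E : ℂ) / 2) := by
    rw [Complex.ofReal_cpow (by positivity)]
    push_cast
    rfl
  rw [← e2, inv_mul_cancel₀ (by exact_mod_cast hpos.ne'), one_mul, Complex.I_sq]
  congr 1
  ring

lemma tilted_map_equiv {X Y : Type*} [MeasurableSpace X] [MeasurableSpace Y] (μ : Measure X)
    (e : X ≃ᵐ Y) (f : Y → ℝ) : (μ.map e).tilted f = (μ.tilted (f ∘ e)).map e := by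
  ext s hs
  rw [Measure.map_apply e.measurable hs, tilted_apply' _ _ hs,
    tilted_apply' _ _ (e.measurable hs), e.restrict_map, lintegral_map_equiv, integral_map_equiv]
  rfl

/-- Tilting normalises, so a constant factor disappears; this makes the value of a Jacobian
irrelevant. -/
lemma tilted_smul_measure {X : Type*} [MeasurableSpace X] (μ : Measure X) {c : ℝ≥0∞}
    (hc : c ≠ 0) (hc' : c ≠ ∞) (f : X → ℝ) : (c • μ).tilted f = μ.tilted f := by
  have hpos : 0 < c.toReal := ENNReal.toReal_pos hc hc'
  ext s hs
  rw [tilted_apply' _ _ hs, tilted_apply' _ _ hs, Measure.restrict_smul, lintegral_smul_measure,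
    integral_smul_measure, smul_eq_mul, smul_eq_mul, ← lintegral_const_mul' _ _ hc']
  congr 1 with x
  conv_lhs => rw [← ENNReal.ofReal_toReal hc']
  rw [← ENNReal.ofReal_mul hpos.le]
  congr 1
  by_cases h : ∫ x, Real.exp (f x) ∂μ = 0
  · simp [h]
  · have := hpos.ne'
    rw [ENNReal.ofReal_toReal hc']
    field_simp

/-- The normalisation absorbs additive constants of the exponent, so a square can be completed
without tracking them. -/
lemma tilted_add_const {X : Type*} [MeasurableSpace X] (μ : Measure X) (f : X → ℝ) (c : ℝ) :
    μ.tilted (fun x => f x + c) = μ.tilted f := by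
  unfold Measure.tilted
  congr 1 with x
  congr 1
  simp_rw [Real.exp_add, integral_mul_const]
  rw [mul_div_mul_right _ _ (Real.exp_pos c).ne']

/-- A Gaussian measure with precision matrix `Λ` has density proportional to
`exp (⟨b, w⟩ - ⟨w, Λ w⟩ / 2)`. -/
lemma tilted_quadratic_eq {d : ℕ} {Λ : Matrix (Fin d) (Fin d) ℝ} (hΛ : Λ.PosDef)
    (b : Fin d → ℝ) :
    (volume : Measure (EuclideanSpace ℝ (Fin d))).tilted
        (fun w => b ⬝ᵥ w.ofLp - (w.ofLp ⬝ᵥ Λ *ᵥ w.ofLp) / 2) =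
      multivariateGaussian (WithLp.toLp 2 (Λ⁻¹ *ᵥ b)) Λ⁻¹ := by
  have hu : IsUnit Λ.det := (isUnit_iff_isUnit_det Λ).1 hΛ.isUnit
  set S := CFC.sqrt Λ⁻¹ with hS
  have hSS : S * S = Λ⁻¹ := CFC.sqrt_mul_sqrt_self _ hΛ.inv.posSemidef.nonneg
  have hSh : Sᵀ = S := by
    have : Sᴴ = S := (CFC.sqrt_nonneg Λ⁻¹).isSelfAdjoint
    simpa using this
  have hdS : S.det ≠ 0 := by
    intro h
    have h1 : S.det * S.det = Λ⁻¹.det := by rw [← det_mul, hSS]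
    rw [h, zero_mul] at h1
    exact hΛ.inv.det_pos.ne h1
  have hSu : IsUnit S.det := hdS.isUnit
  have hSLS : S * Λ * S = 1 := by
    have h1 : S * (S * Λ * S) = S := by
      rw [← mul_assoc, ← mul_assoc, hSS, nonsing_inv_mul _ hu, one_mul]
    calc S * Λ * S = S⁻¹ * (S * (S * Λ * S)) := by
          rw [← mul_assoc S⁻¹, nonsing_inv_mul _ hSu, one_mul]
      _ = 1 := by rw [h1, nonsing_inv_mul _ hSu]
  set m : EuclideanSpace ℝ (Fin d) := WithLp.toLp 2 (Λ⁻¹ *ᵥ b) with hm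
  -- The affine map `x ↦ m + Λ^{-1/2} x`, which carries the standard Gaussian to the one with mean
  -- `m` and covariance `Λ⁻¹`.
  let e : EuclideanSpace ℝ (Fin d) ≃ᵐ EuclideanSpace ℝ (Fin d) :=
    { toFun := fun x => m + toEuclideanCLM (𝕜 := ℝ) S x
      invFun := fun x => toEuclideanCLM (𝕜 := ℝ) S⁻¹ (x - m)
      left_inv := fun x => by
        change toEuclideanCLM (𝕜 := ℝ) S⁻¹ (m + toEuclideanCLM (𝕜 := ℝ) S x - m) = x
        rw [add_sub_cancel_left, ← mul_apply_eq_comp, ← map_mul,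
          nonsing_inv_mul _ hSu, map_one]
        rfl
      right_inv := fun x => by
        change m + toEuclideanCLM (𝕜 := ℝ) S (toEuclideanCLM (𝕜 := ℝ) S⁻¹ (x - m)) = x
        rw [← mul_apply_eq_comp, ← map_mul, mul_nonsing_inv _ hSu, map_one]
        simp
      measurable_toFun := by simp only [Equiv.coe_fn_mk]; fun_prop
      measurable_invFun := by simp only [Equiv.coe_fn_symm_mk]; fun_prop }
  have hvol : ∃ c : ℝ≥0∞, c ≠ 0 ∧ c ≠ ∞ ∧
      (volume : Measure (EuclideanSpace ℝ (Fin d))).map e = c • volume := by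
    have hdet : LinearMap.det
        ((toEuclideanCLM (𝕜 := ℝ) S : _ →L[ℝ] EuclideanSpace ℝ (Fin d)) :
          EuclideanSpace ℝ (Fin d) →ₗ[ℝ] EuclideanSpace ℝ (Fin d)) ≠ 0 := by
      intro h
      have h1 := congrArg LinearMap.det (congrArg
        (fun L : EuclideanSpace ℝ (Fin d) →L[ℝ] EuclideanSpace ℝ (Fin d) =>
          (L : EuclideanSpace ℝ (Fin d) →ₗ[ℝ] EuclideanSpace ℝ (Fin d)))
        ((map_mul (toEuclideanCLM (𝕜 := ℝ)) S S⁻¹).symm.trans (by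
          rw [mul_nonsing_inv _ hSu, map_one])))
      rw [ContinuousLinearMap.toLinearMap_mul, map_mul, h, zero_mul] at h1
      simp at h1
    have h1 := Measure.map_linearMap_addHaar_eq_smul_addHaar
      (volume : Measure (EuclideanSpace ℝ (Fin d))) hdet
    refine ⟨_, (ENNReal.ofReal_pos.2 (abs_pos.2 (inv_ne_zero hdet))).ne',
      ENNReal.ofReal_ne_top, ?_⟩
    have he : (e : EuclideanSpace ℝ (Fin d) → EuclideanSpace ℝ (Fin d)) =
        (fun x => m + x) ∘ (toEuclideanCLM (𝕜 := ℝ) S) := rfl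
    rw [he, ← Measure.map_map (by fun_prop) (by fun_prop)]
    refine (congrArg (Measure.map (fun x => m + x)) h1).trans ?_
    rw [Measure.map_smul, map_add_left_eq_self]
  obtain ⟨c, hc, hc', hvol⟩ := hvol
  have hmap : multivariateGaussian m Λ⁻¹ = (stdGaussian (EuclideanSpace ℝ (Fin d))).map e := rfl
  rw [hmap, stdGaussian_eq_tilted, ← tilted_smul_measure _ hc hc', ← hvol, tilted_map_equiv]
  congr 1
  -- The added constant is the maximum of the exponent `⟨b, w⟩ - ⟨w, Λ w⟩ / 2`, attained at `w = Λ⁻¹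
  -- b`; in the coordinate `x` the remainder is exactly `-‖x‖² / 2`.
  rw [← tilted_add_const volume (fun x => -‖x‖ ^ 2 / 2) (b ⬝ᵥ Λ⁻¹ *ᵥ b / 2)]
  congr 1
  funext x
  have hex : (e x).ofLp = Λ⁻¹ *ᵥ b + S *ᵥ x.ofLp := rfl
  have hΛS : Λ *ᵥ (Λ⁻¹ *ᵥ b) = b := by rw [mulVec_mulVec, mul_nonsing_inv _ hu, one_mulVec]
  have hΛt : Λᵀ = Λ := by simpa using hΛ.isHermitian.eq
  have h1 : (Λ⁻¹ *ᵥ b) ⬝ᵥ (Λ *ᵥ (S *ᵥ x.ofLp)) = b ⬝ᵥ (S *ᵥ x.ofLp) := by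
    rw [dotProduct_mulVec, ← mulVec_transpose, hΛt, hΛS]
  have h2 : (S *ᵥ x.ofLp) ⬝ᵥ (Λ *ᵥ (S *ᵥ x.ofLp)) = x.ofLp ⬝ᵥ x.ofLp := by
    rw [dotProduct_comm, dotProduct_mulVec, ← mulVec_transpose, hSh, mulVec_mulVec, mulVec_mulVec,
      hSLS, one_mulVec]
  have h3 : ‖x‖ ^ 2 = x.ofLp ⬝ᵥ x.ofLp := by
    rw [EuclideanSpace.real_norm_sq_eq, dotProduct]
    simp [sq]
  simp only [Function.comp_apply, hex, mulVec_add, hΛS, dotProduct_add, add_dotProduct, h1, h2, h3,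
    dotProduct_comm (Λ⁻¹ *ᵥ b) b, dotProduct_comm (S *ᵥ x.ofLp) b]
  ring

end Gaussian

/-! ### Tilting a product measure by a separable exponent. -/

section PiTilted

variable {ι : Type*} [Fintype ι] {E : ι → Type*} [∀ i, MeasurableSpace (E i)]

/-- The exponential of a sum factorises, and hence so do its integrals over boxes and the
normalising constant. This keeps the stages independent a posteriori. -/
lemma pi_tilted (μ : (i : ι) → Measure (E i)) [∀ i, IsProbabilityMeasure (μ i)]
    (f : (i : ι) → E i → ℝ) (hf : ∀ i, Integrable (fun x => Real.exp (f i x)) (μ i)) :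
    (Measure.pi μ).tilted (fun x => ∑ i, f i (x i)) = Measure.pi fun i => (μ i).tilted (f i) := by
  have hp : ∀ i, IsProbabilityMeasure ((μ i).tilted (f i)) := fun i =>
    isProbabilityMeasure_tilted (hf i)
  symm
  refine Measure.pi_eq fun s hs => ?_
  rw [tilted_apply_eq_ofReal_integral' _ (MeasurableSet.univ_pi hs)]
  simp_rw [tilted_apply_eq_ofReal_integral' _ (hs _), Real.exp_sum]
  rw [integral_fintype_prod_eq_prod (fun i x => Real.exp (f i x)), Measure.restrict_pi_pi,
    ← ENNReal.ofReal_prod_of_nonneg]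
  · simp_rw [← Finset.prod_div_distrib]
    rw [integral_fintype_prod_eq_prod (fun i x => Real.exp (f i x) / ∫ y, Real.exp (f i y) ∂μ i)]
  · intro i _
    exact integral_nonneg fun x => by positivity

end PiTilted

/-! ### One-dimensional Gaussian likelihoods and predictive densities. -/

section RealGaussian

/-- Taking pure noise as the reference measure gives every parameter value the same dominating
measure, with the strictly positive density `exp (x y - x² / 2)`. -/
lemma gaussianReal_one_eq_withDensity (x : ℝ) :
    gaussianReal x 1 =
      (gaussianReal 0 1).withDensity fun y => ENNReal.ofReal (Real.exp (x * y - x ^ 2 / 2)) := by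
  rw [gaussianReal_of_var_ne_zero _ one_ne_zero, gaussianReal_of_var_ne_zero _ one_ne_zero,
    ← withDensity_mul _ (measurable_gaussianPDF _ _) (by fun_prop)]
  congr 1 with y
  rw [Pi.mul_apply, gaussianPDF, gaussianPDF, ← ENNReal.ofReal_mul (gaussianPDFReal_nonneg _ _ _),
    gaussianPDFReal, gaussianPDFReal, mul_assoc _ (Real.exp _), ← Real.exp_add]
  congr 3
  push_cast
  ring

lemma integral_exp_gaussianReal_one (x : ℝ) :
    Integrable (fun y => Real.exp (x * y - x ^ 2 / 2)) (gaussianReal 0 1) ∧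
      ∫ y, Real.exp (x * y - x ^ 2 / 2) ∂(gaussianReal 0 1) = 1 := by
  have h : ∫⁻ y, ENNReal.ofReal (Real.exp (x * y - x ^ 2 / 2)) ∂(gaussianReal 0 1) = 1 := by
    have := measure_univ (μ := gaussianReal x 1)
    rwa [gaussianReal_one_eq_withDensity, withDensity_apply _ MeasurableSet.univ,
      Measure.restrict_univ] at this
  have hi : Integrable (fun y => Real.exp (x * y - x ^ 2 / 2)) (gaussianReal 0 1) := by
    refine ⟨Measurable.aestronglyMeasurable (by fun_prop), ?_⟩
    rw [hasFiniteIntegral_iff_ofReal (ae_of_all _ fun y => (Real.exp_pos _).le), h]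
    exact ENNReal.one_lt_top
  refine ⟨hi, ?_⟩
  rw [integral_eq_lintegral_of_nonneg_ae (ae_of_all _ fun y => (Real.exp_pos _).le)
    hi.aestronglyMeasurable, h, ENNReal.toReal_one]

/-- The law of independent unit-variance Gaussians with means `x` has an explicit density with
respect to standard noise. -/
lemma map_add_pi_gaussianReal {H : ℕ} (x : Fin H → ℝ) :
    (Measure.pi fun _ : Fin H => gaussianReal 0 1).map (fun ε h => x h + ε h) =
      (Measure.pi fun _ : Fin H => gaussianReal 0 1).withDensity
        fun y => ENNReal.ofReal (Real.exp (∑ h, (x h * y h - x h ^ 2 / 2))) := by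
  have h0 := Measure.pi_map_pi (μ := fun _ : Fin H => gaussianReal 0 1)
    (f := fun h ε => x h + ε) (fun i => by fun_prop)
  rw [h0]
  simp_rw [gaussianReal_map_const_add, zero_add]
  have h1 : ∀ h, gaussianReal (x h) 1 =
      (gaussianReal 0 1).tilted fun y => x h * y - x h ^ 2 / 2 := fun h => by
    rw [Measure.tilted, (integral_exp_gaussianReal_one (x h)).2, gaussianReal_one_eq_withDensity]
    simp
  simp_rw [h1]
  rw [← pi_tilted (fun _ : Fin H => gaussianReal 0 1) (fun h y => x h * y - x h ^ 2 / 2)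
    (fun h => (integral_exp_gaussianReal_one (x h)).1), Measure.tilted]
  have h2 : ∫ y : Fin H → ℝ, Real.exp (∑ h, (x h * y h - x h ^ 2 / 2))
      ∂(Measure.pi fun _ : Fin H => gaussianReal 0 1) = 1 := by
    simp_rw [Real.exp_sum]
    rw [integral_fintype_prod_eq_prod (fun h y => Real.exp (x h * y - x h ^ 2 / 2))]
    simp [(integral_exp_gaussianReal_one _).2]
  rw [h2]
  simp

/-- The predictive density of a Gaussian observation under a Gaussian prior. -/
lemma integral_exp_likelihood_gaussianReal (m : ℝ) (v : ℝ≥0) (y : ℝ) :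
    Integrable (fun x => Real.exp (x * y - x ^ 2 / 2)) (gaussianReal m v) ∧
    ∫ x, Real.exp (x * y - x ^ 2 / 2) ∂(gaussianReal m v) =
      Real.exp (y ^ 2 / 2 - (y - m) ^ 2 / (2 * (1 + v)) - Real.log (1 + v) / 2) := by
  constructor
  · refine Integrable.of_bound (C := Real.exp (y ^ 2 / 2))
      (Measurable.aestronglyMeasurable (by fun_prop)) (ae_of_all _ fun x => ?_)
    rw [Real.norm_eq_abs, Real.abs_exp, Real.exp_le_exp]
    nlinarith [sq_nonneg (x - y)]
  -- Writing the variable as `m + s ξ` with `ξ` standard also covers the degenerate case `v = 0`.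
  set s : ℝ := √v with hs
  have hs2 : s ^ 2 = v := Real.sq_sqrt v.2
  have hmap : gaussianReal m v = (gaussianReal 0 1).map (fun ξ => m + s * ξ) := by
    rw [show (fun ξ => m + s * ξ) = (fun x => m + x) ∘ (fun ξ => s * ξ) from rfl,
      ← Measure.map_map (by fun_prop) (by fun_prop), gaussianReal_map_const_mul,
      gaussianReal_map_const_add]
    congr 1
    · simp
    · ext; simp [hs2]
  rw [hmap, integral_map (by fun_prop) (Measurable.aestronglyMeasurable (by fun_prop)),
    integral_gaussianReal_eq_integral_smul one_ne_zero]
  have hv : (0 : ℝ) < 1 + v := by positivity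
  -- The centre of the square in `ξ`: after completing it, the exponent is `-(1 + v) / 2 * (ξ - c)²`
  -- plus a term free of `ξ`.
  set c : ℝ := s * (y - m) / (1 + v) with hc
  have key : ∀ ξ : ℝ, gaussianPDFReal 0 1 ξ • Real.exp ((m + s * ξ) * y - (m + s * ξ) ^ 2 / 2) =
      ((√(2 * Real.pi))⁻¹ * Real.exp (y ^ 2 / 2 - (y - m) ^ 2 / (2 * (1 + v)))) *
        Real.exp (-((1 + v) / 2) * (ξ - c) ^ 2) := fun ξ => by
    rw [gaussianPDFReal, smul_eq_mul, mul_assoc, mul_assoc _ (Real.exp _), ← Real.exp_add,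
      ← Real.exp_add]
    simp only [NNReal.coe_one, mul_one]
    congr 2
    rw [hc]
    field_simp
    rw [← hs2]
    ring
  simp_rw [key]
  rw [integral_const_mul, integral_sub_right_eq_self (fun ξ => Real.exp (-((1 + v) / 2) * ξ ^ 2)) c,
    integral_gaussian, Real.exp_sub _ (Real.log (1 + v) / 2), mul_assoc]
  have h1 : Real.pi / ((1 + v) / 2) = 2 * Real.pi / (1 + v) := by field_simp
  have h2 : Real.exp (Real.log (1 + v) / 2) = √(1 + v) := by
    rw [Real.exp_half, Real.exp_log hv]
  rw [h1, h2, Real.sqrt_div (by positivity)]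
  have h3 : √(2 * Real.pi) ≠ 0 := by positivity
  field_simp

end RealGaussian

/-! ### Linear and quadratic functionals of Gaussian vectors. -/

section Marginals

variable {d : ℕ} {m : EuclideanSpace ℝ (Fin d)} {S : Matrix (Fin d) (Fin d) ℝ}

lemma map_inner_multivariateGaussian (hS : S.PosSemidef) (φ : EuclideanSpace ℝ (Fin d)) :
    (multivariateGaussian m S).map (fun w => inner ℝ φ w) =
      gaussianReal (inner ℝ φ m) (φ.ofLp ⬝ᵥ S *ᵥ φ.ofLp).toNNReal := by
  have h := IsGaussian.map_eq_gaussianReal (μ := multivariateGaussian m S) (innerSL ℝ φ)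
  have h1 : (innerSL ℝ φ : EuclideanSpace ℝ (Fin d) → ℝ) = fun w => inner ℝ φ w := rfl
  have h2 : (multivariateGaussian m S)[(innerSL ℝ φ : EuclideanSpace ℝ (Fin d) → ℝ)] =
      inner ℝ φ m := by
    rw [(innerSL ℝ φ).integral_comp_id_comm IsGaussian.integrable_id,
      integral_id_multivariateGaussian]
    rfl
  have h3 : Var[(innerSL ℝ φ : EuclideanSpace ℝ (Fin d) → ℝ); multivariateGaussian m S] =
      φ.ofLp ⬝ᵥ S *ᵥ φ.ofLp := by
    rw [← covarianceBilin_multivariateGaussian (μ := m) hS, covarianceBilin_self]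
    · rfl
    · exact IsGaussian.memLp_two_id
  rw [h2, h3, h1] at h
  exact h

/-- The difference of two independent copies has covariance `2 Λ⁻¹`, so the form has mean `tr (Λ · 2
Λ⁻¹) = 2d`, whatever `Λ` is. This is the source of the dimension factor in the information ratio. -/
lemma integral_quadratic_multivariateGaussian {Λ : Matrix (Fin d) (Fin d) ℝ} (hΛ : Λ.PosDef) :
    Integrable (fun p : EuclideanSpace ℝ (Fin d) × EuclideanSpace ℝ (Fin d) =>
        (p.1 - p.2).ofLp ⬝ᵥ Λ *ᵥ (p.1 - p.2).ofLp)
      ((multivariateGaussian m Λ⁻¹).prod (multivariateGaussian m Λ⁻¹)) ∧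
    ∫ p, (p.1 - p.2).ofLp ⬝ᵥ Λ *ᵥ (p.1 - p.2).ofLp
      ∂((multivariateGaussian m Λ⁻¹).prod (multivariateGaussian m Λ⁻¹)) = 2 * d := by
  set G := multivariateGaussian m Λ⁻¹ with hG
  have hmem : ∀ i, MemLp (fun u : EuclideanSpace ℝ (Fin d) => u i - m i) 2 G := fun i => by
    have h1 : MemLp (fun u : EuclideanSpace ℝ (Fin d) => u i) 2 G :=
      IsGaussian.memLp_dual G (EuclideanSpace.proj i) 2 (by simp)
    exact h1.sub (memLp_const _)
  have hmean : ∀ i, ∫ u : EuclideanSpace ℝ (Fin d), u i ∂G = m i := fun i => by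
    have h := (EuclideanSpace.proj i : EuclideanSpace ℝ (Fin d) →L[ℝ] ℝ).integral_comp_id_comm
      (μ := G) IsGaussian.integrable_id
    rw [hG, integral_id_multivariateGaussian] at h
    exact h
  have hint : ∀ i, Integrable (fun u : EuclideanSpace ℝ (Fin d) => u i - m i) G := fun i =>
    (hmem i).integrable (by norm_num)
  have hzero : ∀ i, ∫ u : EuclideanSpace ℝ (Fin d), (u i - m i) ∂G = 0 := fun i => by
    have h1 : Integrable (fun u : EuclideanSpace ℝ (Fin d) => u i) G :=
      ((hint i).add (integrable_const (m i))).congr (ae_of_all _ fun u => by simp)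
    rw [integral_sub h1 (integrable_const _), hmean]
    simp
  have hcov : ∀ i j, ∫ u : EuclideanSpace ℝ (Fin d), (u i - m i) * (u j - m j) ∂G = Λ⁻¹ i j := by
    intro i j
    rw [← covariance_eval_multivariateGaussian (μ := m) hΛ.inv.posSemidef i j, covariance]
    simp_rw [← hG, hmean]
  have hint2 : ∀ i j, Integrable
      (fun u : EuclideanSpace ℝ (Fin d) => (u i - m i) * (u j - m j)) G := fun i j =>
    (hmem i).integrable_mul (hmem j)
  -- The product of the coordinates `i` and `j` of `p.1 - p.2`, expanded around the common mean `m`;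
  -- the two cross terms integrate to zero by independence.
  set F : Fin d → Fin d → EuclideanSpace ℝ (Fin d) × EuclideanSpace ℝ (Fin d) → ℝ :=
    fun i j p => (p.1 i - m i) * (p.1 j - m j) - (p.1 i - m i) * (p.2 j - m j)
      - (p.1 j - m j) * (p.2 i - m i) + (p.2 i - m i) * (p.2 j - m j) with hF
  have hexp : ∀ p : EuclideanSpace ℝ (Fin d) × EuclideanSpace ℝ (Fin d),
      (p.1 - p.2).ofLp ⬝ᵥ Λ *ᵥ (p.1 - p.2).ofLp = ∑ i, ∑ j, Λ i j * F i j p := fun p => by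
    simp only [dotProduct, mulVec, Finset.mul_sum, hF]
    refine Finset.sum_congr rfl fun i _ => Finset.sum_congr rfl fun j _ => ?_
    simp only [WithLp.ofLp_sub, Pi.sub_apply]
    ring
  have hA : ∀ i j, Integrable (fun p : EuclideanSpace ℝ (Fin d) × EuclideanSpace ℝ (Fin d) =>
      (p.1 i - m i) * (p.1 j - m j)) (G.prod G) := fun i j => (hint2 i j).comp_fst G
  have hB : ∀ i j, Integrable (fun p : EuclideanSpace ℝ (Fin d) × EuclideanSpace ℝ (Fin d) =>
      (p.2 i - m i) * (p.2 j - m j)) (G.prod G) := fun i j => (hint2 i j).comp_snd G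
  have hC : ∀ i j, Integrable (fun p : EuclideanSpace ℝ (Fin d) × EuclideanSpace ℝ (Fin d) =>
      (p.1 i - m i) * (p.2 j - m j)) (G.prod G) := fun i j => (hint i).mul_prod (hint j)
  have hFint : ∀ i j, Integrable (F i j) (G.prod G) := fun i j =>
    (((hA i j).sub (hC i j)).sub (hC j i)).add (hB i j)
  have hFval : ∀ i j, ∫ p, F i j p ∂(G.prod G) = 2 * Λ⁻¹ i j := fun i j => by
    have e1 := integral_add (((hA i j).sub (hC i j)).sub (hC j i)) (hB i j)
    have e2 := integral_sub ((hA i j).sub (hC i j)) (hC j i)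
    have e3 := integral_sub (hA i j) (hC i j)
    simp only [Pi.sub_apply] at e1 e2 e3
    rw [hF]
    simp only
    rw [e1, e2, e3, integral_prod_mul (μ := G) (ν := G) (fun u => u i - m i) (fun u => u j - m j),
      integral_prod_mul (μ := G) (ν := G) (fun u => u j - m j) (fun u => u i - m i), hzero, hzero,
      integral_fun_fst (fun u : EuclideanSpace ℝ (Fin d) => (u i - m i) * (u j - m j)),
      integral_fun_snd (fun u : EuclideanSpace ℝ (Fin d) => (u i - m i) * (u j - m j)), hcov]
    simp
    ring
  simp_rw [hexp]
  refine ⟨integrable_finsetSum _ fun i _ => integrable_finsetSum _ fun j _ =>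
    (hFint i j).const_mul _, ?_⟩
  refine (integral_finsetSum _ fun i _ => integrable_finsetSum _ fun j _ =>
    (hFint i j).const_mul _).trans ?_
  have hsym : ∀ i j, Λ⁻¹ i j = Λ⁻¹ j i := fun i j => by
    simpa using congrFun (congrFun hΛ.inv.isHermitian.eq j) i
  have htr : (Λ * Λ⁻¹).trace = d := by
    rw [mul_nonsing_inv _ ((isUnit_iff_isUnit_det Λ).1 hΛ.isUnit), trace_one]
    simp
  rw [← htr, trace, Finset.mul_sum]
  refine Finset.sum_congr rfl fun i _ => ?_
  refine (integral_finsetSum _ fun j _ => (hFint i j).const_mul _).trans ?_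
  rw [diag_apply, mul_apply, Finset.mul_sum]
  refine Finset.sum_congr rfl fun j _ => ?_
  rw [integral_const_mul, hFval, hsym i j]
  ring

end Marginals

/-! ### Mutual information from explicit densities. -/

section MutualInformation

variable {W Y : Type*} [MeasurableSpace W] [MeasurableSpace Y]

lemma compProd_eq_withDensity (β : Measure W) [SFinite β] (ν : Measure Y) [SFinite ν]
    (κ : Kernel W Y) [IsSFiniteKernel κ] {f : W × Y → ℝ≥0∞} (hf : Measurable f)
    (hκ : ∀ w, κ w = ν.withDensity fun y => f (w, y)) :
    β ⊗ₘ κ = (β.prod ν).withDensity f := by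
  refine Measure.ext_of_lintegral _ fun g hg => ?_
  rw [Measure.lintegral_compProd hg, lintegral_withDensity_eq_lintegral_mul _ hf hg,
    lintegral_prod _ (hf.mul hg).aemeasurable]
  refine lintegral_congr fun w => ?_
  rw [hκ, lintegral_withDensity_eq_lintegral_mul _ (by fun_prop) (by fun_prop)]
  rfl

lemma bind_eq_withDensity (β : Measure W) [SFinite β] (ν : Measure Y) [SFinite ν]
    (κ : Kernel W Y) {f : W × Y → ℝ≥0∞} (hf : Measurable f)
    (hκ : ∀ w, κ w = ν.withDensity fun y => f (w, y)) :
    β.bind κ = ν.withDensity fun y => ∫⁻ w, f (w, y) ∂β := by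
  ext s hs
  rw [Measure.bind_apply hs κ.measurable.aemeasurable, withDensity_apply _ hs,
    lintegral_lintegral_swap (by fun_prop)]
  refine lintegral_congr fun w => ?_
  rw [hκ, withDensity_apply _ hs]

/-- The joint law and the product of the marginals both have positive exponential densities, `exp ℓ`
and `exp Z`, relative to `β.prod ν`. Their log-likelihood ratio is therefore `ℓ - Z`; the total
masses are equal, so no correction term remains in the divergence. -/
lemma mutualInfo_eq_integral_log (β : Measure W) [IsProbabilityMeasure β] (ν : Measure Y)
    [IsProbabilityMeasure ν] (κ : Kernel W Y) [IsMarkovKernel κ] {ℓ : W × Y → ℝ}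
    (hℓ : Measurable ℓ) {Z : Y → ℝ} (hZ : Measurable Z)
    (hκ : ∀ w, κ w = ν.withDensity fun y => ENNReal.ofReal (Real.exp (ℓ (w, y))))
    (hβ : ∀ y, ∫⁻ w, ENNReal.ofReal (Real.exp (ℓ (w, y))) ∂β = ENNReal.ofReal (Real.exp (Z y)))
    (hint : Integrable (fun p => ℓ p - Z p.2) (β ⊗ₘ κ)) :
    mutualInfo β κ = ENNReal.ofReal (∫ p, (ℓ p - Z p.2) ∂(β ⊗ₘ κ)) := by
  have h1 : β ⊗ₘ κ = (β.prod ν).withDensity fun p => ENNReal.ofReal (Real.exp (ℓ p)) :=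
    compProd_eq_withDensity β ν κ (by fun_prop) hκ
  have h2 : β.bind κ = ν.withDensity fun y => ENNReal.ofReal (Real.exp (Z y)) := by
    rw [bind_eq_withDensity β ν κ (f := fun p => ENNReal.ofReal (Real.exp (ℓ p)))
      (by fun_prop) hκ]
    simp_rw [hβ]
  have hprob : IsProbabilityMeasure (β.bind κ) := inferInstance
  have h3 : β.prod (β.bind κ) =
      (β.prod ν).withDensity fun p => ENNReal.ofReal (Real.exp (Z p.2)) := by
    rw [h2, prod_withDensity_right (by fun_prop)]
  have h4 : β ⊗ₘ κ = (β.prod (β.bind κ)).withDensity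
      fun p => ENNReal.ofReal (Real.exp (ℓ p - Z p.2)) := by
    rw [h1, h3, ← withDensity_mul _ (by fun_prop) (by fun_prop)]
    congr 1 with p
    rw [Pi.mul_apply, ← ENNReal.ofReal_mul (Real.exp_pos _).le, ← Real.exp_add]
    congr 2
    ring
  have hac : β ⊗ₘ κ ≪ β.prod (β.bind κ) := by
    rw [h4]; exact withDensity_absolutelyContinuous _ _
  have hllr : llr (β ⊗ₘ κ) (β.prod (β.bind κ)) =ᵐ[β ⊗ₘ κ] fun p => ℓ p - Z p.2 := by
    refine hac.ae_le ?_
    have h5 := Measure.rnDeriv_withDensity (β.prod (β.bind κ))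
      (f := fun p => ENNReal.ofReal (Real.exp (ℓ p - Z p.2))) (by fun_prop)
    rw [← h4] at h5
    filter_upwards [h5] with p hp
    rw [llr, hp, ENNReal.toReal_ofReal (Real.exp_pos _).le, Real.log_exp]
  rw [mutualInfo, InformationTheory.klDiv_of_ac_of_integrable hac ((integrable_congr hllr).2 hint),
    integral_congr_ae hllr]
  simp

end MutualInformation

/-! ### The likelihood of an episode and independent Gaussian parameters. -/

noncomputable section

variable {S A : Type*} [MeasurableSpace S] [MeasurableSpace A] {H d : ℕ}

namespace BayesMDP

variable (M : BayesMDP S A H d) {X : Type*} [MeasurableSpace X]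

/-- Law of the observation noise of one episode. -/
def noise (H : ℕ) : Measure (Fin H → ℝ) := Measure.pi fun _ : Fin H => gaussianReal 0 1

instance : IsProbabilityMeasure (noise H) := by unfold noise; infer_instance

/-- Log-likelihood of the parameter `w` given an episode, relative to pure-noise observations. -/
def logLik (e : Episode S A H) (w : Param H d) : ℝ :=
  ∑ h, (inner ℝ (M.φ (e.1 h)) (w h) * e.2 h - inner ℝ (M.φ (e.1 h)) (w h) ^ 2 / 2)

@[fun_prop]
lemma measurable_logLik : Measurable fun p : Episode S A H × Param H d => M.logLik p.1 p.2 := by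
  have := M.φ_measurable
  unfold logLik
  fun_prop

lemma lintegral_episodeLaw (p : MixedFamily S A H X) (x : X) (w : Param H d)
    {f : Episode S A H → ℝ≥0∞} (hf : Measurable f) :
    ∫⁻ e, f e ∂(M.episodeLaw p (x, w)) =
      ∫⁻ q, f (q.1, fun h => inner ℝ (M.φ (q.1 h)) (w h) + q.2 h)
        ∂((M.mixedStateActionLaw p x).prod (noise H)) := by
  have hφ := M.φ_measurable
  unfold episodeLaw
  rw [Kernel.lintegral_map _ (by fun_prop) _ hf, Kernel.prod_apply, Kernel.id_apply,
    lintegral_prod _ (by fun_prop), lintegral_dirac' _ (by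
      refine Measurable.lintegral_prod_right ?_
      fun_prop)]
  rw [Kernel.prod_apply, Kernel.comap_apply, Kernel.const_apply]
  rfl

/-- The law of the state-action sequence does not involve `w`; conditionally on it, `w` only shifts
the noise. Hence `w` enters through the density of the observations alone. -/
lemma episodeLaw_eq_withDensity (p : MixedFamily S A H X) (x : X) (w : Param H d) :
    M.episodeLaw p (x, w) = ((M.mixedStateActionLaw p x).prod (noise H)).withDensity
      fun e => ENNReal.ofReal (Real.exp (M.logLik e w)) := by
  have hφ := M.φ_measurable
  refine Measure.ext_of_lintegral _ fun f hf => ?_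
  have hl : Measurable fun e : Episode S A H => ENNReal.ofReal (Real.exp (M.logLik e w)) := by
    fun_prop
  rw [lintegral_episodeLaw M p x w hf, lintegral_withDensity_eq_lintegral_mul _ hl hf,
    lintegral_prod _ (by fun_prop), lintegral_prod _ (hl.mul hf).aemeasurable]
  refine lintegral_congr fun z => ?_
  have h := map_add_pi_gaussianReal fun h => inner ℝ (M.φ (z h)) (w h)
  have h1 : ∫⁻ y, f (z, y) ∂((Measure.pi fun _ : Fin H => gaussianReal 0 1).map
      fun ε h => inner ℝ (M.φ (z h)) (w h) + ε h) =
      ∫⁻ ε, f (z, fun h => inner ℝ (M.φ (z h)) (w h) + ε h) ∂(noise H) :=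
    lintegral_map (by fun_prop) (by fun_prop)
  rw [h, lintegral_withDensity_eq_lintegral_mul _ (by fun_prop) (by fun_prop)] at h1
  exact h1.symm

end BayesMDP

/-- Independent Gaussians with means `m h` and precision matrices `Λ h`. -/
def gaussPi (m : Fin H → EuclideanSpace ℝ (Fin d)) (Λ : Fin H → Matrix (Fin d) (Fin d) ℝ) :
    Measure (Param H d) :=
  Measure.pi fun h => multivariateGaussian (m h) (Λ h)⁻¹

instance (m : Fin H → EuclideanSpace ℝ (Fin d)) (Λ : Fin H → Matrix (Fin d) (Fin d) ℝ) :
    IsProbabilityMeasure (gaussPi m Λ) := by unfold gaussPi; infer_instance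

lemma gaussPi_map_eval (m : Fin H → EuclideanSpace ℝ (Fin d))
    (Λ : Fin H → Matrix (Fin d) (Fin d) ℝ) (h : Fin H) :
    (gaussPi m Λ).map (fun w => w h) = multivariateGaussian (m h) (Λ h)⁻¹ :=
  (measurePreserving_eval (fun h => multivariateGaussian (m h) (Λ h)⁻¹) h).map_eq

lemma noise_map_eval (h : Fin H) : (BayesMDP.noise H).map (fun ε => ε h) = gaussianReal 0 1 :=
  (measurePreserving_eval (fun _ : Fin H => gaussianReal 0 1) h).map_eq

lemma gaussPi_map_inner {m : Fin H → EuclideanSpace ℝ (Fin d)}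
    {Λ : Fin H → Matrix (Fin d) (Fin d) ℝ} (hΛ : ∀ h, (Λ h).PosDef) (h : Fin H)
    (φ : EuclideanSpace ℝ (Fin d)) :
    (gaussPi m Λ).map (fun w => inner ℝ φ (w h)) =
      gaussianReal (inner ℝ φ (m h)) (φ.ofLp ⬝ᵥ (Λ h)⁻¹ *ᵥ φ.ofLp).toNNReal := by
  rw [← map_inner_multivariateGaussian (hΛ h).inv.posSemidef, ← gaussPi_map_eval m Λ h,
    Measure.map_map (by fun_prop) (by fun_prop)]
  rfl

lemma integral_add_add_const {Ω : Type*} [MeasurableSpace Ω] {μ : Measure Ω}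
    [IsProbabilityMeasure μ] {f g : Ω → ℝ} (hf : Integrable f μ) (hg : Integrable g μ) (c : ℝ) :
    ∫ x, (f x + g x + c) ∂μ = ∫ x, f x ∂μ + ∫ x, g x ∂μ + c := by
  have h := integral_add (hf.add hg) (integrable_const c)
  simp only [Pi.add_apply] at h
  rw [h, integral_add hf hg]
  simp

lemma integrable_sq_gaussianReal (m : ℝ) (v : ℝ≥0) (c : ℝ) :
    Integrable (fun x => (x - c) ^ 2) (gaussianReal m v) :=
  ((memLp_id_gaussianReal (μ := m) (v := v) 2).sub (memLp_const c)).integrable_sq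

lemma integral_sq_gaussianReal (m : ℝ) (v : ℝ≥0) (c : ℝ) :
    ∫ x, (x - m + c) ^ 2 ∂(gaussianReal m v) = v + c ^ 2 := by
  have h1 : ∫ x, (x - m) ^ 2 ∂(gaussianReal m v) = v := by
    rw [← variance_id_gaussianReal (μ := m), variance_eq_integral aemeasurable_id]
    simp
  have hi : Integrable (fun x => x - m) (gaussianReal m v) :=
    ((memLp_id_gaussianReal (μ := m) (v := v) 1).sub (memLp_const m)).integrable le_rfl
  have h2 : ∫ x, (x - m) ∂(gaussianReal m v) = 0 := by
    have h3 : Integrable (fun x : ℝ => x) (gaussianReal m v) :=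
      (memLp_id_gaussianReal (μ := m) (v := v) 1).integrable le_rfl
    rw [integral_sub h3 (integrable_const _), integral_id_gaussianReal]
    simp
  have h4 : ∀ x, (x - m + c) ^ 2 = (x - m) ^ 2 + 2 * c * (x - m) + c ^ 2 := fun x => by ring
  simp_rw [h4]
  rw [integral_add_add_const (integrable_sq_gaussianReal m v m) (hi.const_mul _),
    integral_const_mul, h1, h2]
  simp

/-! ### The information gain of an episode under Gaussian parameters. -/

namespace BayesMDP

variable (M : BayesMDP S A H d) {X : Type*} [MeasurableSpace X]

/-- Variance of the linear predictor at `x` when the parameter has precision matrix `Λ`. -/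
def predVar (Λ : Matrix (Fin d) (Fin d) ℝ) (x : S × A) : ℝ :=
  (M.φ x).ofLp ⬝ᵥ Λ⁻¹ *ᵥ (M.φ x).ofLp

@[fun_prop]
lemma measurable_predVar (Λ : Matrix (Fin d) (Fin d) ℝ) : Measurable (M.predVar Λ) := by
  have := M.φ_measurable
  unfold predVar dotProduct mulVec dotProduct
  fun_prop

lemma predVar_nonneg {Λ : Matrix (Fin d) (Fin d) ℝ} (hΛ : Λ.PosDef) (x : S × A) :
    0 ≤ M.predVar Λ x := dotProduct_inv_mulVec_nonneg hΛ _

/-- Log-density of the predictive law of an episode, relative to pure-noise observations. -/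
def logPred (m : Fin H → EuclideanSpace ℝ (Fin d)) (Λ : Fin H → Matrix (Fin d) (Fin d) ℝ)
    (e : Episode S A H) : ℝ :=
  ∑ h, (e.2 h ^ 2 / 2 - (e.2 h - inner ℝ (M.φ (e.1 h)) (m h)) ^ 2 /
    (2 * (1 + M.predVar (Λ h) (e.1 h))) - Real.log (1 + M.predVar (Λ h) (e.1 h)) / 2)

@[fun_prop]
lemma measurable_logPred (m : Fin H → EuclideanSpace ℝ (Fin d))
    (Λ : Fin H → Matrix (Fin d) (Fin d) ℝ) : Measurable (M.logPred m Λ) := by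
  have := M.φ_measurable
  unfold logPred
  fun_prop

/-- For a fixed episode the likelihood is a product over stages and the `w_h` are independent, so
the average is a product of one-dimensional predictive densities. -/
lemma lintegral_exp_logLik {m : Fin H → EuclideanSpace ℝ (Fin d)}
    {Λ : Fin H → Matrix (Fin d) (Fin d) ℝ} (hΛ : ∀ h, (Λ h).PosDef) (e : Episode S A H) :
    ∫⁻ w, ENNReal.ofReal (Real.exp (M.logLik e w)) ∂(gaussPi m Λ) =
      ENNReal.ofReal (Real.exp (M.logPred m Λ e)) := by
  have key : ∀ h, Integrable (fun u => Real.exp (inner ℝ (M.φ (e.1 h)) u * e.2 h -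
        inner ℝ (M.φ (e.1 h)) u ^ 2 / 2)) (multivariateGaussian (m h) (Λ h)⁻¹) ∧
      ∫ u, Real.exp (inner ℝ (M.φ (e.1 h)) u * e.2 h - inner ℝ (M.φ (e.1 h)) u ^ 2 / 2)
        ∂(multivariateGaussian (m h) (Λ h)⁻¹) =
      Real.exp (e.2 h ^ 2 / 2 - (e.2 h - inner ℝ (M.φ (e.1 h)) (m h)) ^ 2 /
    (2 * (1 + M.predVar (Λ h) (e.1 h))) - Real.log (1 + M.predVar (Λ h) (e.1 h)) / 2) := fun h => by
    have h1 := integral_exp_likelihood_gaussianReal (inner ℝ (M.φ (e.1 h)) (m h))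
      (M.predVar (Λ h) (e.1 h)).toNNReal (e.2 h)
    rw [predVar, ← map_inner_multivariateGaussian (hΛ h).inv.posSemidef, ← predVar,
      Real.coe_toNNReal _ (M.predVar_nonneg (hΛ h) _)] at h1
    rw [integral_map (by fun_prop) (Measurable.aestronglyMeasurable (by fun_prop))] at h1
    exact ⟨h1.1.comp_measurable (by fun_prop), h1.2⟩
  have hint : Integrable (fun w => Real.exp (M.logLik e w)) (gaussPi m Λ) := by
    unfold logLik gaussPi
    simp_rw [Real.exp_sum]
    exact Integrable.fintype_prod (f := fun h u => Real.exp (inner ℝ (M.φ (e.1 h)) u * e.2 h -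
        inner ℝ (M.φ (e.1 h)) u ^ 2 / 2)) fun h => (key h).1
  rw [← ofReal_integral_eq_lintegral_ofReal hint (ae_of_all _ fun w => (Real.exp_pos _).le)]
  congr 1
  unfold logLik logPred gaussPi
  simp_rw [Real.exp_sum]
  rw [integral_fintype_prod_eq_prod (fun h u => Real.exp (inner ℝ (M.φ (e.1 h)) u * e.2 h -
        inner ℝ (M.φ (e.1 h)) u ^ 2 / 2))]
  exact Finset.prod_congr rfl fun h _ => (key h).2

/-- Summand of the log-likelihood ratio in terms of the noise `ε`. -/
def ratioTerm (m : EuclideanSpace ℝ (Fin d)) (Λ : Matrix (Fin d) (Fin d) ℝ)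
    (u : EuclideanSpace ℝ (Fin d)) (x : S × A) (ε : ℝ) : ℝ :=
  -(ε ^ 2 / 2) + (inner ℝ (M.φ x) u - inner ℝ (M.φ x) m + ε) ^ 2 / (2 * (1 + M.predVar Λ x)) +
    Real.log (1 + M.predVar Λ x) / 2

lemma integrable_norm_sub_sq (m : EuclideanSpace ℝ (Fin d)) (V : Matrix (Fin d) (Fin d) ℝ) :
    Integrable (fun u => ‖u - m‖ ^ 2) (multivariateGaussian m V) :=
  ((IsGaussian.memLp_two_id (μ := multivariateGaussian m V)).sub
    (memLp_const m)).integrable_norm_pow (by norm_num)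

/-- Domination by `2 (ε² + ‖w_h - m_h‖² + 1)`, which is integrable because Gaussians have second
moments. -/
lemma integrable_ratioTerm {m : Fin H → EuclideanSpace ℝ (Fin d)}
    {Λ : Fin H → Matrix (Fin d) (Fin d) ℝ} (hΛ : ∀ h, (Λ h).PosDef)
    (hv : ∀ h x, M.predVar (Λ h) x ≤ 1) (ρ : Measure (StateActions S A H))
    [IsProbabilityMeasure ρ] (h : Fin H) :
    Integrable (fun p : Param H d × Episode S A H =>
      M.ratioTerm (m h) (Λ h) (p.1 h) (p.2.1 h) (p.2.2 h))
      ((gaussPi m Λ).prod (ρ.prod (noise H))) := by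
  have hφ := M.φ_measurable
  have hε : Integrable (fun p : Param H d × Episode S A H => p.2.2 h ^ 2)
      ((gaussPi m Λ).prod (ρ.prod (noise H))) := by
    have h1 : Integrable (fun ε : Fin H → ℝ => ε h ^ 2) (noise H) := by
      have := integrable_sq_gaussianReal 0 1 0
      rw [← noise_map_eval h] at this
      simpa [Function.comp_def] using this.comp_measurable (f := fun ε : Fin H → ℝ => ε h)
        (by fun_prop)
    exact (h1.comp_snd ρ).comp_snd (gaussPi m Λ)
  have hu : Integrable (fun p : Param H d × Episode S A H => ‖p.1 h - m h‖ ^ 2)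
      ((gaussPi m Λ).prod (ρ.prod (noise H))) := by
    have h1 := integrable_norm_sub_sq (m h) (Λ h)⁻¹
    rw [← gaussPi_map_eval m Λ h] at h1
    exact (h1.comp_measurable (f := fun w : Param H d => w h) (by fun_prop)).comp_fst _
  refine ((hε.add hu).add (integrable_const (1 : ℝ))).const_mul 2 |>.mono'
    (Measurable.aestronglyMeasurable (by unfold ratioTerm; fun_prop)) (ae_of_all _ fun p => ?_)
  have hv0 := M.predVar_nonneg (hΛ h) (p.2.1 h)
  have hv1 := hv h (p.2.1 h)
  have ha : (inner ℝ (M.φ (p.2.1 h)) (p.1 h) - inner ℝ (M.φ (p.2.1 h)) (m h)) ^ 2 ≤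
      ‖p.1 h - m h‖ ^ 2 := by
    rw [← inner_sub_right, sq_le_sq, abs_norm]
    refine (abs_real_inner_le_norm _ _).trans ?_
    nlinarith [M.φ_norm_le (p.2.1 h), norm_nonneg (p.1 h - m h)]
  have hlog0 : 0 ≤ Real.log (1 + M.predVar (Λ h) (p.2.1 h)) := Real.log_nonneg (by linarith)
  have hlog1 : Real.log (1 + M.predVar (Λ h) (p.2.1 h)) ≤ 1 := by
    have := Real.log_le_sub_one_of_pos (x := 1 + M.predVar (Λ h) (p.2.1 h)) (by linarith)
    linarith
  set a := inner ℝ (M.φ (p.2.1 h)) (p.1 h) - inner ℝ (M.φ (p.2.1 h)) (m h)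
  set v := M.predVar (Λ h) (p.2.1 h)
  set ε := p.2.2 h
  have hq0 : 0 ≤ (a + ε) ^ 2 / (2 * (1 + v)) := by positivity
  have hq1 : (a + ε) ^ 2 / (2 * (1 + v)) ≤ a ^ 2 + ε ^ 2 := by
    rw [div_le_iff₀ (by linarith)]
    nlinarith [sq_nonneg (a - ε), sq_nonneg a, sq_nonneg ε]
  rw [Real.norm_eq_abs, abs_le]
  simp only [ratioTerm, Pi.add_apply]
  change -(2 * (ε ^ 2 + ‖p.1 h - m h‖ ^ 2 + 1)) ≤ -(ε ^ 2 / 2) + (a + ε) ^ 2 / (2 * (1 + v)) +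
    Real.log (1 + v) / 2 ∧ -(ε ^ 2 / 2) + (a + ε) ^ 2 / (2 * (1 + v)) +
    Real.log (1 + v) / 2 ≤ 2 * (ε ^ 2 + ‖p.1 h - m h‖ ^ 2 + 1)
  constructor <;> nlinarith [sq_nonneg ε, sq_nonneg a]

/-- Given the state-action pair, the predictive residual has variance `1 + v`. The two quadratic
terms thus average to `-1/2` and `+1/2` and cancel, leaving only the logarithm. -/
lemma integral_ratioTerm {m : Fin H → EuclideanSpace ℝ (Fin d)}
    {Λ : Fin H → Matrix (Fin d) (Fin d) ℝ} (hΛ : ∀ h, (Λ h).PosDef)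
    (hv : ∀ h x, M.predVar (Λ h) x ≤ 1) (ρ : Measure (StateActions S A H))
    [IsProbabilityMeasure ρ] (h : Fin H) :
    ∫ p, M.ratioTerm (m h) (Λ h) (p.1 h) (p.2.1 h) (p.2.2 h)
      ∂((gaussPi m Λ).prod (ρ.prod (noise H))) =
      ∫ z, Real.log (1 + M.predVar (Λ h) (z h)) / 2 ∂ρ := by
  have hI := M.integrable_ratioTerm (m := m) hΛ hv ρ h
  rw [integral_prod_symm _ hI, integral_prod _ hI.integral_prod_right]
  refine integral_congr_ae (ae_of_all _ fun z => ?_)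
  have hv0 := M.predVar_nonneg (hΛ h) (z h)
  set v := M.predVar (Λ h) (z h) with hvdef
  have h1 : ∀ ε : Fin H → ℝ, ∫ w, M.ratioTerm (m h) (Λ h) (w h) (z h) (ε h) ∂(gaussPi m Λ) =
      -(ε h ^ 2 / 2) + (v + ε h ^ 2) / (2 * (1 + v)) + Real.log (1 + v) / 2 := fun ε => by
    have h2 := gaussPi_map_inner (m := m) hΛ h (M.φ (z h))
    rw [← predVar, ← hvdef] at h2
    set g : ℝ → ℝ := fun x => -(ε h ^ 2 / 2) + (x - inner ℝ (M.φ (z h)) (m h) + ε h) ^ 2 /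
      (2 * (1 + v)) + Real.log (1 + v) / 2 with hg
    have h3 : ∫ w, M.ratioTerm (m h) (Λ h) (w h) (z h) (ε h) ∂(gaussPi m Λ) =
        ∫ x, g x ∂((gaussPi m Λ).map (fun w => inner ℝ (M.φ (z h)) (w h))) := by
      rw [integral_map (Measurable.aemeasurable (by fun_prop))
        (Measurable.aestronglyMeasurable (by fun_prop))]
      rfl
    have hi : Integrable (fun x => (x - inner ℝ (M.φ (z h)) (m h) + ε h) ^ 2)
        (gaussianReal (inner ℝ (M.φ (z h)) (m h)) v.toNNReal) := by
      refine (integrable_sq_gaussianReal _ _ (inner ℝ (M.φ (z h)) (m h) - ε h)).congr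
        (ae_of_all _ fun x => ?_)
      simp only
      ring
    rw [h3, h2, hg]
    simp only
    rw [integral_add_add_const (integrable_const _) (hi.div_const _), integral_div,
      integral_sq_gaussianReal, Real.coe_toNNReal _ hv0]
    simp
  simp_rw [h1]
  have h4 : ∫ ε, (-(ε h ^ 2 / 2) + (v + ε h ^ 2) / (2 * (1 + v)) + Real.log (1 + v) / 2)
      ∂(noise H) = ∫ y, (-(y ^ 2 / 2) + (v + y ^ 2) / (2 * (1 + v)) + Real.log (1 + v) / 2)
        ∂(gaussianReal 0 1) := by
    rw [← noise_map_eval h, integral_map (Measurable.aemeasurable (by fun_prop))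
      (Measurable.aestronglyMeasurable (by fun_prop))]
  have hi : Integrable (fun y : ℝ => y ^ 2) (gaussianReal 0 1) := by
    simpa using integrable_sq_gaussianReal 0 1 0
  have hq : ∫ y, y ^ 2 ∂(gaussianReal 0 1) = 1 := by
    simpa using integral_sq_gaussianReal 0 1 0
  have hlin : ∀ y : ℝ, (-(y ^ 2 / 2) + (v + y ^ 2) / (2 * (1 + v)) + Real.log (1 + v) / 2) =
      (1 / (2 * (1 + v)) - 1 / 2) * y ^ 2 + (v / (2 * (1 + v)) + Real.log (1 + v) / 2) :=
    fun y => by ring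
  rw [h4]
  simp_rw [hlin]
  rw [integral_add (hi.const_mul _) (integrable_const _), integral_const_mul, hq]
  simp
  field_simp
  ring

lemma logLik_sub_logPred {m : Fin H → EuclideanSpace ℝ (Fin d)}
    {Λ : Fin H → Matrix (Fin d) (Fin d) ℝ} (w : Param H d) (z : StateActions S A H)
    (ε : Fin H → ℝ) :
    M.logLik (z, fun h => inner ℝ (M.φ (z h)) (w h) + ε h) w -
      M.logPred m Λ (z, fun h => inner ℝ (M.φ (z h)) (w h) + ε h) =
    ∑ h, M.ratioTerm (m h) (Λ h) (w h) (z h) (ε h) := by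
  unfold logLik logPred ratioTerm
  rw [← Finset.sum_sub_distrib]
  refine Finset.sum_congr rfl fun h _ => ?_
  simp only
  ring

/-- The information that an episode carries about Gaussian parameters. -/
lemma infoGain_gaussPi {m : Fin H → EuclideanSpace ℝ (Fin d)}
    {Λ : Fin H → Matrix (Fin d) (Fin d) ℝ} (hΛ : ∀ h, (Λ h).PosDef)
    (hv : ∀ h x, M.predVar (Λ h) x ≤ 1) (q : MixedPolicy S A H) :
    M.infoGain (gaussPi m Λ) q = ENNReal.ofReal
      (∫ z, ∑ h, Real.log (1 + M.predVar (Λ h) (z h)) / 2 ∂(M.mixedStateActionLaw q ())) := by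
  have hφ := M.φ_measurable
  set ρ := M.mixedStateActionLaw q () with hρ
  set κ : Kernel (Param H d) (Episode S A H) :=
    (M.episodeLaw q).comap (fun w => ((), w)) (by fun_prop) with hκ
  -- Turns noise into observations, so that the joint law of parameter and episode is the image of a
  -- product measure.
  set T : Param H d × Episode S A H → Param H d × Episode S A H :=
    fun p => (p.1, (p.2.1, fun h => inner ℝ (M.φ (p.2.1 h)) (p.1 h) + p.2.2 h)) with hT
  have hTm : Measurable T := by fun_prop
  have hmap : gaussPi m Λ ⊗ₘ κ = ((gaussPi m Λ).prod (ρ.prod (noise H))).map T := by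
    refine Measure.ext_of_lintegral _ fun f hf => ?_
    rw [Measure.lintegral_compProd hf, lintegral_map hf hTm, lintegral_prod _ (by fun_prop)]
    refine lintegral_congr fun w => ?_
    rw [hκ, Kernel.comap_apply, lintegral_episodeLaw M q () w (by fun_prop)]
  have hcomp : ∀ p, M.logLik (T p).2 (T p).1 - M.logPred m Λ (T p).2 =
      ∑ h, M.ratioTerm (m h) (Λ h) (p.1 h) (p.2.1 h) (p.2.2 h) := fun p =>
    M.logLik_sub_logPred p.1 p.2.1 p.2.2
  have hmeas : Measurable fun p : Param H d × Episode S A H =>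
    M.logLik p.2 p.1 - M.logPred m Λ p.2 := by fun_prop
  have hlog : ∀ h, Integrable (fun z : StateActions S A H =>
      Real.log (1 + M.predVar (Λ h) (z h)) / 2) ρ := fun h => by
    refine Integrable.of_bound (C := 1) (Measurable.aestronglyMeasurable (by fun_prop))
      (ae_of_all _ fun z => ?_)
    have hv0 := M.predVar_nonneg (hΛ h) (z h)
    have hlog0 : 0 ≤ Real.log (1 + M.predVar (Λ h) (z h)) := Real.log_nonneg (by linarith)
    have := Real.log_le_sub_one_of_pos (x := 1 + M.predVar (Λ h) (z h)) (by linarith)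
    rw [Real.norm_eq_abs, abs_of_nonneg (by positivity)]
    linarith [hv h (z h)]
  have hI : ∀ h, Integrable (fun p : Param H d × Episode S A H =>
      M.ratioTerm (m h) (Λ h) (p.1 h) (p.2.1 h) (p.2.2 h))
      ((gaussPi m Λ).prod (ρ.prod (noise H))) := M.integrable_ratioTerm hΛ hv ρ
  rw [infoGain, mutualInfo_eq_integral_log (gaussPi m Λ) (ρ.prod (noise H)) κ
    (ℓ := fun p => M.logLik p.2 p.1) (by fun_prop) (M.measurable_logPred m Λ)
    (fun w => M.episodeLaw_eq_withDensity q () w) (fun e => M.lintegral_exp_logLik hΛ e)]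
  · rw [hmap, integral_map hTm.aemeasurable hmeas.aestronglyMeasurable]
    simp_rw [hcomp]
    rw [integral_finsetSum _ fun h _ => hI h, integral_finsetSum _ fun h _ => hlog h]
    simp_rw [M.integral_ratioTerm hΛ hv]
  · rw [hmap, integrable_map_measure hmeas.aestronglyMeasurable hTm.aemeasurable]
    exact (integrable_finsetSum _ fun h _ => hI h).congr (ae_of_all _ fun p => (hcomp p).symm)

end BayesMDP

/-- Reindexing of a family of policies. -/
def PolicyFamily.comap {X X' : Type*} [MeasurableSpace X] [MeasurableSpace X']
    (p : PolicyFamily S A H X) (f : X' → X) (hf : Measurable f) : PolicyFamily S A H X' where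
  act h := (p.act h).comap (fun z => (f z.1, z.2)) (by fun_prop)
  act_markov _ := inferInstance

/-! ### Reindexed policies, values and Thompson sampling. -/

namespace BayesMDP

variable (M : BayesMDP S A H d) {X X' : Type*} [MeasurableSpace X] [MeasurableSpace X']

lemma nextState_apply (k : ℕ) (x : X) (x' : X') (s : S) (z : Fin k → S × A) :
    M.nextState X k ((x, s), z) = M.nextState X' k ((x', s), z) := by
  cases k <;> rfl

lemma lintegral_prefixLaw_succ (p : PolicyFamily S A H X) (k : ℕ) (hk : k + 1 ≤ H) (c : X × S)
    {g : (Fin (k + 1) → S × A) → ℝ≥0∞} (hg : Measurable g) :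
    ∫⁻ z, g z ∂(M.prefixLaw p (k + 1) hk c) =
      ∫⁻ z, ∫⁻ s, ∫⁻ a, g (Fin.snoc (α := fun _ => S × A) z (s, a)) ∂(p.act ⟨k, hk⟩ (c.1, s))
        ∂(M.nextState X k (c, z)) ∂(M.prefixLaw p k (Nat.le_of_succ_le hk) c) := by
  have hm := measurable_snoc (Z := S × A) k
  have hgm := hg.comp hm
  rw [prefixLaw, Kernel.lintegral_map _ hm _ hg]
  refine (Kernel.lintegral_compProd _ _ _ hgm).trans ?_
  refine lintegral_congr fun z => ?_
  exact Kernel.lintegral_compProd _ _ _ (hgm.comp measurable_prodMk_left)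

/-- The index acts only through the action kernels; the transitions ignore it. This identifies a
member of a family, viewed as a policy of its own, with the family at that index. -/
lemma prefixLaw_comap (p : PolicyFamily S A H X) (f : X' → X) (hf : Measurable f) (k : ℕ)
    (hk : k ≤ H) (x : X') (s : S) :
    M.prefixLaw (p.comap f hf) k hk (x, s) = M.prefixLaw p k hk (f x, s) := by
  induction k with
  | zero => rfl
  | succ k ih =>
    refine Measure.ext_of_lintegral _ fun g hg => ?_
    rw [lintegral_prefixLaw_succ M _ k hk _ hg, lintegral_prefixLaw_succ M _ k hk _ hg, ih]
    refine lintegral_congr fun z => ?_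
    rw [M.nextState_apply (X := X') (X' := X) k x (f x) s z]
    rfl

lemma stateActionLaw_comap (p : PolicyFamily S A H X) (f : X' → X) (hf : Measurable f)
    (x : X') (s : S) :
    M.stateActionLaw (p.comap f hf) (x, s) = M.stateActionLaw p (f x, s) :=
  M.prefixLaw_comap p f hf H le_rfl x s

lemma value_comap (p : PolicyFamily S A H X) (f : X' → X) (hf : Measurable f) (x : X') (s : S)
    (w : Param H d) : M.value (p.comap f hf) x s w = M.value p (f x) s w := by
  rw [value, stateActionLaw_comap, value]

lemma mixedStateActionLaw_apply (p : MixedFamily S A H X) (x : X) :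
    M.mixedStateActionLaw p x =
      ((p.law x).prod M.init).bind fun y => M.stateActionLaw p.fam ((x, y.1), y.2) := by
  rw [mixedStateActionLaw, Kernel.comp_apply, Kernel.prod_apply, Kernel.prod_apply,
    Kernel.id_apply, Kernel.const_apply, Measure.dirac_prod]
  have h : (((p.law x).map (Prod.mk x)).prod M.init) =
      ((p.law x).prod M.init).map fun y => ((x, y.1), y.2) := by
    have := Measure.map_prod_map (p.law x) M.init (measurable_prodMk_left (x := x)) measurable_id
    rw [Measure.map_id] at this
    exact this
  have hm : Measurable fun y : p.Seed × S => M.stateActionLaw p.fam ((x, y.1), y.2) :=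
    (Kernel.measurable _).comp (by fun_prop)
  ext t ht
  rw [h, Measure.bind_apply ht (Kernel.measurable _).aemeasurable,
    Measure.bind_apply ht hm.aemeasurable,
    lintegral_map (Kernel.measurable_coe _ ht) (by fun_prop)]

lemma mixedStateActionLaw_at (p : MixedFamily S A H X) (x : X) :
    M.mixedStateActionLaw (p.at x) () = M.mixedStateActionLaw p x := by
  rw [mixedStateActionLaw_apply, mixedStateActionLaw_apply]
  refine congrArg (Measure.bind _) (funext fun y => ?_)
  exact M.stateActionLaw_comap p.fam (fun z : Unit × p.Seed => (x, z.2)) (by fun_prop) _ _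

/-- The reward collected along a state-action sequence. -/
def reward (z : StateActions S A H) (w : Param H d) : ℝ :=
  ∑ h, M.link (inner ℝ (M.φ (z h)) (w h))

@[fun_prop]
lemma measurable_reward :
    Measurable fun p : StateActions S A H × Param H d => M.reward p.1 p.2 := by
  have := M.φ_measurable
  have := M.link_lipschitz.continuous.measurable
  unfold reward
  fun_prop

/-- A bound on the reward of any state-action sequence. -/
def rewardBound (w : Param H d) : ℝ := ∑ h, (|M.link 0| + ‖w h‖)

/-- A `1`-Lipschitz link grows at most linearly and features have norm at most one. Rewards may be
unbounded in `w`, so this envelope, integrable under Gaussian parameters, supplies the domination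
needed for Fubini. -/
lemma abs_reward_le (z : StateActions S A H) (w : Param H d) :
    |M.reward z w| ≤ M.rewardBound w := by
  refine (Finset.abs_sum_le_sum_abs _ _).trans (Finset.sum_le_sum fun h _ => ?_)
  have h1 := M.link_lipschitz.dist_le_mul (inner ℝ (M.φ (z h)) (w h)) 0
  rw [Real.dist_eq, Real.dist_eq, sub_zero, NNReal.coe_one, one_mul] at h1
  have h2 := (abs_real_inner_le_norm (M.φ (z h)) (w h))
  have h3 : ‖M.φ (z h)‖ * ‖w h‖ ≤ ‖w h‖ :=
    mul_le_of_le_one_left (norm_nonneg _) (M.φ_norm_le _)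
  have h4 := abs_sub_abs_le_abs_sub (M.link (inner ℝ (M.φ (z h)) (w h))) (M.link 0)
  linarith

lemma integrable_reward (ρ : Measure (StateActions S A H)) [IsFiniteMeasure ρ] (w : Param H d) :
    Integrable (fun z => M.reward z w) ρ :=
  Integrable.of_bound (C := M.rewardBound w) (Measurable.aestronglyMeasurable (by fun_prop))
    (ae_of_all _ fun z => M.abs_reward_le z w)

lemma integrable_rewardBound (m : Fin H → EuclideanSpace ℝ (Fin d))
    (Λ : Fin H → Matrix (Fin d) (Fin d) ℝ) : Integrable M.rewardBound (gaussPi m Λ) := by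
  refine integrable_finsetSum _ fun h _ => (integrable_const _).add ?_
  have h1 : Integrable (fun u => ‖u‖) (multivariateGaussian (m h) (Λ h)⁻¹) :=
    IsGaussian.integrable_id.norm
  rw [← gaussPi_map_eval m Λ h] at h1
  exact h1.comp_measurable (f := fun w : Param H d => w h) (by fun_prop)

lemma value_eq (p : PolicyFamily S A H X) (x : X) (s : S) (w : Param H d) :
    M.value p x s w = ∫ z, M.reward z w ∂(M.stateActionLaw p (x, s)) := rfl

@[fun_prop]
lemma measurable_value (p : PolicyFamily S A H X) :
    Measurable fun c : X × S × Param H d => M.value p c.1 c.2.1 c.2.2 := by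
  have h := StronglyMeasurable.integral_kernel_prod_right'
    (κ := (M.stateActionLaw p).comap (fun c : X × S × Param H d => (c.1, c.2.1)) (by fun_prop))
    (f := fun q : (X × S × Param H d) × StateActions S A H => M.reward q.2 q.1.2.2)
    (Measurable.stronglyMeasurable (by fun_prop))
  exact h.measurable

lemma abs_value_le (p : PolicyFamily S A H X) (x : X) (s : S) (w : Param H d) :
    |M.value p x s w| ≤ M.rewardBound w := by
  rw [value_eq, ← Real.norm_eq_abs]
  refine (norm_integral_le_of_norm_le_const (C := M.rewardBound w)
    (ae_of_all _ fun z => M.abs_reward_le z w)).trans ?_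
  simp

/-- Removing `at` writes the regret as iterated kernel integrals, from which measurability in the
index, that is, in the history, can be read off. -/
lemma regret_at (piStar : PolicyFamily S A H (Param H d)) (β : Measure (Param H d))
    (p : MixedFamily S A H X) (x : X) :
    M.regret piStar β (p.at x) =
      ∫ w, ∫ s, (M.value piStar w s w - ∫ u, M.value p.fam (x, u) s w ∂(p.law x)) ∂M.init ∂β := by
  refine integral_congr_ae (ae_of_all _ fun w => integral_congr_ae (ae_of_all _ fun s => ?_))
  exact congrArg (fun r => M.value piStar w s w - r) (integral_congr_ae (ae_of_all _ fun u =>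
    M.value_comap p.fam (fun z : Unit × p.Seed => (x, z.2)) (by fun_prop) ((), u) s w))

lemma measurable_regret_at (piStar : PolicyFamily S A H (Param H d))
    (κ : Kernel X (Param H d)) [IsMarkovKernel κ] (p : MixedFamily S A H X) :
    Measurable fun x => M.regret piStar (κ x) (p.at x) := by
  simp_rw [regret_at]
  have h1 : Measurable fun c : (X × Param H d) × S =>
      ∫ u, M.value p.fam (c.1.1, u) c.2 c.1.2 ∂(p.law c.1.1) :=
    (StronglyMeasurable.integral_kernel_prod_right'
      (κ := p.law.comap (fun c : (X × Param H d) × S => c.1.1) (by fun_prop))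
      (f := fun q : ((X × Param H d) × S) × p.Seed => M.value p.fam (q.1.1.1, q.2) q.1.2 q.1.1.2)
      (Measurable.stronglyMeasurable (by fun_prop))).measurable
  have h2 : Measurable fun c : X × Param H d => ∫ s, (M.value piStar c.2 s c.2 -
      ∫ u, M.value p.fam (c.1, u) s c.2 ∂(p.law c.1)) ∂M.init :=
    (StronglyMeasurable.integral_prod_right' (f := fun q : (X × Param H d) × S =>
      M.value piStar q.1.2 q.2 q.1.2 - ∫ u, M.value p.fam (q.1.1, u) q.2 q.1.2 ∂(p.law q.1.1))
      (Measurable.stronglyMeasurable (by fun_prop))).measurable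
  exact (StronglyMeasurable.integral_kernel_prod_right' (κ := κ)
    h2.stronglyMeasurable).measurable

/-- Thompson sampling: the seed is a parameter drawn from `β`, and the policy that is optimal for
it is played. -/
def thompson (piStar : PolicyFamily S A H (Param H d)) (β : Measure (Param H d))
    [IsProbabilityMeasure β] : MixedPolicy S A H where
  Seed := Param H d
  seedSpace := inferInstance
  law := Kernel.const Unit β
  law_markov := inferInstance
  fam := piStar.comap Prod.snd measurable_snd

lemma thompson_inClosure (piStar : PolicyFamily S A H (Param H d)) (β : Measure (Param H d))
    [IsProbabilityMeasure β] {C : Set (Policy S A H)} (hC : ∀ w, piStar.at w ∈ C) :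
    (thompson piStar β).InClosure C :=
  ae_of_all _ fun u => hC u

/-- Expected reward, averaged over the first state, of the policy with index `x`. -/
def meanValue (p : PolicyFamily S A H X) (x : X) (w : Param H d) : ℝ :=
  ∫ s, M.value p x s w ∂M.init

@[fun_prop]
lemma measurable_meanValue (p : PolicyFamily S A H X) :
    Measurable fun c : X × Param H d => M.meanValue p c.1 c.2 :=
  (StronglyMeasurable.integral_prod_right' (f := fun q : (X × Param H d) × S =>
    M.value p q.1.1 q.2 q.1.2) (Measurable.stronglyMeasurable (by fun_prop))).measurable

lemma abs_meanValue_le (p : PolicyFamily S A H X) (x : X) (w : Param H d) :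
    |M.meanValue p x w| ≤ M.rewardBound w := by
  rw [meanValue, ← Real.norm_eq_abs]
  refine (norm_integral_le_of_norm_le_const (C := M.rewardBound w)
    (ae_of_all _ fun z => M.abs_value_le p x z w)).trans ?_
  simp

lemma integrable_value_init (p : PolicyFamily S A H X) (x : X) (w : Param H d) :
    Integrable (fun s => M.value p x s w) M.init :=
  Integrable.of_bound (C := M.rewardBound w) (Measurable.aestronglyMeasurable (by fun_prop))
    (ae_of_all _ fun z => M.abs_value_le p x z w)

/-- Since the sampled parameter has the same law as the true one, the comparator value `V(π*_w; w)`
may be replaced by `V(π*_u; u)` under the integral. The regret then compares a single policy under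
two independent parameters. -/
lemma regret_thompson (piStar : PolicyFamily S A H (Param H d)) (β : Measure (Param H d))
    [IsProbabilityMeasure β] (hβ : Integrable M.rewardBound β) :
    M.regret piStar β (thompson piStar β) =
      ∫ p, (M.meanValue piStar p.1 p.1 - M.meanValue piStar p.1 p.2) ∂(β.prod β) := by
  have h1 : ∀ w, ∫ s, (M.value piStar w s w - ∫ u, M.value piStar u s w ∂β) ∂M.init =
      M.meanValue piStar w w - ∫ u, M.meanValue piStar u w ∂β := fun w => by
    have hi : Integrable (fun q : S × Param H d => M.value piStar q.2 q.1 w) (M.init.prod β) :=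
      Integrable.of_bound (C := M.rewardBound w) (Measurable.aestronglyMeasurable (by fun_prop))
        (ae_of_all _ fun q => M.abs_value_le piStar q.2 q.1 w)
    rw [integral_sub (M.integrable_value_init piStar w w) hi.integral_prod_left,
      integral_integral_swap hi]
    rfl
  have h2 : Integrable (fun w => M.meanValue piStar w w) β :=
    hβ.mono' (Measurable.aestronglyMeasurable (by fun_prop))
      (ae_of_all _ fun w => M.abs_meanValue_le piStar w w)
  have h3 : Integrable (fun p : Param H d × Param H d => M.meanValue piStar p.1 p.2)
      (β.prod β) :=
    (hβ.comp_snd β).mono' (Measurable.aestronglyMeasurable (by fun_prop))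
      (ae_of_all _ fun p => M.abs_meanValue_le piStar p.1 p.2)
  have h4 : Integrable (fun w => ∫ u, M.meanValue piStar u w ∂β) β := h3.integral_prod_right
  calc M.regret piStar β (thompson piStar β)
      = ∫ w, (M.meanValue piStar w w - ∫ u, M.meanValue piStar u w ∂β) ∂β := by
        refine integral_congr_ae (ae_of_all _ fun w => ?_)
        refine Eq.trans (integral_congr_ae (ae_of_all _ fun s => ?_)) (h1 w)
        exact congrArg (fun r => M.value piStar w s w - r) (integral_congr_ae (ae_of_all _ fun u =>
          M.value_comap piStar Prod.snd measurable_snd ((), u) s w))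
    _ = _ := by
        rw [integral_sub h2 h4, integral_sub (h2.comp_fst β) h3, integral_prod_symm _ h3,
          integral_fun_fst (fun w => M.meanValue piStar w w)]
        simp

end BayesMDP

end

lemma integral_bind_eq {U V : Type*} [MeasurableSpace U] [MeasurableSpace V] (μ : Measure U)
    [SFinite μ] (κ : Kernel U V) [IsSFiniteKernel κ] {f : V → ℝ}
    (hf : Integrable f (μ.bind κ)) :
    ∫ v, f v ∂(μ.bind κ) = ∫ u, ∫ v, f v ∂(κ u) ∂μ := by
  have h := Measure.snd_compProd μ κ
  rw [← h, Measure.snd] at hf ⊢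
  rw [integral_map measurable_snd.aemeasurable hf.aestronglyMeasurable,
    Measure.integral_compProd (f := fun p : U × V => f p.2)
      ((integrable_map_measure hf.aestronglyMeasurable measurable_snd.aemeasurable).1 hf)]

lemma abs_integral_le_integral_add {U : Type*} [MeasurableSpace U] {μ : Measure U}
    {f g k : U → ℝ} (hg : Integrable g μ) (hk : Integrable k μ) (h : ∀ x, |f x| ≤ g x + k x) :
    |∫ x, f x ∂μ| ≤ ∫ x, g x ∂μ + ∫ x, k x ∂μ := by
  rw [← integral_add hg hk, ← Real.norm_eq_abs]
  exact norm_integral_le_of_norm_le (hg.add hk) (ae_of_all _ h)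

/-- Nonnegativity of the `Λ`-form at `±a Λ⁻¹ φ + v`. This is Cauchy–Schwarz in its additive form,
with a free weight `a`, so that the two summands can be integrated separately before optimising. -/
lemma abs_inner_le_quadratic {d : ℕ} {Λ : Matrix (Fin d) (Fin d) ℝ} (hΛ : Λ.PosDef)
    {a : ℝ} (ha : 0 < a) (φ v : EuclideanSpace ℝ (Fin d)) :
    |inner ℝ φ v| ≤ a / 2 * (φ.ofLp ⬝ᵥ Λ⁻¹ *ᵥ φ.ofLp) +
      (v.ofLp ⬝ᵥ Λ *ᵥ v.ofLp) / (2 * a) := by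
  have hu : IsUnit Λ.det := (isUnit_iff_isUnit_det Λ).1 hΛ.isUnit
  have hΛt : Λᵀ = Λ := by simpa using hΛ.isHermitian.eq
  have hin : inner ℝ φ v = φ.ofLp ⬝ᵥ v.ofLp := by
    rw [EuclideanSpace.inner_eq_star_dotProduct, star_trivial, dotProduct_comm]
  have hΛφ : Λ *ᵥ (Λ⁻¹ *ᵥ φ.ofLp) = φ.ofLp := by
    rw [mulVec_mulVec, mul_nonsing_inv _ hu, one_mulVec]
  have h1 : (Λ⁻¹ *ᵥ φ.ofLp) ⬝ᵥ (Λ *ᵥ v.ofLp) = φ.ofLp ⬝ᵥ v.ofLp := by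
    rw [dotProduct_mulVec, ← mulVec_transpose, hΛt, hΛφ]
  have key : ∀ b : ℝ, 0 ≤ b ^ 2 * (φ.ofLp ⬝ᵥ Λ⁻¹ *ᵥ φ.ofLp) + 2 * b * (φ.ofLp ⬝ᵥ v.ofLp) +
      v.ofLp ⬝ᵥ Λ *ᵥ v.ofLp := fun b => by
    have h := hΛ.posSemidef.dotProduct_mulVec_nonneg (b • (Λ⁻¹ *ᵥ φ.ofLp) + v.ofLp)
    simp only [star_trivial, mulVec_add, mulVec_smul, hΛφ, dotProduct_add, add_dotProduct,
      smul_dotProduct, dotProduct_smul, smul_eq_mul, h1, dotProduct_comm (Λ⁻¹ *ᵥ φ.ofLp) φ.ofLp,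
      dotProduct_comm v.ofLp φ.ofLp] at h
    linarith
  have hp := key a
  have hn := key (-a)
  set q := φ.ofLp ⬝ᵥ Λ⁻¹ *ᵥ φ.ofLp
  set r := φ.ofLp ⬝ᵥ v.ofLp
  set t := v.ofLp ⬝ᵥ Λ *ᵥ v.ofLp
  have h2 : a / 2 * q + t / (2 * a) = (a ^ 2 * q + t) / (2 * a) := by field_simp
  rw [hin, h2, le_div_iff₀ (by positivity), abs_eq_max_neg, max_mul_of_nonneg _ _ (by positivity)]
  exact max_le (by nlinarith) (by nlinarith)

/-! ### The regret of Thompson sampling and the information ratio. -/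

noncomputable section

variable {S A : Type*} [MeasurableSpace S] [MeasurableSpace A] {H d : ℕ}

namespace BayesMDP

variable (M : BayesMDP S A H d) {X : Type*} [MeasurableSpace X]

/-- Total variance of the linear predictors along a state-action sequence. -/
def totalVar (Λ : Fin H → Matrix (Fin d) (Fin d) ℝ) (z : StateActions S A H) : ℝ :=
  ∑ h, M.predVar (Λ h) (z h)

@[fun_prop]
lemma measurable_totalVar (Λ : Fin H → Matrix (Fin d) (Fin d) ℝ) :
    Measurable (M.totalVar Λ) := by
  unfold totalVar; fun_prop

variable {m : Fin H → EuclideanSpace ℝ (Fin d)} {Λ : Fin H → Matrix (Fin d) (Fin d) ℝ}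

lemma totalVar_nonneg (hΛ : ∀ h, (Λ h).PosDef) (z : StateActions S A H) : 0 ≤ M.totalVar Λ z :=
  Finset.sum_nonneg fun h _ => M.predVar_nonneg (hΛ h) _

lemma totalVar_le (hv : ∀ h x, M.predVar (Λ h) x ≤ 1) (z : StateActions S A H) :
    M.totalVar Λ z ≤ H := by
  unfold totalVar
  simpa using Finset.sum_le_sum fun h (_ : h ∈ Finset.univ) => hv h (z h)

lemma integrable_totalVar (hΛ : ∀ h, (Λ h).PosDef) (hv : ∀ h x, M.predVar (Λ h) x ≤ 1)
    (ρ : Measure (StateActions S A H)) [IsFiniteMeasure ρ] : Integrable (M.totalVar Λ) ρ := by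
  refine Integrable.of_bound (C := H) (Measurable.aestronglyMeasurable (by fun_prop))
    (ae_of_all _ fun z => ?_)
  rw [Real.norm_eq_abs, abs_of_nonneg (M.totalVar_nonneg hΛ z)]
  exact M.totalVar_le hv z

lemma integral_mixedStateActionLaw (p : MixedFamily S A H X) (x : X)
    {f : StateActions S A H → ℝ} (hf : Measurable f) {B : ℝ} (hB : ∀ z, |f z| ≤ B) :
    ∫ z, f z ∂(M.mixedStateActionLaw p x) =
      ∫ u, ∫ s, ∫ z, f z ∂(M.stateActionLaw p.fam ((x, u), s)) ∂M.init ∂(p.law x) := by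
  set κ : Kernel (p.Seed × S) (StateActions S A H) :=
    (M.stateActionLaw p.fam).comap (fun y => ((x, y.1), y.2)) (by fun_prop) with hκ
  have h : M.mixedStateActionLaw p x = ((p.law x).prod M.init).bind κ :=
    M.mixedStateActionLaw_apply p x
  have hi : Integrable f (((p.law x).prod M.init).bind κ) := by
    rw [← h]
    exact Integrable.of_bound (C := B) hf.aestronglyMeasurable (ae_of_all _ hB)
  have hB0 : 0 ≤ B ∨ IsEmpty (StateActions S A H) := by
    by_cases hne : Nonempty (StateActions S A H)
    · exact Or.inl ((abs_nonneg _).trans (hB hne.some))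
    · exact Or.inr (not_nonempty_iff.1 hne)
  have hi2 : Integrable (fun y => ∫ z, f z ∂(κ y)) ((p.law x).prod M.init) := by
    refine Integrable.of_bound (C := B) hf.stronglyMeasurable.integral_kernel.aestronglyMeasurable
      (ae_of_all _ fun y => ?_)
    refine (norm_integral_le_of_norm_le_const (C := B) (ae_of_all _ hB)).trans ?_
    simp
  rw [h, integral_bind_eq _ _ hi, integral_prod _ hi2]
  rfl

/-- Sum over the stages of the squared distances of two parameters in the precision norms. -/
def precDist (Λ : Fin H → Matrix (Fin d) (Fin d) ℝ) (p : Param H d × Param H d) : ℝ :=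
  ∑ h, (p.1 h - p.2 h).ofLp ⬝ᵥ Λ h *ᵥ (p.1 h - p.2 h).ofLp

lemma integral_precDist (hΛ : ∀ h, (Λ h).PosDef) :
    Integrable (precDist Λ) ((gaussPi m Λ).prod (gaussPi m Λ)) ∧
      ∫ p, precDist Λ p ∂((gaussPi m Λ).prod (gaussPi m Λ)) = 2 * d * H := by
  have key : ∀ h, Integrable (fun p : Param H d × Param H d =>
        (p.1 h - p.2 h).ofLp ⬝ᵥ Λ h *ᵥ (p.1 h - p.2 h).ofLp)
        ((gaussPi m Λ).prod (gaussPi m Λ)) ∧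
      ∫ p, (p.1 h - p.2 h).ofLp ⬝ᵥ Λ h *ᵥ (p.1 h - p.2 h).ofLp
        ∂((gaussPi m Λ).prod (gaussPi m Λ)) = 2 * d := fun h => by
    have h1 := integral_quadratic_multivariateGaussian (m := m h) (hΛ h)
    have h2 := Measure.map_prod_map (gaussPi m Λ) (gaussPi m Λ)
      (measurable_pi_apply h) (measurable_pi_apply h)
    have h3 : (gaussPi m Λ).map (Function.eval h) = multivariateGaussian (m h) (Λ h)⁻¹ :=
      gaussPi_map_eval m Λ h
    rw [h3] at h2
    rw [h2] at h1
    have hm : Measurable (Prod.map (Function.eval h) (Function.eval h) :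
      Param H d × Param H d → _) := (measurable_pi_apply h).prodMap (measurable_pi_apply h)
    rw [integral_map hm.aemeasurable h1.1.aestronglyMeasurable] at h1
    exact ⟨h1.1.comp_measurable hm, h1.2⟩
  refine ⟨integrable_finsetSum _ fun h _ => (key h).1, ?_⟩
  unfold precDist
  rw [integral_finsetSum _ fun h _ => (key h).1]
  simp_rw [fun h => (key h).2]
  simp
  ring

lemma abs_reward_sub_le (hΛ : ∀ h, (Λ h).PosDef) {a : ℝ} (ha : 0 < a)
    (z : StateActions S A H) (u w : Param H d) :
    |M.reward z u - M.reward z w| ≤ a / 2 * M.totalVar Λ z + precDist Λ (u, w) / (2 * a) := by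
  unfold reward totalVar precDist
  rw [← Finset.sum_sub_distrib, Finset.mul_sum, Finset.sum_div, ← Finset.sum_add_distrib]
  refine (Finset.abs_sum_le_sum_abs _ _).trans (Finset.sum_le_sum fun h _ => ?_)
  have h1 := M.link_lipschitz.dist_le_mul (inner ℝ (M.φ (z h)) (u h)) (inner ℝ (M.φ (z h)) (w h))
  rw [Real.dist_eq, Real.dist_eq, NNReal.coe_one, one_mul, ← inner_sub_right] at h1
  exact h1.trans (abs_inner_le_quadratic (hΛ h) ha _ _)

lemma abs_meanValue_sub_le (hΛ : ∀ h, (Λ h).PosDef) (hv : ∀ h x, M.predVar (Λ h) x ≤ 1)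
    (p : PolicyFamily S A H X) (x : X) {a : ℝ} (ha : 0 < a) (u w : Param H d) :
    |M.meanValue p x u - M.meanValue p x w| ≤
      a / 2 * ∫ s, ∫ z, M.totalVar Λ z ∂(M.stateActionLaw p (x, s)) ∂M.init +
        precDist Λ (u, w) / (2 * a) := by
  have hs : ∀ s, |M.value p x s u - M.value p x s w| ≤
      a / 2 * ∫ z, M.totalVar Λ z ∂(M.stateActionLaw p (x, s)) +
        precDist Λ (u, w) / (2 * a) := fun s => by
    have hi := (M.integrable_totalVar hΛ hv (M.stateActionLaw p (x, s))).const_mul (a / 2)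
    rw [value_eq, value_eq, ← integral_sub (M.integrable_reward _ u) (M.integrable_reward _ w)]
    refine (abs_integral_le_integral_add hi (integrable_const (precDist Λ (u, w) / (2 * a)))
      fun z => M.abs_reward_sub_le hΛ ha z u w).trans (le_of_eq ?_)
    rw [integral_const_mul]
    simp
  have hi : Integrable (fun s => ∫ z, M.totalVar Λ z ∂(M.stateActionLaw p (x, s))) M.init := by
    refine Integrable.of_bound (C := H) ?_ (ae_of_all _ fun s => ?_)
    · exact ((measurable_totalVar M Λ).stronglyMeasurable.integral_kernel
        (κ := M.stateActionLaw p)).comp_measurable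
          (measurable_prodMk_left) |>.aestronglyMeasurable
    · refine (norm_integral_le_of_norm_le_const (C := H) (ae_of_all _ fun z => ?_)).trans ?_
      · rw [Real.norm_eq_abs, abs_of_nonneg (M.totalVar_nonneg hΛ z)]
        exact M.totalVar_le hv z
      · simp
  have hi2 := hi.const_mul (a / 2)
  rw [meanValue, meanValue, ← integral_sub (M.integrable_value_init p x u)
    (M.integrable_value_init p x w)]
  refine (abs_integral_le_integral_add hi2 (integrable_const (precDist Λ (u, w) / (2 * a)))
    hs).trans (le_of_eq ?_)
  rw [integral_const_mul]
  simp

/-- The played policy depends on the sampled parameter `u`, so the episode and `u - w` are not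
independent. Young's inequality decouples them: one summand sees only the played policy, the other
only the pair `(u, w)`, whose mean squared precision distance is `2dH`. -/
lemma regret_thompson_abs_le (hΛ : ∀ h, (Λ h).PosDef) (hv : ∀ h x, M.predVar (Λ h) x ≤ 1)
    (piStar : PolicyFamily S A H (Param H d)) {a : ℝ} (ha : 0 < a) :
    |M.regret piStar (gaussPi m Λ) (thompson piStar (gaussPi m Λ))| ≤
      a / 2 * ∫ z, M.totalVar Λ z
        ∂(M.mixedStateActionLaw (thompson piStar (gaussPi m Λ)) ()) + d * H / a := by
  set β := gaussPi m Λ with hβ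
  have hJ : ∫ z, M.totalVar Λ z ∂(M.mixedStateActionLaw (thompson piStar β) ()) =
      ∫ u, ∫ s, ∫ z, M.totalVar Λ z ∂(M.stateActionLaw piStar (u, s)) ∂M.init ∂β := by
    rw [M.integral_mixedStateActionLaw (thompson piStar β) () (M.measurable_totalVar Λ) (B := H)
      fun z => by
        rw [abs_of_nonneg (M.totalVar_nonneg hΛ z)]
        exact M.totalVar_le hv z]
    refine integral_congr_ae (ae_of_all _ fun u => integral_congr_ae (ae_of_all _ fun s => ?_))
    exact congrArg (fun μ => ∫ z, M.totalVar Λ z ∂μ)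
      (M.stateActionLaw_comap piStar Prod.snd measurable_snd ((), u) s)
  have hi : Integrable (fun u =>
      ∫ s, ∫ z, M.totalVar Λ z ∂(M.stateActionLaw piStar (u, s)) ∂M.init) β := by
    refine Integrable.of_bound (C := H) ?_ (ae_of_all _ fun u => ?_)
    · exact (StronglyMeasurable.integral_prod_right' ((measurable_totalVar M
        Λ).stronglyMeasurable.integral_kernel (κ := M.stateActionLaw piStar))).aestronglyMeasurable
    · refine (norm_integral_le_of_norm_le_const (C := H) (ae_of_all _ fun s =>
        (norm_integral_le_of_norm_le_const (C := H) (ae_of_all _ fun z => ?_)).trans ?_)).trans ?_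
      · rw [Real.norm_eq_abs, abs_of_nonneg (M.totalVar_nonneg hΛ z)]
        exact M.totalVar_le hv z
      · simp
      · simp
  have hi2 := (hi.const_mul (a / 2)).comp_fst β
  have hq := integral_precDist (m := m) hΛ
  rw [regret_thompson M piStar β (M.integrable_rewardBound m Λ), hJ]
  refine (abs_integral_le_integral_add hi2 (hq.1.div_const (2 * a))
    fun p => M.abs_meanValue_sub_le hΛ hv piStar p.1 ha p.1 p.2).trans (le_of_eq ?_)
  rw [integral_div, hq.2,
    integral_fun_fst (fun u => a / 2 *
      ∫ s, ∫ z, M.totalVar Λ z ∂(M.stateActionLaw piStar (u, s)) ∂M.init), integral_const_mul]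
  simp
  field_simp

end BayesMDP

/-- Optimising a family of bounds over a positive parameter. -/
lemma sq_le_of_forall_le {x J K : ℝ} (hx : 0 ≤ x) (hJ : 0 ≤ J) (hK : 0 ≤ K)
    (h : ∀ a > 0, x ≤ a / 2 * J + K / (2 * a)) : x ^ 2 ≤ J * K := by
  by_contra! hlt
  have hxp : 0 < x := by
    rcases hx.eq_or_lt with rfl | hx
    · nlinarith [mul_nonneg hJ hK]
    · exact hx
  rcases hJ.eq_or_lt with rfl | hJ
  · have h1 := h ((K + 1) / x) (by positivity)
    have h2 : K / (2 * ((K + 1) / x)) = x * (K / (2 * (K + 1))) := by field_simp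
    rw [h2, mul_zero, zero_add] at h1
    have h3 : K / (2 * (K + 1)) < 1 := by rw [div_lt_one (by positivity)]; linarith
    nlinarith
  · have h1 := h (x / J) (by positivity)
    have h2 : x / J / 2 * J + K / (2 * (x / J)) = x / 2 + K * J / (2 * x) := by field_simp
    rw [h2] at h1
    have h3 : K * J / (2 * x) < x / 2 := by
      rw [div_lt_div_iff₀ (by positivity) (by positivity)]
      nlinarith
    linarith

namespace BayesMDP

variable (M : BayesMDP S A H d) {m : Fin H → EuclideanSpace ℝ (Fin d)}
  {Λ : Fin H → Matrix (Fin d) (Fin d) ℝ}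

lemma regret_thompson_sq_le (hΛ : ∀ h, (Λ h).PosDef) (hv : ∀ h x, M.predVar (Λ h) x ≤ 1)
    (piStar : PolicyFamily S A H (Param H d)) :
    M.regret piStar (gaussPi m Λ) (thompson piStar (gaussPi m Λ)) ^ 2 ≤
      (∫ z, M.totalVar Λ z ∂(M.mixedStateActionLaw (thompson piStar (gaussPi m Λ)) ())) *
        (2 * d * H) := by
  rw [← sq_abs]
  refine sq_le_of_forall_le (abs_nonneg _) (integral_nonneg fun z => M.totalVar_nonneg hΛ z)
    (by positivity) fun a ha => (M.regret_thompson_abs_le hΛ hv piStar ha).trans (le_of_eq ?_)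
  congr 1
  field_simp

/-- Information, in nats, that an episode with state-action sequence `z` carries about parameters
with precision matrices `Λ`. -/
def seqInfo (Λ : Fin H → Matrix (Fin d) (Fin d) ℝ) (z : StateActions S A H) : ℝ :=
  ∑ h, Real.log (1 + M.predVar (Λ h) (z h)) / 2

@[fun_prop]
lemma measurable_seqInfo (Λ : Fin H → Matrix (Fin d) (Fin d) ℝ) :
    Measurable (M.seqInfo Λ) := by
  unfold seqInfo; fun_prop

/-- The concave logarithm lies above its chord on `[1, 2]`. The constant `log 2` of the theorem
comes from here. -/
lemma log_two_mul_le_log_one_add {x : ℝ} (h0 : 0 ≤ x) (h1 : x ≤ 1) :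
    Real.log 2 * x ≤ Real.log (1 + x) := by
  have h := strictConcaveOn_log_Ioi.concaveOn.2 (show (1 : ℝ) ∈ Set.Ioi 0 by simp)
    (show (2 : ℝ) ∈ Set.Ioi 0 by simp) (sub_nonneg.2 h1) h0 (by ring)
  simp only [smul_eq_mul, Real.log_one, mul_zero, zero_add] at h
  rw [show (1 - x) * 1 + x * 2 = 1 + x by ring] at h
  linarith

lemma log_two_mul_totalVar_le (hΛ : ∀ h, (Λ h).PosDef) (hv : ∀ h x, M.predVar (Λ h) x ≤ 1)
    (z : StateActions S A H) : Real.log 2 / 2 * M.totalVar Λ z ≤ M.seqInfo Λ z := by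
  unfold totalVar seqInfo
  rw [Finset.mul_sum]
  refine Finset.sum_le_sum fun h _ => ?_
  have := log_two_mul_le_log_one_add (M.predVar_nonneg (hΛ h) (z h)) (hv h (z h))
  linarith

lemma seqInfo_nonneg (hΛ : ∀ h, (Λ h).PosDef) (z : StateActions S A H) : 0 ≤ M.seqInfo Λ z :=
  Finset.sum_nonneg fun h _ => div_nonneg
    (Real.log_nonneg (by linarith [M.predVar_nonneg (hΛ h) (z h)])) (by norm_num)

lemma seqInfo_le (hΛ : ∀ h, (Λ h).PosDef) (hv : ∀ h x, M.predVar (Λ h) x ≤ 1)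
    (z : StateActions S A H) : M.seqInfo Λ z ≤ H := by
  have : ∀ h, Real.log (1 + M.predVar (Λ h) (z h)) / 2 ≤ 1 := fun h => by
    have h0 := M.predVar_nonneg (hΛ h) (z h)
    have := Real.log_le_sub_one_of_pos (x := 1 + M.predVar (Λ h) (z h)) (by linarith)
    linarith [hv h (z h)]
  unfold seqInfo
  simpa using Finset.sum_le_sum fun h (_ : h ∈ Finset.univ) => this h

lemma integrable_seqInfo (hΛ : ∀ h, (Λ h).PosDef) (hv : ∀ h x, M.predVar (Λ h) x ≤ 1)
    (ρ : Measure (StateActions S A H)) [IsFiniteMeasure ρ] : Integrable (M.seqInfo Λ) ρ := by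
  refine Integrable.of_bound (C := H) (Measurable.aestronglyMeasurable (by fun_prop))
    (ae_of_all _ fun z => ?_)
  rw [Real.norm_eq_abs, abs_of_nonneg (M.seqInfo_nonneg hΛ z)]
  exact M.seqInfo_le hΛ hv z

/-- The constant is `2dH`, from the precision distance, times `2 / log 2`, the price of replacing
predictive variance by half its logarithmic counterpart. -/
lemma regret_thompson_sq_le_info (hΛ : ∀ h, (Λ h).PosDef) (hv : ∀ h x, M.predVar (Λ h) x ≤ 1)
    (piStar : PolicyFamily S A H (Param H d)) :
    M.regret piStar (gaussPi m Λ) (thompson piStar (gaussPi m Λ)) ^ 2 ≤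
      4 * H * d / Real.log 2 *
        ∫ z, M.seqInfo Λ z ∂(M.mixedStateActionLaw (thompson piStar (gaussPi m Λ)) ()) := by
  have hlog : 0 < Real.log 2 := Real.log_pos (by norm_num)
  refine (M.regret_thompson_sq_le hΛ hv piStar).trans ?_
  have h := integral_mono ((M.integrable_totalVar hΛ hv
    (M.mixedStateActionLaw (thompson piStar (gaussPi m Λ)) ())).const_mul (Real.log 2 / 2))
    (M.integrable_seqInfo hΛ hv _) (M.log_two_mul_totalVar_le hΛ hv)
  rw [integral_const_mul] at h
  set J := ∫ z, M.totalVar Λ z ∂(M.mixedStateActionLaw (thompson piStar (gaussPi m Λ)) ())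
  have h2 : J * (2 * d * H) = 4 * H * d / Real.log 2 * (Real.log 2 / 2 * J) := by field_simp; ring
  rw [h2]
  exact mul_le_mul_of_nonneg_left h (by positivity)

/-- A minimiser of the regularised information ratio has small regret relative to its information
gain. -/
lemma regret_sq_le_of_score_le (hΛ : ∀ h, (Λ h).PosDef) (hv : ∀ h x, M.predVar (Λ h) x ≤ 1)
    (piStar : PolicyFamily S A H (Param H d)) {η : ℝ} (hη : 0 < η) (q : MixedPolicy S A H)
    (hq : M.score piStar η (gaussPi m Λ) q ≤
      M.score piStar η (gaussPi m Λ) (thompson piStar (gaussPi m Λ))) :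
    M.regret piStar (gaussPi m Λ) q ^ 2 ≤
      4 * H * d / Real.log 2 * (∫ z, M.seqInfo Λ z ∂(M.mixedStateActionLaw q ()) + η) := by
  have hlog : 0 < Real.log 2 := Real.log_pos (by norm_num)
  have hC : 0 ≤ 4 * H * d / Real.log 2 := by positivity
  -- As `η > 0` and the information is finite, the extended score is an ordinary real quotient and
  -- scores can be compared as reals.
  have hs : ∀ q : MixedPolicy S A H, M.score piStar η (gaussPi m Λ) q =
      ENNReal.ofReal (M.regret piStar (gaussPi m Λ) q ^ 2 /
        (∫ z, M.seqInfo Λ z ∂(M.mixedStateActionLaw q ()) + η)) := fun q => by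
    have hI : 0 ≤ ∫ z, M.seqInfo Λ z ∂(M.mixedStateActionLaw q ()) :=
      integral_nonneg fun z => M.seqInfo_nonneg hΛ z
    rw [score, M.infoGain_gaussPi hΛ hv, ENNReal.ofReal_div_of_pos (by positivity),
      ENNReal.ofReal_add hI hη.le]
    rfl
  have hI : ∀ q, 0 ≤ ∫ z, M.seqInfo Λ z ∂(M.mixedStateActionLaw q ()) := fun q =>
    integral_nonneg fun z => M.seqInfo_nonneg hΛ z
  rw [hs, hs, ENNReal.ofReal_le_ofReal_iff (div_nonneg (sq_nonneg _)
    (add_nonneg (hI _) hη.le))] at hq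
  have h1 := M.regret_thompson_sq_le_info (m := m) hΛ hv piStar
  have h2 : M.regret piStar (gaussPi m Λ) (thompson piStar (gaussPi m Λ)) ^ 2 /
      (∫ z, M.seqInfo Λ z ∂(M.mixedStateActionLaw (thompson piStar (gaussPi m Λ)) ()) + η) ≤
      4 * H * d / Real.log 2 := by
    rw [div_le_iff₀ (by linarith [hI (thompson piStar (gaussPi m Λ))])]
    refine h1.trans (mul_le_mul_of_nonneg_left (by linarith) hC)
  exact (div_le_iff₀ (by linarith [hI q])).1 (hq.trans h2)

end BayesMDP

end

/-- Bayes' rule: conditioning a product measure reweighted by a likelihood. -/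
lemma condDistrib_withDensity_prod {W Ω : Type*} [MeasurableSpace W] [MeasurableSpace Ω]
    [StandardBorelSpace W] [Nonempty W] (β : Measure W) [IsProbabilityMeasure β] (Q : Measure Ω)
    [SFinite Q] {f : W × Ω → ℝ} (hf : Measurable f)
    (hint : ∀ ω, Integrable (fun w => Real.exp (f (w, ω))) β)
    (μ : Measure (W × Ω)) [IsFiniteMeasure μ]
    (hμ : μ = (β.prod Q).withDensity fun p => ENNReal.ofReal (Real.exp (f p))) :
    ∀ᵐ ω ∂(μ.map Prod.snd), condDistrib Prod.fst Prod.snd μ ω = β.tilted fun w => f (w, ω) := by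
  -- The evidence: up to `Q`, the density of the second marginal. It is positive everywhere, so
  -- dividing by it is harmless.
  set Z : Ω → ℝ := fun ω => ∫ w, Real.exp (f (w, ω)) ∂β with hZ
  have hZm : Measurable Z := (StronglyMeasurable.integral_prod_left'
    (f := fun p : W × Ω => Real.exp (f p)) (Measurable.stronglyMeasurable (by fun_prop))).measurable
  have hZpos : ∀ ω, 0 < Z ω := fun ω => integral_exp_pos (hint ω)
  set g : Ω → W → ℝ≥0∞ := fun ω w => ENNReal.ofReal (Real.exp (f (w, ω)) / Z ω) with hg
  have hgm : Measurable (Function.uncurry g) := by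
    unfold Function.uncurry
    simp only [hg]
    fun_prop
  set G : Kernel Ω W := (Kernel.const Ω β).withDensity g with hG
  have hGt : ∀ ω, G ω = β.tilted fun w => f (w, ω) := fun ω => by
    rw [hG, Kernel.withDensity_apply _ hgm]
    rfl
  have : IsMarkovKernel G := ⟨fun ω => by
    rw [hGt]; exact isProbabilityMeasure_tilted (hint ω)⟩
  have key : μ.map (fun p => (p.2, p.1)) = μ.map Prod.snd ⊗ₘ G := by
    refine Measure.ext_of_lintegral _ fun k hk => ?_
    have hlk : Measurable fun ω => ∫⁻ w, k (ω, w) ∂(G ω) := hk.lintegral_kernel_prod_right'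
    have hfm : Measurable fun p => ENNReal.ofReal (Real.exp (f p)) := by fun_prop
    have hlk2 : Measurable fun p : W × Ω => ∫⁻ w, k (p.2, w) ∂(G p.2) := hlk.comp measurable_snd
    rw [lintegral_map hk (by fun_prop), Measure.lintegral_compProd hk,
      lintegral_map hlk (by fun_prop), hμ,
      lintegral_withDensity_eq_lintegral_mul _ hfm (by fun_prop),
      lintegral_withDensity_eq_lintegral_mul _ hfm hlk2,
      lintegral_prod_symm _ (by fun_prop), lintegral_prod_symm _ (hfm.mul hlk2).aemeasurable]
    refine lintegral_congr fun ω => ?_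
    simp only [Pi.mul_apply]
    rw [lintegral_mul_const _ (by fun_prop), ← ofReal_integral_eq_lintegral_ofReal (hint ω)
      (ae_of_all _ fun w => (Real.exp_pos _).le)]
    have h1 : ∫⁻ w, k (ω, w) ∂(G ω) = ∫⁻ w, g ω w * k (ω, w) ∂β := by
      rw [hG, Kernel.lintegral_withDensity _ hgm _ (by fun_prop)]
      rfl
    rw [h1, ← lintegral_const_mul' _ _ ENNReal.ofReal_ne_top]
    refine lintegral_congr fun w => ?_
    rw [hg, ← mul_assoc, ← ENNReal.ofReal_mul (hZpos ω).le]
    congr 2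
    field_simp [(hZpos ω).ne']
  -- The tilted kernel disintegrates the joint law, and disintegrations are almost surely unique.
  have h := condDistrib_ae_eq_of_measure_eq_compProd (μ := μ) (Y := Prod.fst) Prod.snd
    measurable_fst.aemeasurable key
  filter_upwards [h] with ω hω
  rw [hω, hGt]

/-! ### The likelihood of a history of online episodes. -/

noncomputable section

variable {S A : Type*} [MeasurableSpace S] [MeasurableSpace A] {H d : ℕ}

namespace BayesMDP

variable (M : BayesMDP S A H d)

/-- Law of the first `t` online episodes when the observations are replaced by pure noise. -/
def refLaw (alg : Algorithm S A H) : (t : ℕ) → Measure (Fin t → Episode S A H)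
  | 0 => Measure.dirac Fin.elim0
  | t + 1 => ((refLaw alg t) ⊗ₘ
      ((M.mixedStateActionLaw (alg t)) ×ₖ Kernel.const _ (noise H))).map
        (fun z => Fin.snoc (α := fun _ => Episode S A H) z.1 z.2)

instance (alg : Algorithm S A H) (t : ℕ) : IsProbabilityMeasure (M.refLaw alg t) := by
  induction t with
  | zero => unfold refLaw; infer_instance
  | succ t ih =>
    unfold refLaw
    exact Measure.isProbabilityMeasure_map (measurable_snoc t).aemeasurable

/-- Log-likelihood of the parameter given a history of online episodes. -/
def histLogLik {t : ℕ} (p : Param H d × (Fin t → Episode S A H)) : ℝ :=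
  ∑ s, M.logLik (p.2 s) p.1

@[fun_prop]
lemma measurable_histLogLik {t : ℕ} :
    Measurable (M.histLogLik : Param H d × (Fin t → Episode S A H) → ℝ) := by
  unfold histLogLik
  refine Finset.measurable_sum _ fun s _ => ?_
  exact M.measurable_logLik.comp (f := fun p : Param H d × (Fin t → Episode S A H) =>
    (p.2 s, p.1)) (by fun_prop)

lemma histLogLik_snoc {t : ℕ} (w : Param H d) (ω : Fin t → Episode S A H) (e : Episode S A H) :
    M.histLogLik (w, Fin.snoc (α := fun _ => Episode S A H) ω e) =
      M.histLogLik (w, ω) + M.logLik e w := by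
  simp [histLogLik, Fin.sum_univ_castSucc]

lemma measurable_jointStep (t : ℕ) :
    Measurable fun z : (Param H d × (Fin t → Episode S A H)) × Episode S A H =>
      (z.1.1, Fin.snoc (α := fun _ => Episode S A H) z.1.2 z.2) :=
  (measurable_fst.comp measurable_fst).prodMk ((measurable_snoc t).comp
    ((measurable_snd.comp measurable_fst).prodMk measurable_snd))

lemma lintegral_jointLaw_succ (D : OfflineData S A H) (alg : Algorithm S A H) (t : ℕ)
    {f : Param H d × (Fin (t + 1) → Episode S A H) → ℝ≥0∞} (hf : Measurable f) :
    ∫⁻ z, f z ∂(M.jointLaw D alg (t + 1)) =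
      ∫⁻ z, ∫⁻ e, f (z.1, Fin.snoc (α := fun _ => Episode S A H) z.2 e)
        ∂(M.episodeLaw (alg t) (z.2, z.1)) ∂(M.jointLaw D alg t) := by
  rw [jointLaw, lintegral_map hf (measurable_jointStep t)]
  exact Measure.lintegral_compProd (hf.comp (measurable_jointStep t))

/-- Adaptivity does no harm: given the past, policy and dynamics are independent of `w`, so their
contribution stays in the reference law and the likelihood is the product of the noise shifts of all
episodes. -/
lemma jointLaw_eq_withDensity (D : OfflineData S A H) (alg : Algorithm S A H) (t : ℕ) :
    M.jointLaw D alg t = ((M.offlinePosterior D).prod (M.refLaw alg t)).withDensity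
      fun p => ENNReal.ofReal (Real.exp (M.histLogLik p)) := by
  induction t with
  | zero =>
    have h : (fun p : Param H d × (Fin 0 → Episode S A H) =>
        ENNReal.ofReal (Real.exp (M.histLogLik p))) = 1 := by
      funext p; simp [histLogLik]
    rw [h, withDensity_one]
    rfl
  | succ t ih =>
    refine Measure.ext_of_lintegral _ fun f hf => ?_
    have hstep := measurable_jointStep (S := S) (A := A) (H := H) (d := d) t
    have hl : Measurable fun p : Param H d × (Fin (t + 1) → Episode S A H) =>
      ENNReal.ofReal (Real.exp (M.histLogLik p)) := by fun_prop
    have hl' : Measurable fun p : Param H d × (Fin t → Episode S A H) =>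
      ENNReal.ofReal (Real.exp (M.histLogLik p)) := by fun_prop
    have hfs : Measurable fun z : Param H d × (Fin t → Episode S A H) =>
        ∫⁻ e, f (z.1, Fin.snoc (α := fun _ => Episode S A H) z.2 e)
          ∂(M.episodeLaw (alg t) (z.2, z.1)) :=
      Measurable.lintegral_kernel_prod_right' (κ := (M.episodeLaw (alg t)).comap
        (fun z : Param H d × (Fin t → Episode S A H) => (z.2, z.1)) (by fun_prop))
        (hf.comp hstep)
    rw [M.lintegral_jointLaw_succ D alg t hf, ih,
      lintegral_withDensity_eq_lintegral_mul _ hl' hfs,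
      lintegral_withDensity_eq_lintegral_mul _ hl hf,
      lintegral_prod _ (hl'.mul hfs).aemeasurable, lintegral_prod _ (hl.mul hf).aemeasurable]
    refine lintegral_congr fun w => ?_
    have hf1 : Measurable fun ω : Fin (t + 1) → Episode S A H =>
      ENNReal.ofReal (Real.exp (M.histLogLik (w, ω))) * f (w, ω) := by fun_prop
    rw [refLaw]
    simp only [Pi.mul_apply]
    rw [lintegral_map hf1 (measurable_snoc t)]
    refine Eq.trans ?_ (Measure.lintegral_compProd (hf1.comp (measurable_snoc t))).symm
    refine lintegral_congr fun ω => ?_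
    have hf2 : Measurable fun e : Episode S A H =>
        f (w, Fin.snoc (α := fun _ => Episode S A H) ω e) :=
      hf.comp (measurable_prodMk_left.comp ((measurable_snoc t).comp measurable_prodMk_left))
    have hl2 : Measurable fun e : Episode S A H => ENNReal.ofReal (Real.exp (M.logLik e w)) := by
      fun_prop
    rw [episodeLaw_eq_withDensity, lintegral_withDensity_eq_lintegral_mul _ hl2 hf2,
      ← lintegral_const_mul' _ _ ENNReal.ofReal_ne_top, Kernel.prod_apply, Kernel.const_apply]
    refine lintegral_congr fun e => ?_
    simp only [Pi.mul_apply, Function.comp_apply]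
    rw [histLogLik_snoc, Real.exp_add, ENNReal.ofReal_mul (Real.exp_pos _).le, mul_assoc]

/-! ### The posterior is Gaussian -/

/-- Precision matrices of the posterior given the history `ω`. -/
def postPrec (D : OfflineData S A H) {t : ℕ} (ω : Fin t → Episode S A H) (h : Fin H) :
    Matrix (Fin d) (Fin d) ℝ :=
  M.gram D h + ∑ s, vecMulVec (M.φ ((ω s).1 h)).ofLp (M.φ ((ω s).1 h)).ofLp

lemma gram_quadratic (D : OfflineData S A H) (h : Fin H) (v : Fin d → ℝ) :
    v ⬝ᵥ M.gram D h *ᵥ v = M.prec * (v ⬝ᵥ v) +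
      ∑ i : Fin (D.n h), ((M.φ (D.pt h i)).ofLp ⬝ᵥ v) ^ 2 := by
  simp only [gram, add_mulVec, smul_mulVec, one_mulVec, sum_mulVec, vecMulVec_mulVec,
    dotProduct_add, dotProduct_smul, dotProduct_sum, smul_eq_mul]
  congr 1
  refine Finset.sum_congr rfl fun i _ => ?_
  simp [dotProduct_comm v]
  ring

lemma postPrec_quadratic (D : OfflineData S A H) {t : ℕ} (ω : Fin t → Episode S A H) (h : Fin H)
    (v : Fin d → ℝ) :
    v ⬝ᵥ M.postPrec D ω h *ᵥ v = M.prec * (v ⬝ᵥ v) +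
      ∑ i : Fin (D.n h), ((M.φ (D.pt h i)).ofLp ⬝ᵥ v) ^ 2 +
      ∑ s, ((M.φ ((ω s).1 h)).ofLp ⬝ᵥ v) ^ 2 := by
  rw [postPrec, add_mulVec, dotProduct_add, gram_quadratic, sum_mulVec, dotProduct_sum]
  congr 1
  refine Finset.sum_congr rfl fun i _ => ?_
  simp [vecMulVec_mulVec, dotProduct_comm v]
  ring

lemma prec_pos : 0 < M.prec := zero_lt_one.trans_le M.one_le_prec

lemma posDef_gram (D : OfflineData S A H) (h : Fin H) : (M.gram D h).PosDef := by
  refine (PosDef.one.smul M.prec_pos).add_posSemidef (posSemidef_sum _ fun i _ => ?_)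
  simpa using posSemidef_vecMulVec_self_star (M.φ (D.pt h i)).ofLp

lemma posDef_postPrec (D : OfflineData S A H) {t : ℕ} (ω : Fin t → Episode S A H) (h : Fin H) :
    (M.postPrec D ω h).PosDef := by
  refine (M.posDef_gram D h).add_posSemidef (posSemidef_sum _ fun i _ => ?_)
  simpa using posSemidef_vecMulVec_self_star (M.φ ((ω i).1 h)).ofLp

lemma feature_dotProduct_self_le (x : S × A) : (M.φ x).ofLp ⬝ᵥ (M.φ x).ofLp ≤ 1 := by
  have h : (M.φ x).ofLp ⬝ᵥ (M.φ x).ofLp = ‖M.φ x‖ ^ 2 := by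
    rw [EuclideanSpace.real_norm_sq_eq, dotProduct]
    simp [sq]
  rw [h]
  exact pow_le_one₀ (norm_nonneg _) (M.φ_norm_le x)

lemma predVar_le {Λ : Matrix (Fin d) (Fin d) ℝ} (hΛ : Λ.PosDef) {c : ℝ} (hc : 0 < c)
    (h : ∀ v : Fin d → ℝ, c * (v ⬝ᵥ v) ≤ v ⬝ᵥ Λ *ᵥ v) (x : S × A) : M.predVar Λ x ≤ 1 / c :=
  (dotProduct_inv_mulVec_le hΛ hc h _).trans
    (div_le_div_of_nonneg_right (M.feature_dotProduct_self_le x) hc.le)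

/-- Data only increase the precision, so it dominates the prior precision and hence the identity;
features have norm at most one. This is where `1 ≤ λ` is needed. -/
lemma predVar_postPrec_le_one (D : OfflineData S A H) {t : ℕ} (ω : Fin t → Episode S A H)
    (h : Fin H) (x : S × A) : M.predVar (M.postPrec D ω h) x ≤ 1 := by
  have := M.predVar_le (M.posDef_postPrec D ω h) zero_lt_one (fun v => ?_) x
  · simpa using this
  · rw [postPrec_quadratic]
    have h1 : 0 ≤ v ⬝ᵥ v := by simpa using dotProduct_self_star_nonneg v
    have h2 : 0 ≤ ∑ i : Fin (D.n h), ((M.φ (D.pt h i)).ofLp ⬝ᵥ v) ^ 2 :=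
      Finset.sum_nonneg fun _ _ => sq_nonneg _
    have h3 : 0 ≤ ∑ s, ((M.φ ((ω s).1 h)).ofLp ⬝ᵥ v) ^ 2 :=
      Finset.sum_nonneg fun _ _ => sq_nonneg _
    nlinarith [M.one_le_prec]

lemma prior_eq : M.prior = Measure.pi fun _ : Fin H =>
    (volume : Measure (EuclideanSpace ℝ (Fin d))).tilted
      fun u => -(M.prec * (u.ofLp ⬝ᵥ u.ofLp) / 2) := by
  have hpd : (M.prec • (1 : Matrix (Fin d) (Fin d) ℝ)).PosDef := PosDef.one.smul M.prec_pos
  have hinv : (M.prec • (1 : Matrix (Fin d) (Fin d) ℝ))⁻¹ = M.prec⁻¹ • 1 := by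
    refine inv_eq_left_inv ?_
    rw [smul_mul_smul_comm, inv_mul_cancel₀ M.prec_pos.ne', one_mul, one_smul]
  have h := tilted_quadratic_eq hpd 0
  rw [mulVec_zero, WithLp.toLp_zero, hinv] at h
  rw [prior, ← h]
  congr 1
  funext _
  congr 1
  funext u
  simp [smul_mulVec]

/-- Stage-wise log-likelihood of the offline data and of the history `ω`. -/
def stageLogLik (D : OfflineData S A H) {t : ℕ} (ω : Fin t → Episode S A H) (h : Fin H)
    (u : EuclideanSpace ℝ (Fin d)) : ℝ :=
  -(∑ i : Fin (D.n h), (D.obs h i - inner ℝ (M.φ (D.pt h i)) u) ^ 2 / 2) +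
    ∑ s, (inner ℝ (M.φ ((ω s).1 h)) u * (ω s).2 h - inner ℝ (M.φ ((ω s).1 h)) u ^ 2 / 2)

lemma lik_term_le (x y : ℝ) : x * y - x ^ 2 / 2 ≤ y ^ 2 / 2 := by nlinarith [sq_nonneg (x - y)]

lemma integrable_exp_stageLogLik (D : OfflineData S A H) {t : ℕ} (ω : Fin t → Episode S A H)
    (h : Fin H) (μ : Measure (EuclideanSpace ℝ (Fin d))) [IsFiniteMeasure μ] :
    Integrable (fun u => Real.exp (M.stageLogLik D ω h u)) μ := by
  refine Integrable.of_bound (C := Real.exp (∑ s, (ω s).2 h ^ 2 / 2))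
    (Measurable.aestronglyMeasurable (by unfold stageLogLik; fun_prop)) (ae_of_all _ fun u => ?_)
  rw [Real.norm_eq_abs, Real.abs_exp, Real.exp_le_exp, stageLogLik]
  have h1 : 0 ≤ ∑ i : Fin (D.n h), (D.obs h i - inner ℝ (M.φ (D.pt h i)) u) ^ 2 / 2 :=
    Finset.sum_nonneg fun _ _ => by positivity
  have h2 := Finset.sum_le_sum fun s (_ : s ∈ Finset.univ) =>
    lik_term_le (inner ℝ (M.φ ((ω s).1 h)) u) ((ω s).2 h)
  linarith

lemma integrable_exp_histLogLik {t : ℕ} (ω : Fin t → Episode S A H) (μ : Measure (Param H d))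
    [IsFiniteMeasure μ] : Integrable (fun w => Real.exp (M.histLogLik (w, ω))) μ := by
  refine Integrable.of_bound (C := Real.exp (∑ s, ∑ h, (ω s).2 h ^ 2 / 2))
    (Measurable.aestronglyMeasurable (by fun_prop)) (ae_of_all _ fun w => ?_)
  rw [Real.norm_eq_abs, Real.abs_exp, Real.exp_le_exp, histLogLik]
  exact Finset.sum_le_sum fun s _ => Finset.sum_le_sum fun h _ => lik_term_le _ _

/-- Prior, offline data and online episodes contribute exponents that add up to a quadratic in each
`w_h`, with quadratic part `postPrec` and linear coefficient `b h`. The mean is left existential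
because regret and information are bounded through the precision alone. -/
lemma offlinePosterior_tilted_eq (D : OfflineData S A H) {t : ℕ} (ω : Fin t → Episode S A H) :
    ∃ m, (M.offlinePosterior D).tilted (fun w => M.histLogLik (w, ω)) =
      gaussPi m (M.postPrec D ω) := by
  set b : Fin H → Fin d → ℝ := fun h =>
    ∑ i : Fin (D.n h), D.obs h i • (M.φ (D.pt h i)).ofLp +
      ∑ s, (ω s).2 h • (M.φ ((ω s).1 h)).ofLp with hb
  set f0 : EuclideanSpace ℝ (Fin d) → ℝ := fun u => -(M.prec * (u.ofLp ⬝ᵥ u.ofLp) / 2) with hf0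
  refine ⟨fun h => WithLp.toLp 2 ((M.postPrec D ω h)⁻¹ *ᵥ b h), ?_⟩
  have hint : Integrable (fun w => Real.exp (-(∑ h, ∑ i : Fin (D.n h),
      (D.obs h i - inner ℝ (M.φ (D.pt h i)) (w h)) ^ 2 / 2))) M.prior := by
    refine Integrable.of_bound (C := 1) (Measurable.aestronglyMeasurable (by fun_prop))
      (ae_of_all _ fun w => ?_)
    rw [Real.norm_eq_abs, Real.abs_exp, Real.exp_le_one_iff, neg_nonpos]
    positivity
  have hsum : ((fun w : Param H d => -(∑ h, ∑ i : Fin (D.n h),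
      (D.obs h i - inner ℝ (M.φ (D.pt h i)) (w h)) ^ 2 / 2)) + fun w => M.histLogLik (w, ω)) =
      fun w => ∑ h, M.stageLogLik D ω h (w h) := by
    funext w
    simp only [Pi.add_apply, stageLogLik, histLogLik, logLik]
    rw [Finset.sum_comm, Finset.sum_add_distrib, Finset.sum_neg_distrib]
  have hprob : IsProbabilityMeasure ((volume : Measure (EuclideanSpace ℝ (Fin d))).tilted f0) := by
    have hpd : (M.prec • (1 : Matrix (Fin d) (Fin d) ℝ)).PosDef := PosDef.one.smul M.prec_pos
    have h := tilted_quadratic_eq hpd 0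
    have h2 : (fun w : EuclideanSpace ℝ (Fin d) => (0 : Fin d → ℝ) ⬝ᵥ w.ofLp -
        (w.ofLp ⬝ᵥ (M.prec • (1 : Matrix (Fin d) (Fin d) ℝ)) *ᵥ w.ofLp) / 2) = f0 := by
      funext u; simp [smul_mulVec, hf0]
    rw [h2] at h
    rw [h]
    infer_instance
  have hint0 : Integrable (fun u => Real.exp (f0 u))
      (volume : Measure (EuclideanSpace ℝ (Fin d))) := by
    -- Tilting by a non-integrable exponential gives the zero measure by convention, which is not a
    -- probability measure.
    by_contra hni
    rw [tilted_of_not_integrable hni] at hprob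
    exact hprob.ne_zero _ rfl
  rw [offlinePosterior, tilted_tilted hint, hsum, prior_eq,
    pi_tilted (fun _ : Fin H => (volume : Measure (EuclideanSpace ℝ (Fin d))).tilted f0)
      (M.stageLogLik D ω) (fun h => M.integrable_exp_stageLogLik D ω h _), gaussPi]
  congr 1
  funext h
  rw [tilted_tilted hint0, ← tilted_quadratic_eq (M.posDef_postPrec D ω h),
    -- The constant collects the terms `obs² / 2` of the offline squares, which do not involve the
    -- parameter.
    ← tilted_add_const volume (fun w : EuclideanSpace ℝ (Fin d) => b h ⬝ᵥ w.ofLp -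
      (w.ofLp ⬝ᵥ M.postPrec D ω h *ᵥ w.ofLp) / 2) (-(∑ i : Fin (D.n h), D.obs h i ^ 2 / 2))]
  congr 1
  funext u
  have hin : ∀ x, inner ℝ (M.φ x) u = (M.φ x).ofLp ⬝ᵥ u.ofLp := fun x => by
    rw [EuclideanSpace.inner_eq_star_dotProduct, star_trivial, dotProduct_comm]
  simp only [Pi.add_apply, hf0, stageLogLik, postPrec_quadratic, hin, hb, add_dotProduct,
    sum_dotProduct, smul_dotProduct, smul_eq_mul]
  have e1 : ∑ i : Fin (D.n h), (D.obs h i - (M.φ (D.pt h i)).ofLp ⬝ᵥ u.ofLp) ^ 2 / 2 =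
      ∑ i : Fin (D.n h), D.obs h i ^ 2 / 2 -
        ∑ i : Fin (D.n h), D.obs h i * ((M.φ (D.pt h i)).ofLp ⬝ᵥ u.ofLp) +
        (∑ i : Fin (D.n h), ((M.φ (D.pt h i)).ofLp ⬝ᵥ u.ofLp) ^ 2) / 2 := by
    rw [Finset.sum_div, ← Finset.sum_sub_distrib, ← Finset.sum_add_distrib]
    exact Finset.sum_congr rfl fun i _ => by ring
  have e2 : ∑ s, ((M.φ ((ω s).1 h)).ofLp ⬝ᵥ u.ofLp * (ω s).2 h -
      ((M.φ ((ω s).1 h)).ofLp ⬝ᵥ u.ofLp) ^ 2 / 2) =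
      ∑ s, (ω s).2 h * ((M.φ ((ω s).1 h)).ofLp ⬝ᵥ u.ofLp) -
        (∑ s, ((M.φ ((ω s).1 h)).ofLp ⬝ᵥ u.ofLp) ^ 2) / 2 := by
    rw [Finset.sum_div, ← Finset.sum_sub_distrib]
    exact Finset.sum_congr rfl fun i _ => by ring
  rw [e1, e2]
  ring

lemma posterior_ae_eq (D : OfflineData S A H) (alg : Algorithm S A H) (t : ℕ) :
    ∀ᵐ ω ∂((M.jointLaw D alg t).map Prod.snd),
      ∃ m, M.posterior D alg t ω = gaussPi m (M.postPrec D ω) := by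
  have h := condDistrib_withDensity_prod (M.offlinePosterior D) (M.refLaw alg t)
    M.measurable_histLogLik (fun ω => M.integrable_exp_histLogLik ω _) (M.jointLaw D alg t)
    (M.jointLaw_eq_withDensity D alg t)
  filter_upwards [h] with ω hω
  obtain ⟨m, hm⟩ := M.offlinePosterior_tilted_eq D ω
  exact ⟨m, by rw [posterior, hω, hm]⟩

end BayesMDP

namespace BayesMDP

variable (M : BayesMDP S A H d) {X : Type*} [MeasurableSpace X]

/-! ### Marginals of the joint law -/

@[fun_prop]
lemma measurable_init {E : Type*} [MeasurableSpace E] (t : ℕ) :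
    Measurable fun ω : Fin (t + 1) → E => (Fin.init ω : Fin t → E) :=
  measurable_pi_lambda _ fun _ => measurable_pi_apply _

@[fun_prop]
lemma measurable_take {E : Type*} [MeasurableSpace E] {t T : ℕ} (h : t ≤ T) :
    Measurable fun ω : Fin T → E => (Fin.take t h ω : Fin t → E) :=
  measurable_pi_lambda _ fun _ => measurable_pi_apply _

lemma jointLaw_map_init (D : OfflineData S A H) (alg : Algorithm S A H) (t : ℕ) :
    (M.jointLaw D alg (t + 1)).map (fun z => (Fin.init z.2 : Fin t → Episode S A H)) =
      (M.jointLaw D alg t).map Prod.snd := by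
  refine Measure.ext_of_lintegral _ fun f hf => ?_
  rw [lintegral_map hf (by fun_prop), M.lintegral_jointLaw_succ D alg t (by fun_prop),
    lintegral_map hf measurable_snd]
  simp

/-- Later episodes do not change the law of earlier ones. This transfers integrals over the full
horizon to the horizon at which a regret or an information gain is defined. -/
lemma jointLaw_map_take (D : OfflineData S A H) (alg : Algorithm S A H) {t T : ℕ} (h : t ≤ T) :
    (M.jointLaw D alg T).map (fun z => (Fin.take t h z.2 : Fin t → Episode S A H)) =
      (M.jointLaw D alg t).map Prod.snd := by
  induction T, h using Nat.le_induction with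
  | base => rfl
  | succ T h ih =>
    rw [← ih]
    have h1 : (fun z : Param H d × (Fin T → Episode S A H) =>
        (Fin.take t h z.2 : Fin t → Episode S A H)) = (Fin.take t h) ∘ Prod.snd := rfl
    rw [h1, ← Measure.map_map (measurable_take h) measurable_snd, ← M.jointLaw_map_init D alg T,
      Measure.map_map (measurable_take h) (by fun_prop)]
    rfl

lemma episodeLaw_map_fst (p : MixedFamily S A H X) (x : X) (w : Param H d) :
    (M.episodeLaw p (x, w)).map Prod.fst = M.mixedStateActionLaw p x := by
  refine Measure.ext_of_lintegral _ fun f hf => ?_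
  rw [lintegral_map hf measurable_fst, M.lintegral_episodeLaw p x w (by fun_prop),
    lintegral_prod _ (by fun_prop)]
  simp

/-- Integrating a function of the first `t` episodes and of the next state-action sequence. -/
lemma integral_jointLaw_succ (D : OfflineData S A H) (alg : Algorithm S A H) (t : ℕ)
    {F : (Fin t → Episode S A H) × StateActions S A H → ℝ} (hF : Measurable F)
    {B : ℝ} (hB : ∀ q, |F q| ≤ B) :
    ∫ z, F (Fin.init z.2, (z.2 (Fin.last t)).1) ∂(M.jointLaw D alg (t + 1)) =
      ∫ z, ∫ q, F (z.2, q) ∂(M.mixedStateActionLaw (alg t) z.2) ∂(M.jointLaw D alg t) := by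
  have hG : Measurable fun z : Param H d × (Fin (t + 1) → Episode S A H) =>
    F (Fin.init z.2, (z.2 (Fin.last t)).1) := by fun_prop
  have hGs := hG.comp (measurable_jointStep (S := S) (A := A) (H := H) (d := d) t)
  rw [jointLaw, integral_map (measurable_jointStep t).aemeasurable hG.aestronglyMeasurable]
  refine (Measure.integral_compProd (Integrable.of_bound (C := B) hGs.aestronglyMeasurable
    (ae_of_all _ fun z => hB _))).trans ?_
  refine integral_congr_ae (ae_of_all _ fun z => ?_)
  have h := integral_map (μ := M.episodeLaw (alg t) (z.2, z.1)) measurable_fst.aemeasurable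
    (f := fun q => F (z.2, q)) (hF.comp measurable_prodMk_left).aestronglyMeasurable
  rw [M.episodeLaw_map_fst] at h
  refine Eq.trans ?_ h.symm
  simp only [Kernel.comap_apply, Prod.swap, Function.comp_apply, Fin.init_snoc, Fin.snoc_last]

/-! ### Accumulated information -/

/-- Half the sum over the stages of the log-determinants of the posterior precision matrices. -/
def potential (D : OfflineData S A H) {t : ℕ} (ω : Fin t → Episode S A H) : ℝ :=
  ∑ h, Real.log (M.postPrec D ω h).det / 2

lemma measurable_postPrec_apply (D : OfflineData S A H) (t : ℕ) (h : Fin H) (i j : Fin d) :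
    Measurable fun ω : Fin t → Episode S A H => M.postPrec D ω h i j := by
  simp only [postPrec, Matrix.add_apply, Matrix.sum_apply, vecMulVec_apply]
  refine measurable_const.add (Finset.measurable_sum _ fun s _ => ?_)
  have h1 : Measurable fun ω : Fin t → Episode S A H => M.φ ((ω s).1 h) :=
    M.φ_measurable.comp (by fun_prop)
  exact ((measurable_pi_apply i).comp ((WithLp.measurable_ofLp 2 _).comp h1)).mul
    ((measurable_pi_apply j).comp ((WithLp.measurable_ofLp 2 _).comp h1))

lemma measurable_postPrec_det (D : OfflineData S A H) (t : ℕ) (h : Fin H) :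
    Measurable fun ω : Fin t → Episode S A H => (M.postPrec D ω h).det := by
  simp only [Matrix.det_apply']
  exact Finset.measurable_sum _ fun σ _ => measurable_const.mul
    (Finset.measurable_prod _ fun i _ => M.measurable_postPrec_apply D t h (σ i) i)

@[fun_prop]
lemma measurable_potential (D : OfflineData S A H) (t : ℕ) :
    Measurable fun ω : Fin t → Episode S A H => M.potential D ω :=
  Finset.measurable_sum _ fun h _ =>
    (Real.measurable_log.comp (M.measurable_postPrec_det D t h)).div_const 2

lemma postPrec_snoc (D : OfflineData S A H) {t : ℕ} (ω : Fin t → Episode S A H)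
    (e : Episode S A H) (h : Fin H) :
    M.postPrec D (Fin.snoc (α := fun _ => Episode S A H) ω e) h =
      M.postPrec D ω h + vecMulVec (M.φ (e.1 h)).ofLp (M.φ (e.1 h)).ofLp := by
  simp [postPrec, Fin.sum_univ_castSucc, add_assoc]

/-- The rank-one determinant formula at each stage: the information of an episode is the exact
increment of the potential, for every realisation. -/
lemma potential_snoc (D : OfflineData S A H) {t : ℕ} (ω : Fin t → Episode S A H)
    (e : Episode S A H) :
    M.potential D (Fin.snoc (α := fun _ => Episode S A H) ω e) =
      M.potential D ω + M.seqInfo (M.postPrec D ω) e.1 := by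
  unfold potential seqInfo
  rw [← Finset.sum_add_distrib]
  refine Finset.sum_congr rfl fun h _ => ?_
  have hpd := M.posDef_postPrec D ω h
  have h0 := M.predVar_nonneg hpd (e.1 h)
  rw [postPrec_snoc, det_add_vecMulVec_self hpd, ← predVar,
    Real.log_mul hpd.det_pos.ne' (by linarith)]
  ring

lemma potential_init (D : OfflineData S A H) {t : ℕ} (ω : Fin (t + 1) → Episode S A H) :
    M.seqInfo (M.postPrec D (Fin.init ω : Fin t → Episode S A H)) (ω (Fin.last t)).1 =
      M.potential D ω - M.potential D (Fin.init ω : Fin t → Episode S A H) := by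
  have h := M.potential_snoc D (Fin.init ω : Fin t → Episode S A H) (ω (Fin.last t))
  rw [Fin.snoc_init_self] at h
  linarith

/-- Value of the potential before any online episode. -/
def potentialZero (D : OfflineData S A H) : ℝ := ∑ h, Real.log (M.gram D h).det / 2

/-- A crude bound of `H` per episode, serving integrability only. -/
lemma abs_potential_sub_le (D : OfflineData S A H) {t : ℕ} (ω : Fin t → Episode S A H) :
    |M.potential D ω - M.potentialZero D| ≤ t * H := by
  induction t with
  | zero => simp [potential, potentialZero, postPrec]
  | succ t ih =>
    have h := M.potential_init D ω
    have h0 := M.seqInfo_nonneg (M.posDef_postPrec D (Fin.init ω : Fin t → Episode S A H))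
      (ω (Fin.last t)).1
    have h1 := M.seqInfo_le (M.posDef_postPrec D (Fin.init ω : Fin t → Episode S A H))
      (M.predVar_postPrec_le_one D _) (ω (Fin.last t)).1
    have h2 := abs_le.1 (ih (Fin.init ω : Fin t → Episode S A H))
    rw [abs_le]
    push_cast
    constructor <;> nlinarith [h2.1, h2.2]

lemma integrable_potential (D : OfflineData S A H) {Ω : Type*} [MeasurableSpace Ω]
    (μ : Measure Ω) [IsFiniteMeasure μ] {t : ℕ} {f : Ω → Fin t → Episode S A H}
    (hf : Measurable f) : Integrable (fun x => M.potential D (f x)) μ := by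
  refine Integrable.of_bound (C := t * H + |M.potentialZero D|)
    (Measurable.aestronglyMeasurable (by fun_prop)) (ae_of_all _ fun x => ?_)
  have h := M.abs_potential_sub_le D (f x)
  have h2 := abs_sub_abs_le_abs_sub (M.potential D (f x)) (M.potentialZero D)
  rw [Real.norm_eq_abs]
  linarith

/-- Expected information gain of episode `t + 1` given the history `ω`. -/
def stepInfo (D : OfflineData S A H) (alg : Algorithm S A H) (t : ℕ)
    (ω : Fin t → Episode S A H) : ℝ :=
  ∫ z, M.seqInfo (M.postPrec D ω) z ∂(M.mixedStateActionLaw (alg t) ω)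

/-- Written as a difference of potentials, the information involves only determinants, and the
inverse of a varying matrix is avoided. The observations inserted as `0` are immaterial, since the
potential ignores observations. -/
lemma measurable_seqInfo_postPrec (D : OfflineData S A H) (t : ℕ) :
    Measurable fun q : (Fin t → Episode S A H) × StateActions S A H =>
      M.seqInfo (M.postPrec D q.1) q.2 := by
  have h : ∀ q : (Fin t → Episode S A H) × StateActions S A H,
      M.seqInfo (M.postPrec D q.1) q.2 =
        M.potential D (Fin.snoc (α := fun _ => Episode S A H) q.1 (q.2, 0)) -
          M.potential D q.1 := fun q => by
    rw [potential_snoc]; ring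
  simp_rw [h]
  have h1 : Measurable fun q : (Fin t → Episode S A H) × StateActions S A H =>
      (Fin.snoc (α := fun _ => Episode S A H) q.1 (q.2, 0) : Fin (t + 1) → Episode S A H) :=
    (measurable_snoc t).comp (f := fun q : (Fin t → Episode S A H) × StateActions S A H =>
      (q.1, ((q.2, 0) : Episode S A H))) (by fun_prop)
  exact ((M.measurable_potential D (t + 1)).comp h1).sub (by fun_prop)

lemma stepInfo_nonneg (D : OfflineData S A H) (alg : Algorithm S A H) (t : ℕ)
    (ω : Fin t → Episode S A H) : 0 ≤ M.stepInfo D alg t ω :=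
  integral_nonneg fun z => M.seqInfo_nonneg (M.posDef_postPrec D ω) z

lemma stepInfo_le (D : OfflineData S A H) (alg : Algorithm S A H) (t : ℕ)
    (ω : Fin t → Episode S A H) : M.stepInfo D alg t ω ≤ H := by
  have h := integral_mono (M.integrable_seqInfo (M.posDef_postPrec D ω)
    (M.predVar_postPrec_le_one D ω) (M.mixedStateActionLaw (alg t) ω)) (integrable_const (H : ℝ))
    (M.seqInfo_le (M.posDef_postPrec D ω) (M.predVar_postPrec_le_one D ω))
  simpa [stepInfo] using h

lemma measurable_stepInfo (D : OfflineData S A H) (alg : Algorithm S A H) (t : ℕ) :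
    Measurable (M.stepInfo D alg t) :=
  (StronglyMeasurable.integral_kernel_prod_right' (κ := M.mixedStateActionLaw (alg t))
    (M.measurable_seqInfo_postPrec D t).stronglyMeasurable).measurable

lemma integral_stepInfo (D : OfflineData S A H) (alg : Algorithm S A H) (t : ℕ) :
    ∫ z, M.stepInfo D alg t z.2 ∂(M.jointLaw D alg t) =
      ∫ z, M.potential D z.2 ∂(M.jointLaw D alg (t + 1)) -
        ∫ z, M.potential D z.2 ∂(M.jointLaw D alg t) := by
  have h := M.integral_jointLaw_succ D alg t (M.measurable_seqInfo_postPrec D t) (B := H)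
    fun q => by
      rw [abs_of_nonneg (M.seqInfo_nonneg (M.posDef_postPrec D q.1) q.2)]
      exact M.seqInfo_le (M.posDef_postPrec D q.1) (M.predVar_postPrec_le_one D q.1) q.2
  have h2 : ∫ z, M.potential D (Fin.init z.2 : Fin t → Episode S A H)
      ∂(M.jointLaw D alg (t + 1)) = ∫ z, M.potential D z.2 ∂(M.jointLaw D alg t) := by
    have hm := M.measurable_potential D t
    have h4 := integral_map (μ := M.jointLaw D alg t) measurable_snd.aemeasurable
      (f := fun ω => M.potential D ω) hm.aestronglyMeasurable
    have h5 := integral_map (μ := M.jointLaw D alg (t + 1))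
      (φ := fun z => (Fin.init z.2 : Fin t → Episode S A H)) (by fun_prop)
      (f := fun ω => M.potential D ω) hm.aestronglyMeasurable
    rw [← h4, ← h5, M.jointLaw_map_init D alg t]
  simp only [potential_init] at h
  rw [integral_sub (M.integrable_potential D _ measurable_snd)
    (M.integrable_potential D _ (by fun_prop)), h2] at h
  exact h.symm

/-- Each expected gain is an expected increment of the potential, so the sum telescopes from the
deterministic offline value. -/
lemma sum_integral_stepInfo (D : OfflineData S A H) (alg : Algorithm S A H) (T : ℕ) :
    ∑ t ∈ Finset.range T, ∫ z, M.stepInfo D alg t z.2 ∂(M.jointLaw D alg t) =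
      ∫ z, (M.potential D z.2 - M.potentialZero D) ∂(M.jointLaw D alg T) := by
  simp_rw [integral_stepInfo]
  have h0 : ∀ z : Param H d × (Fin 0 → Episode S A H),
      M.potential D z.2 = M.potentialZero D := fun z => by
    simp [potential, potentialZero, postPrec]
  rw [Finset.sum_range_sub (fun t => ∫ z, M.potential D z.2 ∂(M.jointLaw D alg t)),
    integral_sub (M.integrable_potential D _ measurable_snd) (integrable_const _)]
  simp [h0]

lemma potential_sub_le (D : OfflineData S A H) {t : ℕ} (ω : Fin t → Episode S A H)
    {c : Fin H → ℝ} (hc : ∀ h, 0 < c h) :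
    M.potential D ω - M.potentialZero D ≤
      ∑ h, ((d + ∑ s, M.predVar (M.gram D h) ((ω s).1 h)) / c h - d + d * Real.log (c h)) / 2 := by
  unfold potential potentialZero
  rw [← Finset.sum_sub_distrib]
  refine Finset.sum_le_sum fun h _ => ?_
  have hA := M.posDef_gram D h
  have h1 := log_det_sub_le hA (M.posDef_postPrec D ω h) (hc h)
  have h2 : ((M.gram D h)⁻¹ * M.postPrec D ω h).trace =
      d + ∑ s, M.predVar (M.gram D h) ((ω s).1 h) := by
    rw [postPrec, mul_add, nonsing_inv_mul _ ((isUnit_iff_isUnit_det _).1 hA.isUnit), trace_add,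
      trace_one, Matrix.mul_sum, trace_sum]
    simp_rw [trace_inv_mul_vecMulVec]
    simp [predVar]
  rw [h2] at h1
  linarith

/-- The parameter `c` is chosen as an upper bound for the average eigenvalue of `gram⁻¹ * postPrec`:
each predictive variance is at most `1 / λ_min`, so the trace is at most `d c` and only `d log c`
survives. The bound holds for every history. -/
lemma potential_sub_le_log (hd : 0 < d) (D : OfflineData S A H) {T : ℕ}
    (ω : Fin T → Episode S A H) :
    M.potential D ω - M.potentialZero D ≤
      ∑ h, d * Real.log (1 + T / (d * lambdaMin (M.gram D h))) / 2 := by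
  have hd' : (0 : ℝ) < d := by exact_mod_cast hd
  have hl : ∀ h, 0 < lambdaMin (M.gram D h) := fun h => lambdaMin_pos hd (M.posDef_gram D h)
  have hc : ∀ h, 0 < 1 + T / (d * lambdaMin (M.gram D h)) := fun h => by
    have := hl h
    positivity
  refine (M.potential_sub_le D ω hc).trans (Finset.sum_le_sum fun h _ => ?_)
  have hpos := hl h
  have h1 : ∑ s, M.predVar (M.gram D h) ((ω s).1 h) ≤ T * (1 / lambdaMin (M.gram D h)) := by
    have := Finset.sum_le_sum fun s (_ : s ∈ (Finset.univ : Finset (Fin T))) =>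
      M.predVar_le (M.posDef_gram D h) hpos (lambdaMin_mul_le (M.posDef_gram D h).isHermitian)
        ((ω s).1 h)
    simpa using this
  have h2 : (d + ∑ s, M.predVar (M.gram D h) ((ω s).1 h)) /
      (1 + T / (d * lambdaMin (M.gram D h))) ≤ d := by
    rw [div_le_iff₀ (hc h)]
    refine (add_le_add le_rfl h1).trans (le_of_eq ?_)
    field_simp
  linarith

/-- At `c = 1` the terms in `d` cancel and the bound is linear in the features' outer products, so
its expectation involves only the visitation covariance. -/
lemma potential_sub_le_sum (D : OfflineData S A H) {T : ℕ} (ω : Fin T → Episode S A H) :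
    M.potential D ω - M.potentialZero D ≤
      ∑ h, (∑ s, M.predVar (M.gram D h) ((ω s).1 h)) / 2 := by
  refine (M.potential_sub_le D ω (c := fun _ => 1) fun _ => one_pos).trans
    (Finset.sum_le_sum fun h _ => le_of_eq ?_)
  simp

lemma isHermitian_visitation (D : OfflineData S A H) (alg : Algorithm S A H) (T : ℕ)
    (h : Fin H) : (M.visitation D alg T h).IsHermitian := by
  ext i j
  simp only [conjTranspose_apply, visitation, of_apply, star_trivial]
  simp_rw [mul_comm (M.φ _ j) (M.φ _ i)]

lemma abs_feature_le (x : S × A) (i : Fin d) : |M.φ x i| ≤ 1 := by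
  have := PiLp.norm_apply_le (M.φ x) i
  rw [Real.norm_eq_abs] at this
  exact this.trans (M.φ_norm_le x)

/-- The predictive variance is linear in `φ φᵀ`, so averaging over time and histories replaces `φ
φᵀ` by the visitation covariance; the factor `T` undoes the time average. -/
lemma integral_sum_predVar (D : OfflineData S A H) (alg : Algorithm S A H) {T : ℕ} (hT : 0 < T)
    (h : Fin H) (Λ : Matrix (Fin d) (Fin d) ℝ) :
    Integrable (fun z : Param H d × (Fin T → Episode S A H) =>
      ∑ s, M.predVar Λ ((z.2 s).1 h)) (M.jointLaw D alg T) ∧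
    ∫ z, ∑ s, M.predVar Λ ((z.2 s).1 h) ∂(M.jointLaw D alg T) =
      T * (Λ⁻¹ * M.visitation D alg T h).trace := by
  have hφ := M.φ_measurable
  have hT' : (T : ℝ) ≠ 0 := by exact_mod_cast hT.ne'
  have hI : ∀ (s : Fin T) (i j : Fin d), Integrable
      (fun z : Param H d × (Fin T → Episode S A H) =>
        M.φ ((z.2 s).1 h) i * M.φ ((z.2 s).1 h) j) (M.jointLaw D alg T) := fun s i j => by
    refine Integrable.of_bound (C := 1) (Measurable.aestronglyMeasurable (by fun_prop))
      (ae_of_all _ fun z => ?_)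
    rw [Real.norm_eq_abs, abs_mul]
    exact mul_le_one₀ (M.abs_feature_le _ i) (abs_nonneg _) (M.abs_feature_le _ j)
  have hexp : ∀ (s : Fin T) (z : Param H d × (Fin T → Episode S A H)),
      M.predVar Λ ((z.2 s).1 h) = ∑ i, ∑ j, Λ⁻¹ i j *
        (M.φ ((z.2 s).1 h) i * M.φ ((z.2 s).1 h) j) := fun s z => by
    simp only [predVar, dotProduct, mulVec, Finset.mul_sum]
    exact Finset.sum_congr rfl fun i _ => Finset.sum_congr rfl fun j _ => by ring
  have hI2 : ∀ s i, Integrable (fun z : Param H d × (Fin T → Episode S A H) =>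
      ∑ j, Λ⁻¹ i j * (M.φ ((z.2 s).1 h) i * M.φ ((z.2 s).1 h) j)) (M.jointLaw D alg T) :=
    fun s i => integrable_finsetSum _ fun j _ => (hI s i j).const_mul _
  have hI3 : ∀ s, Integrable (fun z : Param H d × (Fin T → Episode S A H) =>
      M.predVar Λ ((z.2 s).1 h)) (M.jointLaw D alg T) := fun s => by
    simp_rw [hexp]
    exact integrable_finsetSum _ fun i _ => hI2 s i
  refine ⟨integrable_finsetSum _ fun s _ => hI3 s, ?_⟩
  rw [integral_finsetSum _ fun s _ => hI3 s]
  have h1 : ∀ s, ∫ z, M.predVar Λ ((z.2 s).1 h) ∂(M.jointLaw D alg T) =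
      ∑ i, ∑ j, Λ⁻¹ i j * ∫ z, M.φ ((z.2 s).1 h) i * M.φ ((z.2 s).1 h) j
        ∂(M.jointLaw D alg T) := fun s => by
    simp_rw [hexp]
    refine (integral_finsetSum _ fun i _ => hI2 s i).trans ?_
    refine Finset.sum_congr rfl fun i _ => ?_
    refine (integral_finsetSum _ fun j _ => (hI s i j).const_mul _).trans ?_
    exact Finset.sum_congr rfl fun j _ => integral_const_mul _ _
  simp_rw [h1]
  rw [Finset.sum_comm, trace, Finset.mul_sum]
  refine Finset.sum_congr rfl fun i _ => ?_
  rw [Finset.sum_comm, diag_apply, mul_apply, Finset.mul_sum]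
  refine Finset.sum_congr rfl fun j _ => ?_
  rw [← Finset.mul_sum, visitation, of_apply]
  simp_rw [mul_comm (M.φ _ j) (M.φ _ i)]
  field_simp

/-- Normalising the Gram matrix by `n_h` multiplies its inverse by `n_h`, which accounts for the
division of the stage coverage. -/
lemma trace_inv_gram_mul_visitation_le (D : OfflineData S A H) (alg : Algorithm S A H) (T : ℕ)
    (h : Fin H) :
    ((M.gram D h)⁻¹ * M.visitation D alg T h).trace ≤
      d * (M.stageCoverage D alg T h / D.n h) := by
  have hn : (0 : ℝ) < D.n h := by exact_mod_cast D.one_le_n h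
  have hA : ((D.n h : ℝ)⁻¹ • M.gram D h).PosDef := (M.posDef_gram D h).smul (inv_pos.2 hn)
  have h1 := trace_inv_mul_le hA (M.isHermitian_visitation D alg T h)
  have hinv : ((D.n h : ℝ)⁻¹ • M.gram D h)⁻¹ = (D.n h : ℝ) • (M.gram D h)⁻¹ := by
    refine inv_eq_left_inv ?_
    rw [smul_mul_smul_comm, mul_inv_cancel₀ hn.ne', one_smul,
      nonsing_inv_mul _ ((isUnit_iff_isUnit_det _).1 (M.posDef_gram D h).isUnit)]
  rw [hinv, smul_mul, trace_smul, smul_eq_mul] at h1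
  rw [← mul_div_assoc, le_div_iff₀ hn, mul_comm]
  exact h1

lemma sum_stepInfo_le_logTerm (hH : 0 < H) (hd : 0 < d) (D : OfflineData S A H)
    (alg : Algorithm S A H) (T : ℕ) :
    ∑ t ∈ Finset.range T, ∫ z, M.stepInfo D alg t z.2 ∂(M.jointLaw D alg t) ≤
      d * H / 2 * M.logTerm D T := by
  have hH' : (H : ℝ) ≠ 0 := by exact_mod_cast hH.ne'
  rw [sum_integral_stepInfo]
  refine (integral_mono ((M.integrable_potential D _ measurable_snd).sub (integrable_const _))
    (integrable_const _) fun z => M.potential_sub_le_log hd D z.2).trans (le_of_eq ?_)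
  simp only [integral_const, probReal_univ, one_smul, logTerm]
  rw [Finset.mul_sum, Finset.mul_sum]
  refine Finset.sum_congr rfl fun h _ => ?_
  field_simp

lemma sum_stepInfo_le_coverage (hH : 0 < H) (D : OfflineData S A H)
    (alg : Algorithm S A H) {T : ℕ} (hT : 0 < T) :
    ∑ t ∈ Finset.range T, ∫ z, M.stepInfo D alg t z.2 ∂(M.jointLaw D alg t) ≤
      d * H / 2 * (T * (M.coverage D alg T / D.total)) := by
  have hH' : (H : ℝ) ≠ 0 := by exact_mod_cast hH.ne'
  have htot : (D.total : ℝ) ≠ 0 := by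
    have h0 : 0 < D.total := Finset.sum_pos (fun h _ => D.one_le_n h) ⟨⟨0, hH⟩, Finset.mem_univ _⟩
    exact_mod_cast h0.ne'
  have hI := fun h => M.integral_sum_predVar D alg hT h (M.gram D h)
  rw [sum_integral_stepInfo]
  refine (integral_mono ((M.integrable_potential D _ measurable_snd).sub (integrable_const _))
    (integrable_finsetSum _ fun h _ => (hI h).1.div_const 2)
    fun z => M.potential_sub_le_sum D z.2).trans ?_
  rw [integral_finsetSum _ fun h _ => (hI h).1.div_const 2]
  simp_rw [integral_div, fun h => (hI h).2]
  have h1 : d * H / 2 * (T * (M.coverage D alg T / D.total)) =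
      ∑ h, T * (d * (M.stageCoverage D alg T h / D.n h)) / 2 := by
    rw [coverage, ← Finset.sum_div, ← Finset.mul_sum, ← Finset.mul_sum]
    field_simp
  rw [h1]
  refine Finset.sum_le_sum fun h _ => ?_
  have := mul_le_mul_of_nonneg_left (M.trace_inv_gram_mul_visitation_le D alg T h)
    (Nat.cast_nonneg (α := ℝ) T)
  linarith

/-! ### The regret bound -/

lemma regret_sq_le (D : OfflineData S A H) (piStar : PolicyFamily S A H (Param H d))
    (C : Set (Policy S A H)) (hC : ∀ w, piStar.at w ∈ C) {η : ℝ} (hη : 0 < η) {T : ℕ}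
    (alg : Algorithm S A H) (hIDS : M.IsIDS D piStar C η T alg) {t : ℕ} (ht : t < T) :
    ∀ᵐ ω ∂((M.jointLaw D alg t).map Prod.snd),
      M.regret piStar (M.posterior D alg t ω) ((alg t).at ω) ^ 2 ≤
        4 * H * d / Real.log 2 * (M.stepInfo D alg t ω + η) := by
  filter_upwards [hIDS t ht, M.posterior_ae_eq D alg t] with ω h1 h2
  obtain ⟨m, hm⟩ := h2
  rw [hm] at h1 ⊢
  have h3 := M.regret_sq_le_of_score_le (M.posDef_postPrec D ω) (M.predVar_postPrec_le_one D ω)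
    piStar hη ((alg t).at ω) (h1.2 _ (thompson_inClosure piStar _ hC))
  rwa [mixedStateActionLaw_at] at h3

lemma measurable_stepRegret (D : OfflineData S A H) (piStar : PolicyFamily S A H (Param H d))
    (alg : Algorithm S A H) (t : ℕ) :
    Measurable fun ω => M.regret piStar (M.posterior D alg t ω) ((alg t).at ω) :=
  M.measurable_regret_at piStar (condDistrib Prod.fst Prod.snd (M.jointLaw D alg t)) (alg t)

variable {M} in
lemma integrable_stepRegret {D : OfflineData S A H} {piStar : PolicyFamily S A H (Param H d)}
    {alg : Algorithm S A H} {c η : ℝ} {t : ℕ} (hc : 0 ≤ c)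
    (h : ∀ᵐ ω ∂((M.jointLaw D alg t).map Prod.snd),
      M.regret piStar (M.posterior D alg t ω) ((alg t).at ω) ^ 2 ≤
        c * (M.stepInfo D alg t ω + η)) :
    Integrable (fun ω => M.regret piStar (M.posterior D alg t ω) ((alg t).at ω))
      ((M.jointLaw D alg t).map Prod.snd) := by
  have : IsProbabilityMeasure ((M.jointLaw D alg t).map Prod.snd) :=
    Measure.isProbabilityMeasure_map measurable_snd.aemeasurable
  refine Integrable.of_bound (C := √(c * (H + η)))
    (M.measurable_stepRegret D piStar alg t).aestronglyMeasurable ?_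
  filter_upwards [h] with ω hω
  refine Real.abs_le_sqrt (hω.trans (mul_le_mul_of_nonneg_left ?_ hc))
  linarith [M.stepInfo_le D alg t ω]

variable {M} in
-- Subadditivity of the square root isolates `√(c η)`, and Young's inequality linearises the rest in
-- the information. One weight `a` common to all episodes, optimised after summation, does the work
-- of Jensen together with Cauchy–Schwarz over the episodes.
lemma integral_stepRegret_le {D : OfflineData S A H} {piStar : PolicyFamily S A H (Param H d)}
    {alg : Algorithm S A H} {c η : ℝ} {t : ℕ} (hc : 0 ≤ c) (hη : 0 ≤ η)
    (h : ∀ᵐ ω ∂((M.jointLaw D alg t).map Prod.snd),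
      M.regret piStar (M.posterior D alg t ω) ((alg t).at ω) ^ 2 ≤
        c * (M.stepInfo D alg t ω + η)) {a : ℝ} (ha : 0 < a) :
    ∫ ω, M.regret piStar (M.posterior D alg t ω) ((alg t).at ω)
        ∂((M.jointLaw D alg t).map Prod.snd) ≤
      c / (2 * a) * ∫ z, M.stepInfo D alg t z.2 ∂(M.jointLaw D alg t) +
        (a / 2 + √(c * η)) := by
  have : IsProbabilityMeasure ((M.jointLaw D alg t).map Prod.snd) :=
    Measure.isProbabilityMeasure_map measurable_snd.aemeasurable
  have hm := (M.measurable_stepInfo D alg t).aestronglyMeasurable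
    (μ := (M.jointLaw D alg t).map Prod.snd)
  have hi : Integrable (M.stepInfo D alg t) ((M.jointLaw D alg t).map Prod.snd) :=
    Integrable.of_bound (C := H) hm (ae_of_all _ fun ω => by
      rw [Real.norm_eq_abs, abs_of_nonneg (M.stepInfo_nonneg D alg t ω)]
      exact M.stepInfo_le D alg t ω)
  refine (integral_mono_ae (integrable_stepRegret hc h)
    ((hi.const_mul (c / (2 * a))).add (integrable_const (a / 2 + √(c * η)))) ?_).trans
      (le_of_eq ?_)
  · filter_upwards [h] with ω hω
    have hI := M.stepInfo_nonneg D alg t ω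
    have h1 := (le_abs_self _).trans (Real.abs_le_sqrt hω)
    refine h1.trans ?_
    have h2 : √(c * (M.stepInfo D alg t ω + η)) ≤
        √(c * M.stepInfo D alg t ω) + √(c * η) := by
      rw [mul_add]
      rw [Real.sqrt_le_left (by positivity), add_sq, Real.sq_sqrt (mul_nonneg hc hI),
        Real.sq_sqrt (mul_nonneg hc hη)]
      linarith [mul_nonneg (Real.sqrt_nonneg (c * M.stepInfo D alg t ω))
        (Real.sqrt_nonneg (c * η))]
    have h3 : √(c * M.stepInfo D alg t ω) ≤ c / (2 * a) * M.stepInfo D alg t ω + a / 2 := by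
      have h4 : c / (2 * a) * M.stepInfo D alg t ω + a / 2 =
          (c * M.stepInfo D alg t ω + a ^ 2) / (2 * a) := by field_simp
      have h5 := Real.sq_sqrt (mul_nonneg hc hI)
      rw [h4, le_div_iff₀ (by positivity)]
      nlinarith [sq_nonneg (√(c * M.stepInfo D alg t ω) - a)]
    simp only [Pi.add_apply]
    linarith
  · rw [integral_add' (hi.const_mul _) (integrable_const _), integral_const_mul,
      integral_map measurable_snd.aemeasurable hm]
    simp

lemma cumRegret_bound (D : OfflineData S A H) (piStar : PolicyFamily S A H (Param H d))
    (C : Set (Policy S A H)) (hC : ∀ w, piStar.at w ∈ C) {η : ℝ} (hη : 0 < η) {T : ℕ}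
    (alg : Algorithm S A H) (hIDS : M.IsIDS D piStar C η T alg) :
    Integrable (fun z => M.cumRegret D piStar alg T z.2) (M.jointLaw D alg T) ∧
      ∀ a > 0, M.bayesRegret D piStar alg T ≤
        4 * H * d / Real.log 2 / (2 * a) *
          ∑ t ∈ Finset.range T, ∫ z, M.stepInfo D alg t z.2 ∂(M.jointLaw D alg t) +
        T * (a / 2 + √(4 * H * d / Real.log 2 * η)) := by
  have hlog : 0 < Real.log 2 := Real.log_pos (by norm_num)
  have hc : 0 ≤ 4 * H * d / Real.log 2 := by positivity
  have hsq := fun t : Fin T => M.regret_sq_le D piStar C hC hη alg hIDS t.2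
  have hmap := fun t : Fin T => M.jointLaw_map_take D alg t.2.le
  have hI : ∀ t : Fin T, Integrable (fun z : Param H d × (Fin T → Episode S A H) =>
      M.regret piStar (M.posterior D alg t (Fin.take t t.2.le z.2))
        ((alg t).at (Fin.take t t.2.le z.2))) (M.jointLaw D alg T) := fun t => by
    have h := integrable_stepRegret hc (hsq t)
    rw [← hmap t] at h
    exact h.comp_measurable (f := fun z : Param H d × (Fin T → Episode S A H) =>
      (Fin.take t t.2.le z.2 : Fin t → Episode S A H)) (by fun_prop)
  refine ⟨integrable_finsetSum _ fun t _ => hI t, fun a ha => ?_⟩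
  unfold bayesRegret cumRegret
  rw [integral_finsetSum _ fun t _ => hI t]
  have hle : ∀ t : Fin T, ∫ z, M.regret piStar (M.posterior D alg t (Fin.take t t.2.le z.2))
      ((alg t).at (Fin.take t t.2.le z.2)) ∂(M.jointLaw D alg T) ≤
      4 * H * d / Real.log 2 / (2 * a) *
        ∫ z, M.stepInfo D alg t z.2 ∂(M.jointLaw D alg t) +
        (a / 2 + √(4 * H * d / Real.log 2 * η)) := fun t => by
    have h := integral_stepRegret_le hc hη.le (hsq t) ha
    rw [← hmap t, integral_map (by fun_prop)
      (M.measurable_stepRegret D piStar alg t).aestronglyMeasurable] at h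
    exact h
  refine (Finset.sum_le_sum fun t _ => hle t).trans (le_of_eq ?_)
  rw [Finset.sum_add_distrib, ← Finset.mul_sum, Fin.sum_univ_eq_sum_range
    (fun t => ∫ z, M.stepInfo D alg t z.2 ∂(M.jointLaw D alg t))]
  simp
  ring

lemma bayesRegret_le_of_info_le (D : OfflineData S A H)
    (piStar : PolicyFamily S A H (Param H d)) (C : Set (Policy S A H))
    (hC : ∀ w, piStar.at w ∈ C) {η : ℝ} (hη : 0 < η) {T : ℕ}
    (alg : Algorithm S A H) (hIDS : M.IsIDS D piStar C η T alg) {B : ℝ}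
    (hB : ∑ t ∈ Finset.range T, ∫ z, M.stepInfo D alg t z.2 ∂(M.jointLaw D alg t) ≤
      d * H / 2 * B) :
    M.bayesRegret D piStar alg T ≤
      √(2 / Real.log 2) * (H * d * √(T * B)) + T * √(4 * H * d / Real.log 2 * η) := by
  have hlog : 0 < Real.log 2 := Real.log_pos (by norm_num)
  have hc : 0 ≤ 4 * H * d / Real.log 2 := by positivity
  have hbound := (M.cumRegret_bound D piStar C hC hη alg hIDS).2
  set E := ∑ t ∈ Finset.range T, ∫ z, M.stepInfo D alg t z.2 ∂(M.jointLaw D alg t)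
  have hE : 0 ≤ E := Finset.sum_nonneg fun t _ =>
    integral_nonneg fun z => M.stepInfo_nonneg D alg t z.2
  -- With the `η` cost moved over, the bounds for all `a` read `x ≤ (a / 2) T + C_w E / (2a)`,
  -- whence `x² ≤ T C_w E`. A negative `x` has to be treated apart, as squaring would lose its sign.
  set x := M.bayesRegret D piStar alg T - T * √(4 * H * d / Real.log 2 * η) with hx
  suffices hxle : x ≤ √(2 / Real.log 2) * (H * d * √(T * B)) by linarith
  rcases le_total x 0 with h0 | h0
  · exact h0.trans (by positivity)
  have h1 : x ^ 2 ≤ T * (4 * H * d / Real.log 2 * E) := by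
    refine sq_le_of_forall_le h0 (by positivity) (by positivity) fun a ha => ?_
    have h2 := hbound a ha
    have h3 : 4 * H * d / Real.log 2 * E / (2 * a) = 4 * H * d / Real.log 2 / (2 * a) * E := by
      ring
    rw [h3]
    linarith
  have h2 : x ^ 2 ≤ 2 / Real.log 2 * ((H * d) ^ 2 * (T * B)) := by
    refine h1.trans ?_
    -- The constants combine as `(4Hd / log 2) · (dH / 2) = (2 / log 2) (Hd)²`.
    have h3 : 2 / Real.log 2 * (((H : ℝ) * d) ^ 2 * (T * B)) =
        T * (4 * H * d / Real.log 2 * (d * H / 2 * B)) := by ring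
    rw [h3]
    gcongr
  refine (le_abs_self x).trans ((Real.abs_le_sqrt h2).trans (le_of_eq ?_))
  rw [Real.sqrt_mul (by positivity), Real.sqrt_mul (by positivity), Real.sqrt_sq (by positivity)]

end BayesMDP

end

end OffToOn

theorem mainTheorem5 {S A : Type*} [MeasurableSpace S] [MeasurableSpace A] {H d T : ℕ}
    (hH : 0 < H) (hd : 0 < d) (hT : 0 < T)
    (M : OffToOn.BayesMDP S A H d) (D : OffToOn.OfflineData S A H)
    (piStar : OffToOn.PolicyFamily S A H (OffToOn.Param H d)) (hopt : M.IsOptimal piStar)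
    (C : Set (OffToOn.Policy S A H)) (hC : ∀ w, piStar.at w ∈ C)
    (η : ℝ) (hη : 0 < η)
    (alg : OffToOn.Algorithm S A H) (hIDS : M.IsIDS D piStar C η T alg) :
    Integrable (fun z => M.cumRegret D piStar alg T z.2) (M.jointLaw D alg T) ∧
      M.bayesRegret D piStar alg T ≤
        √(2 / Real.log 2) * (H * d *
          min √(T * M.logTerm D T) (T * √(M.coverage D alg T / D.total))) +
        T * √(4 * H * d / Real.log 2 * η) := by
  refine ⟨(M.cumRegret_bound D piStar C hC hη alg hIDS).1, ?_⟩
  rcases min_choice √(T * M.logTerm D T) (T * √(M.coverage D alg T / D.total)) with h | h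
  · rw [h]
    exact M.bayesRegret_le_of_info_le D piStar C hC hη alg hIDS
      (M.sum_stepInfo_le_logTerm hH hd D alg T)
  · rw [h]
    have h1 := M.bayesRegret_le_of_info_le D piStar C hC hη alg hIDS
      (M.sum_stepInfo_le_coverage hH D alg hT)
    -- The coverage bound on the information is itself linear in `T`, so `T²` leaves the square root
    -- as `T`.
    rwa [← mul_assoc (T : ℝ), Real.sqrt_mul (mul_self_nonneg _),
      Real.sqrt_mul_self (Nat.cast_nonneg T)] at h1
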